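/- Let $C$ be a smooth oriented knot in $S^3$, let $U$ be an unknot, let $P$ be a smooth oriented knot (a pattern) in the solid torus $S^1\times D^2$, and let $m,r\in\mathbb Z$. For a knot $J\subset S^3$ and a pattern $R$, the $n$-twisted satellite $S_n(J,R)\subset S^3$ is the image of $R$ under an orientation-preserving smooth embedding $\varphi:S^1\times D^2\to S^3$ with $\varphi(\cdot,0)=J$ and framing $\mathrm{lk}\big(\varphi(\cdot,0),\varphi(\cdot,1)\big)=n$; it is well defined up to isotopy. Let $\overline C$ be the mirror image of $C$ with reversed orientation. Regard $S_r(C,P)$ also as a pattern: identify $S^1\times D^2$ with the standard unknotted, $0$-framed solid torus in $S^3$, tie $C$ as a local knot into its core $S^1\times\{0\}$ (that is, replace the core by a knot in $S^1\times D^2$ that agrees with the core near one meridian disc, meets this disc only there, and is isotopic to $C$ in $S^3$), and take the image of $P$ under an orientation-preserving embedding of $S^1\times D^2$ into itself whose core is that knot and whose framing, measured in $S^3$, is $r$. (Equivalently, the solid torus is the complement in $S^3$ of a neighbourhood of a meridian of the companion torus of $S_r(C,P)$.) Then the knot $S_m(\overline C,S_r(C,P))$ is smoothly concordant to $S_{m+r}(U,P)$,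 and hence to the knot in $S^3$ obtained by placing $P$, with $m+r$ full twists inserted, in the standard unknotted, $0$-framed solid torus: there is a smooth, neatly embedded annulus in $S^3\times[0,1]$ whose oriented boundary components are the first knot in $S^3\times\{0\}$ and the second in $S^3\times\{1\}$. -/

import Mathlib

open scoped ContDiff

/-! The circle is `ℝ / ℤ`: a map out of the circle is a `1`-periodic map on `ℝ`, and a map into
`S¹ × D²` is given by a lift to the universal cover `ℝ × D²`, whose deck group `ℤ` translates the
first coordinate.  The 3-sphere is the unit sphere of `ℝ⁴`, oriented as the boundary of the unit
ball. -/

/-- The ambient space of the 3-sphere. -/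
abbrev R4 : Type := EuclideanSpace ℝ (Fin 4)

/-- The 3-sphere. -/
abbrev S3 : Set R4 := Metric.sphere (0 : R4) 1

/-- The universal cover `ℝ × D²` of the solid torus `S¹ × D²`; `D²` is the closed unit disc. -/
def solidTorus : Set (ℝ × ℂ) := {p | ‖p.2‖ ≤ 1}

/-- A smooth oriented knot in the 3-sphere: a smooth embedding of the circle `ℝ / ℤ`. -/
structure IsKnot (K : ℝ → R4) : Prop where
  smooth : ContDiff ℝ ∞ K
  periodic : ∀ t, K (t + 1) = K t
  mem_sphere : ∀ t, K t ∈ S3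
  injective : ∀ s t, K s = K t → ∃ n : ℤ, t = s + n
  immersion : ∀ t, deriv K t ≠ 0

/-- A pattern: a smooth oriented knot in `S¹ × D²`, given by its lift to `ℝ × D²`.  The integer
`l` is its winding number (its algebraic intersection number with the disc `D²`). -/
structure IsPattern (P : ℝ → ℝ × ℂ) : Prop where
  smooth : ContDiff ℝ ∞ P
  periodic : ∃ l : ℤ, ∀ t, P (t + 1) = P t + ((l : ℝ), 0)
  mem_solidTorus : ∀ t, P t ∈ solidTorus
  injective : ∀ s t, (∃ k : ℤ, P t = P s + ((k : ℝ), 0)) → ∃ n : ℤ, t = s + n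
  immersion : ∀ t, deriv P t ≠ 0

/-- Two knots are (ambient) isotopic: a smooth path `H` of diffeomorphisms of the 3-sphere, with
inverses `G`, starts at the identity and ends at a diffeomorphism that carries `K` to `K'`. -/
def Isotopic (K K' : ℝ → R4) : Prop :=
  ∃ H G : ℝ × R4 → R4,
    (∀ s ∈ Set.Icc (0 : ℝ) 1, ∀ x ∈ S3,
      ContDiffAt ℝ ∞ H (s, x) ∧ ContDiffAt ℝ ∞ G (s, x) ∧
      H (s, x) ∈ S3 ∧ G (s, x) ∈ S3 ∧ G (s, H (s, x)) = x ∧ H (s, G (s, x)) = x) ∧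
    (∀ x ∈ S3, H (0, x) = x) ∧
    ∀ t, H (1, K t) = K' t

/-- An orientation-preserving smooth embedding of the solid torus `S¹ × D²` into the 3-sphere,
written as a map on `ℝ × ℂ` that is `1`-periodic in the first variable and whose values off
`ℝ × D²` are irrelevant.  The determinant of the outward normal of the sphere and the three partial
derivatives is positive, so that the map is an orientation-preserving local diffeomorphism. -/
structure IsTube (φ : ℝ × ℂ → R4) : Prop where
  smooth : ∀ p ∈ solidTorus, ContDiffAt ℝ ∞ φ p
  periodic : ∀ t w, φ (t + 1, w) = φ (t, w)
  mem_sphere : ∀ p ∈ solidTorus, φ p ∈ S3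
  injective : ∀ p ∈ solidTorus, ∀ q ∈ solidTorus, φ p = φ q → ∃ n : ℤ, q = p + ((n : ℝ), 0)
  oriented : ∀ p ∈ solidTorus,
    0 < Matrix.det (Matrix.of fun i j : Fin 4 =>
      (![φ p, fderiv ℝ φ p (1, 0), fderiv ℝ φ p (0, 1), fderiv ℝ φ p (0, Complex.I)] i) j)

/-- The loop `γ : ℝ / ℤ → S¹` has degree `n`. -/
def HasDegree (γ : ℝ → Circle) (n : ℤ) : Prop :=
  ∃ θ : ℝ → ℝ, Continuous θ ∧ (∀ t, γ t = Circle.exp (2 * Real.pi * θ t)) ∧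
    ∀ t, θ (t + 1) = θ t + n

/-- The framing of the embedded solid torus `φ` is `r`: the linking number of the core `φ (·, 0)`
with the longitude `φ (·, 1)` is `r`.  The linking number is read off from a map `f` from the
complement of the core to the circle that has degree `1` on the positive meridian of the core
(a generator of the first cohomology of the complement). -/
def HasFraming (φ : ℝ × ℂ → R4) (r : ℤ) : Prop :=
  ∃ f : R4 → Circle,
    ContinuousOn f (S3 \ Set.range fun t : ℝ => φ (t, 0)) ∧
    HasDegree (fun t => f (φ (0, (Circle.exp (2 * Real.pi * t) : ℂ)))) 1 ∧
    HasDegree (fun t => f (φ (t, 1))) r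

/-- `K` is (isotopic to) the `r`-twisted satellite `S_r(C, P)` with companion `C` and pattern `P`:
the image of `P` under an embedding of the solid torus with core `C` and framing `r`. -/
def IsSatellite (r : ℤ) (C : ℝ → R4) (P : ℝ → ℝ × ℂ) (K : ℝ → R4) : Prop :=
  ∃ φ : ℝ × ℂ → R4, IsTube φ ∧ (∀ t, φ (t, 0) = C t) ∧ HasFraming φ r ∧
    Isotopic (fun t => φ (P t)) K

/-- The standard unknotted, `0`-framed solid torus
`(t, w) ↦ (exp (2πit), w) / √(1 + |w|²)` in `S³ ⊂ ℂ² = ℝ⁴`. -/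
noncomputable def stdTorus (p : ℝ × ℂ) : R4 :=
  (Real.sqrt (1 + ‖p.2‖ ^ 2))⁻¹ •
    !₂[Real.cos (2 * Real.pi * p.1), Real.sin (2 * Real.pi * p.1), p.2.re, p.2.im]

/-- A knot is an unknot if it is isotopic to the great circle that is the core of the standard
solid torus. -/
def IsUnknot (U : ℝ → R4) : Prop :=
  IsKnot U ∧ Isotopic (fun t => stdTorus (t, 0)) U

/-- The knot `C̄`, for which `C # C̄` is ribbon: the mirror image of `C` with reversed
orientation. -/
noncomputable def mirrorReverse (C : ℝ → R4) : ℝ → R4 :=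
  fun t => !₂[C (-t) 0, C (-t) 1, C (-t) 2, -C (-t) 3]

/-- A locally knotted core of `S¹ × D²`: a knot of winding number one that agrees with the core
`S¹ × {0}` near the disc `{0} × D²` and meets this disc nowhere else.  Cutting `S¹ × D²` along the
disc turns it into a knotted arc in the 3-ball `[0, 1] × D²`. -/
structure IsLocallyKnottedCore (κ : ℝ → ℝ × ℂ) : Prop where
  isPattern : IsPattern κ
  standard : ∃ ε : ℝ, 0 < ε ∧ ∀ t, |t| ≤ ε → κ t = (t, 0)
  arc : ∀ t ∈ Set.Ioo (0 : ℝ) 1, (κ t).1 ∈ Set.Ioo (0 : ℝ) 1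

/-- `Q` is the satellite `S_r(C, P)` regarded as a pattern, that is, as a knot in the solid torus
complementary to a meridian of the companion torus: the companion `C` is tied into the core of
`S¹ × D²` as a local knot, and `Q` is the image of `P` under an embedding `φ` of the solid torus
into itself along that local knot.  The framing of `φ`, as seen in the 3-sphere, is `r`.
Here `φ` is a lift to `ℝ × D²`. -/
def IsSatellitePattern (r : ℤ) (C : ℝ → R4) (P Q : ℝ → ℝ × ℂ) : Prop :=
  ∃ φ : ℝ × ℂ → ℝ × ℂ,
    (∀ p ∈ solidTorus, ContDiffAt ℝ ∞ φ p) ∧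
    (∀ t w, φ (t + 1, w) = φ (t, w) + (1, 0)) ∧
    Set.MapsTo φ solidTorus solidTorus ∧
    IsLocallyKnottedCore (fun t => φ (t, 0)) ∧
    Isotopic (fun t => stdTorus (φ (t, 0))) C ∧
    IsTube (fun p => stdTorus (φ p)) ∧
    HasFraming (fun p => stdTorus (φ p)) r ∧
    ∀ t, Q t = φ (P t)

/-- `n` full twists of the solid torus. -/
noncomputable def fullTwists (n : ℤ) (p : ℝ × ℂ) : ℝ × ℂ :=
  (p.1, (Circle.exp (2 * Real.pi * (n * p.1)) : ℂ) * p.2)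

/-- Smooth concordance of oriented knots: a smooth, neat embedding `A` of the annulus
`S¹ × [0, 1]` into `S³ × [0, 1]` that restricts to `K₀ × {0}` and `K₁ × {1}` on the boundary. -/
def SmoothlyConcordant (K₀ K₁ : ℝ → R4) : Prop :=
  ∃ A : ℝ × ℝ → R4 × ℝ,
    (∀ t, ∀ s ∈ Set.Icc (0 : ℝ) 1, ContDiffAt ℝ ∞ A (t, s)) ∧
    (∀ t s, A (t + 1, s) = A (t, s)) ∧
    (∀ t, ∀ s ∈ Set.Icc (0 : ℝ) 1, (A (t, s)).1 ∈ S3) ∧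
    (∀ t, ∀ s ∈ Set.Ioo (0 : ℝ) 1, (A (t, s)).2 ∈ Set.Ioo (0 : ℝ) 1) ∧
    (∀ t, ∀ s ∈ Set.Icc (0 : ℝ) 1, ∀ t', ∀ s' ∈ Set.Icc (0 : ℝ) 1,
      A (t, s) = A (t', s') → s = s' ∧ ∃ n : ℤ, t' = t + n) ∧
    (∀ t, ∀ s ∈ Set.Icc (0 : ℝ) 1, Function.Injective (fderiv ℝ A (t, s))) ∧
    (∀ t, (fderiv ℝ A (t, 0) (0, 1)).2 ≠ 0 ∧ (fderiv ℝ A (t, 1) (0, 1)).2 ≠ 0) ∧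
    (∀ t, A (t, 0) = (K₀ t, 0)) ∧
    ∀ t, A (t, 1) = (K₁ t, 1)

/-! The reason is that a knot summed with its mirror image is concordant to the unknot, by a
concordance that carries a whole tubular neighbourhood along. Satellites follow such a concordance
of tubes, so that only a framing has to be computed.

Only germs of tubes along their cores matter. A curve in a tube can be slid towards the core
(`EmbOn.collaredConcordant_shrink`), and a deformation of the tube that stays immersive along the
core and injective on it is an embedding near the core (`exists_embedded_neighbourhood`). So it
induces a concordance of sufficiently shrunk satellites (`exists_collaredConcordant`). All knots are
compared by concordances with product ends, which can be composed and reversed.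

Framings: two oriented tubes with the same core differ, up to such deformations, by a twist whose
number of turns is the difference of the framings (`EmbOn.exists_collaredConcordant_twist`). The
transition map is made linear in the fibres and then a rotation. The number of turns is detected by
maps from the knot complement to the circle, and this is unambiguous by
`EmbOn.degree_longitude_eq_zero`: a map with degree zero on the meridian can be altered near the
core to extend over the 3-sphere, and then it lifts to the line off a point.

Companions: let `φ₀` be the tube that turns `P` into the pattern `Q`. It is deformed to a germ `φ`
that is the identity outside a short interval of the circle (`exists_knottedGerm`). An isotopy makes
the companion of the outer satellite the mirror image of the core of `φ₀` in a meridian disc. The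
mirrored tube has framing `-r` and the given one has framing `m`, so that they differ by `m + r`
twists. Placed away from the mirrored arc, the twists commute with `reverseGerm φ`
(`KnottedGerm.exists_reverseGerm_twist`). What remains is `reverseGerm φ ∘ φ` applied to a shrunk
copy of `P`, followed by the twists and the standard torus.

Spinning: `reverseGerm φ ∘ φ` is symmetric in the disc `{0} × ℂ`. Add a coordinate `η ≥ 0` and write
`ρ ^ 2 = u ^ 2 + η ^ 2` and `φ (ρ, w) = (q * ρ, y)`. The map `(u, w, η) ↦ (q * u, y, q * η)` rotates
`φ` about that disc. At `η = 0` it is the symmetric double, and for `η` beyond the knotted arc it is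
the identity. Read as a concordance with parameter `η`, it removes both arcs
(`KnottedGerm.exists_collaredConcordant_spin`).

A satellite of the unknot reaches the same twisted pattern directly, by comparing its tube with the
standard one (`IsSatellite.collaredConcordant_stdTorus_twist`). -/

open scoped ContDiff
open Set Filter Topology

/-! ### Collared concordances -/

/-- Concordance with product ends. -/
def CollaredConcordant (K₀ K₁ : ℝ → R4) : Prop :=
  ∃ (L : ℝ) (A : ℝ × ℝ → R4 × ℝ), 0 < L ∧ ContDiff ℝ ∞ A ∧
    (∀ t s, A (t + 1, s) = A (t, s)) ∧
    (∀ t s, (A (t, s)).1 ∈ S3) ∧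
    (∀ t, ∀ s ≤ 0, A (t, s) = (K₀ t, s)) ∧
    (∀ t, ∀ s ≥ L, A (t, s) = (K₁ t, s)) ∧
    (∀ t, ∀ s ∈ Ioo 0 L, (A (t, s)).2 ∈ Ioo 0 L) ∧
    (∀ t s t' s', A (t, s) = A (t', s') → s = s' ∧ ∃ n : ℤ, t' = t + n) ∧
    ∀ t s, Function.Injective (fderiv ℝ A (t, s))

theorem injective_fderiv_comp {E F G : Type*} [NormedAddCommGroup E] [NormedSpace ℝ E]
    [NormedAddCommGroup F] [NormedSpace ℝ F] [NormedAddCommGroup G] [NormedSpace ℝ G]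
    {g : F → G} {f : E → F} {x : E} (hg : DifferentiableAt ℝ g (f x)) (hf : DifferentiableAt ℝ f x)
    (hgi : Function.Injective (fderiv ℝ g (f x))) (hfi : Function.Injective (fderiv ℝ f x)) :
    Function.Injective (fderiv ℝ (fun y => g (f y)) x) := by
  have : fderiv ℝ (fun y => g (f y)) x = (fderiv ℝ g (f x)).comp (fderiv ℝ f x) :=
    fderiv_comp x hg hf
  rw [this]
  exact hgi.comp hfi

theorem injective_fderiv_of_comp {E F G : Type*} [NormedAddCommGroup E] [NormedSpace ℝ E]
    [NormedAddCommGroup F] [NormedSpace ℝ F] [NormedAddCommGroup G] [NormedSpace ℝ G]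
    {g : F → G} {f : E → F} {x : E} (hg : DifferentiableAt ℝ g (f x)) (hf : DifferentiableAt ℝ f x)
    (h : Function.Injective (fderiv ℝ (fun y => g (f y)) x)) :
    Function.Injective (fderiv ℝ f x) := by
  have : fderiv ℝ (fun y => g (f y)) x = (fderiv ℝ g (f x)).comp (fderiv ℝ f x) :=
    fderiv_comp x hg hf
  rw [this] at h
  exact Function.Injective.of_comp h

theorem injective_of_forall_eq_zero {E F : Type*} [NormedAddCommGroup E] [NormedSpace ℝ E]
    [NormedAddCommGroup F] [NormedSpace ℝ F] {f : E →L[ℝ] F} (h : ∀ v, f v = 0 → v = 0) :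
    Function.Injective f :=
  (injective_iff_map_eq_zero f).2 h

theorem injective_fderiv_of_affine_snd {g : ℝ × ℝ → ℝ × ℝ} {a b : ℝ} (ha : a ≠ 0)
    (hg : ∀ p, g p = (p.1, a * p.2 + b)) (p : ℝ × ℝ) :
    DifferentiableAt ℝ g p ∧ Function.Injective (fderiv ℝ g p) := by
  have h : HasFDerivAt g ((ContinuousLinearMap.fst ℝ ℝ ℝ).prod
      (a • ContinuousLinearMap.snd ℝ ℝ ℝ)) p := by
    have h1 : g = fun p : ℝ × ℝ => (p.1, a * p.2 + b) := funext hg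
    rw [h1]
    exact hasFDerivAt_fst.prodMk ((hasFDerivAt_snd.const_mul a).add_const b)
  refine ⟨h.differentiableAt, ?_⟩
  rw [h.fderiv]
  refine injective_of_forall_eq_zero fun v hv => ?_
  simp [Prod.ext_iff, ha] at hv
  exact Prod.ext hv.1 hv.2

theorem CollaredConcordant.trans {K₀ K₁ K₂ : ℝ → R4} (h₁ : CollaredConcordant K₀ K₁)
    (h₂ : CollaredConcordant K₁ K₂) : CollaredConcordant K₀ K₂ := by
  obtain ⟨L, A, hL, hA, hAp, hAS, hA0, hA1, hAm, hAi, hAd⟩ := h₁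
  obtain ⟨M, B, hM, hB, hBp, hBS, hB0, hB1, hBm, hBi, hBd⟩ := h₂
  -- The shift is by `L + 1` and not by `L`: on the levels between `L` and `L + 1` both pieces are
  -- the product over `K₁`, so that switching at `L + 1 / 2` is smooth.
  set B' : ℝ × ℝ → R4 × ℝ := fun p => B (p.1, p.2 - (L + 1)) + (0, L + 1) with hB'
  have hB's : ContDiff ℝ ∞ B' := by
    have : ContDiff ℝ ∞ fun p : ℝ × ℝ => (p.1, p.2 - (L + 1)) := by fun_prop
    exact (hB.comp this).add contDiff_const
  have hB'd : ∀ p, Function.Injective (fderiv ℝ B' p) := by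
    intro p
    have h1 : fderiv ℝ B' p = fderiv ℝ (fun p : ℝ × ℝ => B (p.1, p.2 - (L + 1))) p := by
      rw [hB']; exact fderiv_add_const _
    rw [h1]
    refine injective_fderiv_comp (g := B) (f := fun p : ℝ × ℝ => (p.1, p.2 - (L + 1)))
      (hB.differentiable (by simp) _) (by fun_prop) (hBd _ _) ?_
    exact (injective_fderiv_of_affine_snd one_ne_zero (b := -(L + 1)) (fun p => by simp; ring) p).2
  have hB'0 : ∀ t, ∀ s ≤ L + 1, B' (t, s) = (K₁ t, s) := by
    intro t s hs
    simp only [hB']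
    rw [hB0 t _ (by linarith)]
    simp
  set D : ℝ × ℝ → R4 × ℝ := fun p => if p.2 < L + 1 / 2 then A p else B' p with hD
  have hDA : ∀ t s, s < L + 1 → D (t, s) = A (t, s) := by
    intro t s hs
    simp only [hD]
    split_ifs with h
    · rfl
    · rw [hB'0 t s hs.le, hA1 t s (by linarith)]
  have hDB : ∀ t s, L < s → D (t, s) = B' (t, s) := by
    intro t s hs
    simp only [hD]
    split_ifs with h
    · rw [hB'0 t s (by linarith), hA1 t s hs.le]
    · rfl
  have hDA' : ∀ p : ℝ × ℝ, p.2 < L + 1 → D =ᶠ[𝓝 p] A := by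
    intro p hp
    filter_upwards [(isOpen_lt continuous_snd continuous_const).mem_nhds hp] with q hq
    exact hDA q.1 q.2 hq
  have hDB' : ∀ p : ℝ × ℝ, L < p.2 → D =ᶠ[𝓝 p] B' := by
    intro p hp
    filter_upwards [(isOpen_lt continuous_const continuous_snd).mem_nhds hp] with q hq
    exact hDB q.1 q.2 hq
  -- The two pieces lie on opposite sides of the level `L + 1 / 2` and therefore cannot meet.
  have hA2 : ∀ t s, s < L + 1 / 2 → (A (t, s)).2 < L + 1 / 2 := by
    intro t s hs
    rcases le_or_gt s 0 with h | h
    · rw [hA0 t s h]; exact hs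
    rcases le_or_gt L s with h' | h'
    · rw [hA1 t s h']; exact hs
    · have := (hAm t s ⟨h, h'⟩).2; linarith
  have hB2 : ∀ t s, L + 1 / 2 ≤ s → L + 1 / 2 ≤ (B' (t, s)).2 := by
    intro t s hs
    rcases le_or_gt s (L + 1) with h | h
    · rw [hB'0 t s h]; exact hs
    simp only [hB', Prod.snd_add]
    rcases le_or_gt M (s - (L + 1)) with h' | h'
    · rw [hB1 t _ h']; simp only; linarith
    · have := (hBm t (s - (L + 1)) ⟨by linarith, h'⟩).1; linarith
  refine ⟨L + 1 + M, D, by positivity, ?_, ?_, ?_, ?_, ?_, ?_, ?_, ?_⟩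
  · rw [contDiff_iff_contDiffAt]
    intro p
    rcases lt_or_ge p.2 (L + 1) with h | h
    · exact hA.contDiffAt.congr_of_eventuallyEq (hDA' p h)
    · exact hB's.contDiffAt.congr_of_eventuallyEq (hDB' p (by linarith))
  · intro t s
    simp only [hD, hB', hAp, hBp]
  · intro t s
    simp only [hD]
    split_ifs with h
    · exact hAS t s
    · simp only [hB', Prod.fst_add, add_zero]; exact hBS _ _
  · intro t s hs
    rw [hDA t s (by linarith), hA0 t s hs]
  · intro t s hs
    rw [hDB t s (by linarith)]
    simp only [hB']
    rw [hB1 t _ (by linarith)]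
    simp
  · intro t s hs
    rcases lt_or_ge s (L + 1 / 2) with h | h
    · rw [hDA t s (by linarith)]
      refine ⟨?_, by linarith [hA2 t s h]⟩
      rcases le_or_gt L s with h' | h'
      · rw [hA1 t s h']; exact hs.1
      · exact (hAm t s ⟨hs.1, h'⟩).1
    · rw [hDB t s (by linarith)]
      refine ⟨by linarith [hB2 t s h], ?_⟩
      rcases le_or_gt s (L + 1) with h' | h'
      · rw [hB'0 t s h']; exact hs.2
      · simp only [hB', Prod.snd_add]
        have := (hBm t (s - (L + 1)) ⟨by linarith, by linarith [hs.2]⟩).2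
        linarith
  · intro t s t' s' h
    rcases lt_or_ge s (L + 1 / 2) with hs | hs <;> rcases lt_or_ge s' (L + 1 / 2) with hs' | hs'
    · rw [hDA t s (by linarith), hDA t' s' (by linarith)] at h
      exact hAi _ _ _ _ h
    · rw [hDA t s (by linarith), hDB t' s' (by linarith)] at h
      have h1 := hA2 t s hs
      have h2 := hB2 t' s' hs'
      rw [h] at h1
      linarith
    · rw [hDB t s (by linarith), hDA t' s' (by linarith)] at h
      have h1 := hA2 t' s' hs'
      have h2 := hB2 t s hs
      rw [h] at h2
      linarith
    · rw [hDB t s (by linarith), hDB t' s' (by linarith)] at h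
      simp only [hB', add_left_inj] at h
      obtain ⟨h1, h2⟩ := hBi _ _ _ _ h
      exact ⟨by linarith, h2⟩
  · intro t s
    rcases lt_or_ge s (L + 1) with h | h
    · rw [(hDA' (t, s) h).fderiv_eq]; exact hAd t s
    · rw [(hDB' (t, s) (by simp only; linarith)).fderiv_eq]; exact hB'd _

theorem CollaredConcordant.symm {K₀ K₁ : ℝ → R4} (h : CollaredConcordant K₀ K₁) :
    CollaredConcordant K₁ K₀ := by
  obtain ⟨L, A, hL, hA, hAp, hAS, hA0, hA1, hAm, hAi, hAd⟩ := h
  have hf := injective_fderiv_of_affine_snd (g := fun p => (p.1, L - p.2)) (a := -1) (b := L)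
    (by norm_num) (fun p => by simp; ring)
  set R : R4 × ℝ → R4 × ℝ := fun x => (x.1, L - x.2) with hR
  have hRd : ∀ x, HasFDerivAt R ((ContinuousLinearMap.fst ℝ R4 ℝ).prod
      (-ContinuousLinearMap.snd ℝ R4 ℝ)) x := fun x =>
    hasFDerivAt_fst.prodMk (hasFDerivAt_snd.const_sub L)
  have hRi : ∀ x, Function.Injective (fderiv ℝ R x) := by
    intro x
    rw [(hRd x).fderiv]
    refine injective_of_forall_eq_zero fun v hv => ?_
    simp [Prod.ext_iff] at hv
    exact Prod.ext hv.1 hv.2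
  refine ⟨L, fun p => R (A (p.1, L - p.2)), hL, ?_, ?_, ?_, ?_, ?_, ?_, ?_, ?_⟩
  · have h1 : ContDiff ℝ ∞ R := by rw [hR]; fun_prop
    have h2 : ContDiff ℝ ∞ fun p : ℝ × ℝ => (p.1, L - p.2) := by fun_prop
    exact h1.comp (hA.comp h2)
  · intro t s; simp [hAp]
  · intro t s; exact hAS _ _
  · intro t s hs
    simp only [hA1 t (L - s) (by linarith), hR]; simp
  · intro t s hs
    simp only [hA0 t (L - s) (by linarith), hR]; simp
  · intro t s hs
    have := hAm t (L - s) ⟨by linarith [hs.2], by linarith [hs.1]⟩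
    simp only [hR]
    exact ⟨by linarith [this.2], by linarith [this.1]⟩
  · intro t s t' s' h
    simp only [hR, Prod.mk.injEq, sub_right_inj] at h
    obtain ⟨h1, h2⟩ := hAi _ _ _ _ (Prod.ext h.1 h.2)
    exact ⟨by linarith, h2⟩
  · intro t s
    refine injective_fderiv_comp (g := R) (f := fun p : ℝ × ℝ => A (p.1, L - p.2))
      (hRd _).differentiableAt ?_ (hRi _) ?_
    · exact DifferentiableAt.comp (t, s) (hA.differentiable (by simp) _) (hf _).1
    · exact injective_fderiv_comp (g := A) (f := fun p : ℝ × ℝ => (p.1, L - p.2))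
        (hA.differentiable (by simp) _) (hf _).1 (hAd _ _) (hf _).2

/-- The levels from `-1` to `L + 1` are rescaled to the unit interval. The unit of collar kept at
each end makes the annulus a product near its boundary, which is where neatness comes from. -/
theorem CollaredConcordant.smoothlyConcordant {K₀ K₁ : ℝ → R4} (h : CollaredConcordant K₀ K₁) :
    SmoothlyConcordant K₀ K₁ := by
  obtain ⟨L, A, hL, hA, hAp, hAS, hA0, hA1, hAm, hAi, hAd⟩ := h
  have hc : (0 : ℝ) < L + 2 := by linarith
  have hf := injective_fderiv_of_affine_snd (g := fun p => (p.1, (L + 2) * p.2 + -1))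
    hc.ne' (fun p => rfl)
  set R : R4 × ℝ → R4 × ℝ := fun x => (x.1, (L + 2)⁻¹ * (x.2 + 1)) with hR
  have hRd : ∀ x, HasFDerivAt R ((ContinuousLinearMap.fst ℝ R4 ℝ).prod
      ((L + 2)⁻¹ • ContinuousLinearMap.snd ℝ R4 ℝ)) x := fun x =>
    hasFDerivAt_fst.prodMk ((hasFDerivAt_snd.add_const 1).const_mul _)
  have hRi : ∀ x, Function.Injective (fderiv ℝ R x) := by
    intro x
    rw [(hRd x).fderiv]
    refine injective_of_forall_eq_zero fun v hv => ?_
    simp [Prod.ext_iff, hc.ne'] at hv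
    exact Prod.ext hv.1 hv.2
  have hneat : ∀ (K : ℝ → R4) (t s₀ : ℝ),
      (∀ᶠ s in 𝓝 s₀, A (t, (L + 2) * s + -1) = (K t, (L + 2) * s + -1)) →
      (fderiv ℝ (fun p : ℝ × ℝ => R (A (p.1, (L + 2) * p.2 + -1))) (t, s₀) (0, 1)).2 ≠ 0 := by
    intro K t s₀ hs
    have hd : DifferentiableAt ℝ (fun p : ℝ × ℝ => R (A (p.1, (L + 2) * p.2 + -1))) (t, s₀) :=
      DifferentiableAt.comp (t, s₀) (g := R) (hRd _).differentiableAt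
        (DifferentiableAt.comp (t, s₀) (g := A) (hA.differentiable (by simp) _) (hf _).1)
    have h1 : HasDerivAt (fun s : ℝ => (R (A (t, (L + 2) * s + -1))).2)
        (fderiv ℝ (fun p : ℝ × ℝ => R (A (p.1, (L + 2) * p.2 + -1))) (t, s₀) (0, 1)).2 s₀ := by
      have h2 : HasDerivAt (fun s : ℝ => (t, s)) ((0 : ℝ), (1 : ℝ)) s₀ :=
        (hasDerivAt_const _ _).prodMk (hasDerivAt_id _)
      have h3 := hd.hasFDerivAt.comp_hasDerivAt s₀ h2
      exact (ContinuousLinearMap.snd ℝ R4 ℝ).hasFDerivAt.comp_hasDerivAt s₀ h3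
    have h4 : HasDerivAt (fun s : ℝ => (R (A (t, (L + 2) * s + -1))).2) 1 s₀ := by
      refine (hasDerivAt_id s₀).congr_of_eventuallyEq ?_
      filter_upwards [hs] with s hs
      rw [hs]
      simp only [hR, id]
      field_simp
      ring
    rw [h1.unique h4]
    exact one_ne_zero
  refine ⟨fun p => R (A (p.1, (L + 2) * p.2 + -1)), ?_, ?_, ?_, ?_, ?_, ?_, ?_, ?_, ?_⟩
  · intro t s _
    have h1 : ContDiff ℝ ∞ R := by rw [hR]; fun_prop
    have h2 : ContDiff ℝ ∞ fun p : ℝ × ℝ => (p.1, (L + 2) * p.2 + -1) := by fun_prop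
    exact (h1.comp (hA.comp h2)).contDiffAt
  · intro t s; simp [hAp]
  · intro t s _; exact hAS _ _
  · intro t s hs
    have key : (A (t, (L + 2) * s + -1)).2 ∈ Ioo (-1) (L + 1) := by
      have h1 : 0 < (L + 2) * s := mul_pos hc hs.1
      have h2 : (L + 2) * s < L + 2 := by nlinarith [hs.2]
      rcases le_or_gt ((L + 2) * s + -1) 0 with h | h
      · rw [hA0 t _ h]; exact ⟨by simp only; linarith, by simp only; linarith⟩
      rcases le_or_gt L ((L + 2) * s + -1) with h' | h'
      · rw [hA1 t _ h']; exact ⟨by simp only; linarith, by simp only; linarith⟩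
      · have := hAm t _ ⟨h, h'⟩
        exact ⟨by linarith [this.1], by linarith [this.2]⟩
    simp only [hR]
    constructor
    · exact mul_pos (inv_pos.2 hc) (by linarith [key.1])
    · rw [inv_mul_lt_iff₀ hc]; linarith [key.2]
  · intro t s _ t' s' _ h
    simp only [hR, Prod.mk.injEq] at h
    have h3 := mul_left_cancel₀ (inv_ne_zero hc.ne') h.2
    obtain ⟨h1, h2⟩ := hAi _ _ _ _ (Prod.ext h.1 (add_right_cancel h3))
    exact ⟨mul_left_cancel₀ hc.ne' (add_right_cancel h1), h2⟩
  · intro t s _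
    refine injective_fderiv_comp (g := R) (f := fun p : ℝ × ℝ => A (p.1, (L + 2) * p.2 + -1))
      (hRd _).differentiableAt ?_ (hRi _) ?_
    · exact DifferentiableAt.comp (t, s) (hA.differentiable (by simp) _) (hf _).1
    · exact injective_fderiv_comp (g := A) (f := fun p : ℝ × ℝ => (p.1, (L + 2) * p.2 + -1))
        (hA.differentiable (by simp) _) (hf _).1 (hAd _ _) (hf _).2
  · intro t
    constructor
    · refine hneat K₀ t 0 ?_
      have : ∀ᶠ s in 𝓝 (0 : ℝ), (L + 2) * s + -1 < 0 :=
        (by fun_prop : Continuous fun s : ℝ => (L + 2) * s + -1).continuousAt.eventually_lt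
          continuousAt_const (by norm_num)
      filter_upwards [this] with s hs
      exact hA0 t _ hs.le
    · refine hneat K₁ t 1 ?_
      have : ∀ᶠ s in 𝓝 (1 : ℝ), L < (L + 2) * s + -1 :=
        continuousAt_const.eventually_lt
          (by fun_prop : Continuous fun s : ℝ => (L + 2) * s + -1).continuousAt (by norm_num)
      filter_upwards [this] with s hs
      exact hA1 t _ hs.le
  · intro t
    simp only
    rw [hA0 t _ (by norm_num)]
    simp [hR]
  · intro t
    simp only
    rw [hA1 t _ (by linarith)]
    simp only [hR, Prod.mk.injEq, true_and]
    field_simp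
    ring

/-- The trace of a smooth isotopy of embedded curves is a concordance. -/
theorem collaredConcordant_of_isotopy {k : ℝ × ℝ → R4}
    (hk : ∀ t, ∀ s ∈ Icc (0 : ℝ) 1, ContDiffAt ℝ ∞ k (t, s))
    (hp : ∀ t, ∀ s ∈ Icc (0 : ℝ) 1, k (t + 1, s) = k (t, s))
    (hS : ∀ t, ∀ s ∈ Icc (0 : ℝ) 1, k (t, s) ∈ S3)
    (hi : ∀ s ∈ Icc (0 : ℝ) 1, ∀ t t', k (t, s) = k (t', s) → ∃ n : ℤ, t' = t + n)
    (hd : ∀ t, ∀ s ∈ Icc (0 : ℝ) 1, deriv (fun t => k (t, s)) t ≠ 0) :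
    CollaredConcordant (fun t => k (t, 0)) (fun t => k (t, 1)) := by
  -- Running the isotopy with this clock makes it constant outside the unit interval, which yields
  -- the product ends.
  set σ := Real.smoothTransition
  have hσ : ∀ s, σ s ∈ Icc (0 : ℝ) 1 := fun s =>
    ⟨Real.smoothTransition.nonneg s, Real.smoothTransition.le_one s⟩
  have hσs : ContDiff ℝ ∞ σ := Real.smoothTransition.contDiff
  set f : ℝ × ℝ → ℝ × ℝ := fun p => (p.1, σ p.2) with hf
  have hfs : ContDiff ℝ ∞ f := contDiff_fst.prodMk (hσs.comp contDiff_snd)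
  have hA : ContDiff ℝ ∞ fun p : ℝ × ℝ => (k (p.1, σ p.2), p.2) := by
    rw [contDiff_iff_contDiffAt]
    intro p
    exact (ContDiffAt.comp p (g := k) (hk _ _ (hσ _)) hfs.contDiffAt).prodMk contDiffAt_snd
  refine ⟨1, fun p => (k (p.1, σ p.2), p.2), one_pos, hA, ?_, ?_, ?_, ?_, ?_, ?_, ?_⟩
  · intro t s; simp only [hp _ _ (hσ s)]
  · intro t s; exact hS _ _ (hσ s)
  · intro t s hs; simp only [σ, Real.smoothTransition.zero_of_nonpos hs]
  · intro t s hs; simp only [σ, Real.smoothTransition.one_of_one_le hs]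
  · intro t s hs; exact hs
  · intro t s t' s' h
    simp only [Prod.mk.injEq] at h
    obtain ⟨h1, rfl⟩ := h
    exact ⟨rfl, hi _ (hσ s) _ _ h1⟩
  · intro t s
    refine injective_of_forall_eq_zero fun v hv => ?_
    have hd1 := (hA.differentiable (by simp) (t, s)).hasFDerivAt
    have h2 : HasFDerivAt (fun p : ℝ × ℝ => p.2) (ContinuousLinearMap.snd ℝ ℝ ℝ) (t, s) :=
      hasFDerivAt_snd
    have h3 : v.2 = 0 := by
      have := ((ContinuousLinearMap.snd ℝ R4 ℝ).hasFDerivAt.comp (t, s) hd1).unique h2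
      have h4 := congrArg (fun T : ℝ × ℝ →L[ℝ] ℝ => T v) this
      simpa [hv] using h4.symm
    have h5 : HasDerivAt (fun t : ℝ => (t, s)) ((1 : ℝ), (0 : ℝ)) t :=
      (hasDerivAt_id _).prodMk (hasDerivAt_const _ _)
    have h6 := hd1.comp_hasDerivAt t h5
    have h7 := (ContinuousLinearMap.fst ℝ R4 ℝ).hasFDerivAt.comp_hasDerivAt t h6
    have h8 : deriv (fun t => k (t, σ s)) t = _ := h7.deriv
    have h9 : v = v.1 • ((1 : ℝ), (0 : ℝ)) := Prod.ext (by simp) (by simp [h3])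
    rw [h9, map_smul] at hv
    rcases smul_eq_zero.1 hv with h0 | h0
    · rw [h9, h0, zero_smul]
    · rw [h0] at h8
      exact absurd h8 (by simpa using hd t _ (hσ s))

/-! ### Shrinking a tubular neighbourhood -/

/-- The open solid torus of radius `r`. -/
def disc (r : ℝ) : Set (ℝ × ℂ) := {p | ‖p.2‖ < r}

theorem isOpen_disc (r : ℝ) : IsOpen (disc r) :=
  isOpen_lt (by fun_prop) continuous_const

theorem disc_mono {r s : ℝ} (h : r ≤ s) : disc r ⊆ disc s := fun _ hp => lt_of_lt_of_le hp h

theorem core_mem_disc {r : ℝ} (hr : 0 < r) (t : ℝ) : (t, (0 : ℂ)) ∈ disc r := by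
  simpa [disc] using hr

/-- Shrinking towards the core. -/
def shrink (δ : ℝ) (p : ℝ × ℂ) : ℝ × ℂ := (p.1, (δ : ℂ) * p.2)

theorem shrink_one (p : ℝ × ℂ) : shrink 1 p = p := by simp [shrink]

theorem shrink_shrink (δ ε : ℝ) (p : ℝ × ℂ) : shrink δ (shrink ε p) = shrink (δ * ε) p := by
  simp [shrink, mul_assoc]

theorem contDiff_shrink (δ : ℝ) : ContDiff ℝ ∞ (shrink δ) := by
  unfold shrink; fun_prop

theorem hasFDerivAt_shrink (δ : ℝ) (p : ℝ × ℂ) :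
    HasFDerivAt (shrink δ) ((ContinuousLinearMap.fst ℝ ℝ ℂ).prod
      ((δ : ℂ) • ContinuousLinearMap.snd ℝ ℝ ℂ)) p :=
  hasFDerivAt_fst.prodMk (hasFDerivAt_snd.const_mul (δ : ℂ))

theorem injective_fderiv_shrink {δ : ℝ} (hδ : δ ≠ 0) (p : ℝ × ℂ) :
    Function.Injective (fderiv ℝ (shrink δ) p) := by
  rw [(hasFDerivAt_shrink δ p).fderiv]
  refine injective_of_forall_eq_zero fun v hv => ?_
  simp [Prod.ext_iff, hδ] at hv
  exact Prod.ext hv.1 hv.2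

theorem norm_shrink_snd {δ : ℝ} (hδ : 0 ≤ δ) (p : ℝ × ℂ) :
    ‖(shrink δ p).2‖ = δ * ‖p.2‖ := by
  simp [shrink, abs_of_nonneg hδ]

/-- A smooth immersed curve in `S¹ × ℂ` without self-intersections, given by a lift. -/
structure TorusCurve (P : ℝ → ℝ × ℂ) : Prop where
  smooth : ContDiff ℝ ∞ P
  periodic : ∃ l : ℤ, ∀ t, P (t + 1) = P t + ((l : ℝ), 0)
  injective : ∀ s t, (∃ k : ℤ, P t = P s + ((k : ℝ), 0)) → ∃ n : ℤ, t = s + n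
  immersion : ∀ t, deriv P t ≠ 0

theorem IsPattern.torusCurve {P : ℝ → ℝ × ℂ} (h : IsPattern P) : TorusCurve P :=
  ⟨h.smooth, h.periodic, h.injective, h.immersion⟩

theorem TorusCurve.exists_bound {P : ℝ → ℝ × ℂ} (h : TorusCurve P) :
    ∃ B > 0, ∀ t, ‖(P t).2‖ ≤ B := by
  obtain ⟨l, hl⟩ := h.periodic
  have hp : Function.Periodic (fun t => (P t).2) 1 := fun t => by simp [hl]
  obtain ⟨B, hB⟩ := isCompact_Icc.exists_bound_of_continuousOn (s := Icc (0 : ℝ) 1)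
    (f := fun t => (P t).2) (h.smooth.continuous.snd.continuousOn)
  refine ⟨max B 1, by positivity, fun t => ?_⟩
  obtain ⟨y, hy, hty⟩ := hp.exists_mem_Ico₀ one_pos t
  rw [hty]
  exact (hB y ⟨hy.1, hy.2.le⟩).trans (le_max_left _ _)

theorem deriv_shrink_comp {P : ℝ → ℝ × ℂ} (h : TorusCurve P) {δ : ℝ} (hδ : δ ≠ 0) (t : ℝ) :
    deriv (fun t => shrink δ (P t)) t ≠ 0 := by
  have h1 := (hasFDerivAt_shrink δ (P t)).comp_hasDerivAt t
    (h.smooth.differentiable (by simp) t).hasDerivAt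
  have h2 : deriv (fun t => shrink δ (P t)) t = _ := h1.deriv
  rw [h2, ← (hasFDerivAt_shrink δ (P t)).fderiv]
  intro h0
  exact h.immersion t (injective_fderiv_shrink hδ (P t) (h0.trans (map_zero _).symm))

theorem TorusCurve.shrink {P : ℝ → ℝ × ℂ} (h : TorusCurve P) {δ : ℝ} (hδ : δ ≠ 0) :
    TorusCurve (fun t => shrink δ (P t)) where
  smooth := (contDiff_shrink δ).comp h.smooth
  periodic := by
    obtain ⟨l, hl⟩ := h.periodic
    exact ⟨l, fun t => by simp [_root_.shrink, hl]⟩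
  injective := by
    rintro s t ⟨k, hk⟩
    refine h.injective s t ⟨k, ?_⟩
    simp only [_root_.shrink, Prod.ext_iff, Prod.fst_add, Prod.snd_add, add_zero, mul_eq_mul_left_iff,
      Complex.ofReal_eq_zero, hδ, or_false] at hk ⊢
    exact hk
  immersion := deriv_shrink_comp h hδ

/-! ### Embedded tubes and neighbourhoods of the core. -/

/-- `φ` embeds the subset `D` of `S¹ × ℂ` in the 3-sphere. -/
structure EmbOn (D : Set (ℝ × ℂ)) (φ : ℝ × ℂ → R4) : Prop where
  smooth : ∀ p ∈ D, ContDiffAt ℝ ∞ φ p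
  periodic : ∀ t w, φ (t + 1, w) = φ (t, w)
  mem_sphere : ∀ p ∈ D, φ p ∈ S3
  injective : ∀ p ∈ D, ∀ q ∈ D, φ p = φ q → ∃ n : ℤ, q = p + ((n : ℝ), 0)
  immersion : ∀ p ∈ D, Function.Injective (fderiv ℝ φ p)

theorem EmbOn.mono {D D' : Set (ℝ × ℂ)} {φ : ℝ × ℂ → R4} (h : EmbOn D φ) (hD : D' ⊆ D) :
    EmbOn D' φ :=
  ⟨fun p hp => h.smooth p (hD hp), h.periodic, fun p hp => h.mem_sphere p (hD hp),
    fun p hp q hq => h.injective p (hD hp) q (hD hq), fun p hp => h.immersion p (hD hp)⟩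

theorem periodic_int {α : Type*} {φ : ℝ × ℂ → α} (h : ∀ t w, φ (t + 1, w) = φ (t, w)) (n : ℤ)
    (p : ℝ × ℂ) : φ (p + ((n : ℝ), 0)) = φ p := by
  have h1 : Function.Periodic (fun t => φ (t, p.2)) 1 := fun t => h t p.2
  have h2 := h1.int_mul n p.1
  have h3 : p + ((n : ℝ), 0) = (p.1 + n * 1, p.2) := by ext <;> simp
  rw [h3]
  exact h2

theorem equivariant_int {φ : ℝ × ℂ → ℝ × ℂ} (h : ∀ t w, φ (t + 1, w) = φ (t, w) + (1, 0)) (n : ℤ)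
    (p : ℝ × ℂ) : φ (p + ((n : ℝ), 0)) = φ p + ((n : ℝ), 0) := by
  have h1 := periodic_int (φ := fun p => φ p - (p.1, 0)) (fun t w => by
    simp only [h]; ext <;> simp) n p
  simp only [sub_eq_iff_eq_add] at h1
  rw [h1]
  ext <;> simp; ring

/-- Tube lemma over one period of the core; periodicity then covers the whole line, by passing to
fractional parts. -/
theorem eventually_core_uniform {p : (ℝ × ℂ) × ℝ → Prop} {a b : ℝ}
    (hper : ∀ t w s, p ((t + 1, w), s) ↔ p ((t, w), s))
    (h : ∀ t, ∀ s ∈ Icc a b, ∀ᶠ q in 𝓝 ((t, (0 : ℂ)), s), p q) :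
    ∃ δ > 0, ∀ q ∈ disc δ, ∀ s ∈ Icc a b, p (q, s) := by
  have hK : IsCompact (Icc (0 : ℝ) 1 ×ˢ Icc a b) := isCompact_Icc.prod isCompact_Icc
  have h1 : ∀ᶠ w in 𝓝 (0 : ℂ), ∀ y ∈ Icc (0 : ℝ) 1 ×ˢ Icc a b, p ((y.1, w), y.2) := by
    refine hK.eventually_forall_of_forall_eventually fun y hy => ?_
    have hc : Tendsto (fun z : ℂ × (ℝ × ℝ) => ((z.2.1, z.1), z.2.2)) (𝓝 (0, y))
        (𝓝 ((y.1, (0 : ℂ)), y.2)) :=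
      (by fun_prop : Continuous fun z : ℂ × (ℝ × ℝ) => ((z.2.1, z.1), z.2.2)).tendsto' _ _ rfl
    exact hc.eventually (h y.1 y.2 hy.2)
  obtain ⟨δ, hδ, hw⟩ := Metric.eventually_nhds_iff.1 h1
  refine ⟨δ, hδ, fun q hq s hs => ?_⟩
  have h2 := hw (y := q.2) (by simpa [disc] using hq) (Int.fract q.1, s)
    ⟨⟨Int.fract_nonneg _, (Int.fract_lt_one _).le⟩, hs⟩
  have h3 := periodic_int (φ := fun q => p (q, s)) (fun t w => propext (hper t w s)) ⌊q.1⌋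
    (Int.fract q.1, q.2)
  have h4 : (Int.fract q.1, q.2) + ((⌊q.1⌋ : ℝ), (0 : ℂ)) = q := by
    ext <;> simp
  rw [h4] at h3
  rwa [h3]

theorem eventually_core_pair_uniform {p : (ℝ × ℂ) × ℝ → (ℝ × ℂ) × ℝ → Prop} {a b : ℝ}
    (hper : ∀ t w s q, p ((t + 1, w), s) q ↔ p ((t, w), s) q)
    (hper' : ∀ t w s q, p q ((t + 1, w), s) ↔ p q ((t, w), s))
    (h : ∀ t, ∀ s ∈ Icc a b, ∀ t', ∀ s' ∈ Icc a b,
      ∀ᶠ q in 𝓝 (((t, (0 : ℂ)), s), ((t', (0 : ℂ)), s')), p q.1 q.2) :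
    ∃ δ > 0, ∀ q ∈ disc δ, ∀ s ∈ Icc a b, ∀ q' ∈ disc δ, ∀ s' ∈ Icc a b, p (q, s) (q', s') := by
  have hK : IsCompact ((Icc (0 : ℝ) 1 ×ˢ Icc a b) ×ˢ (Icc (0 : ℝ) 1 ×ˢ Icc a b)) :=
    (isCompact_Icc.prod isCompact_Icc).prod (isCompact_Icc.prod isCompact_Icc)
  have h1 : ∀ᶠ w in 𝓝 (0 : ℂ × ℂ),
      ∀ y ∈ (Icc (0 : ℝ) 1 ×ˢ Icc a b) ×ˢ (Icc (0 : ℝ) 1 ×ˢ Icc a b),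
        p ((y.1.1, w.1), y.1.2) ((y.2.1, w.2), y.2.2) := by
    refine hK.eventually_forall_of_forall_eventually fun y hy => ?_
    have hc : Tendsto (fun z : (ℂ × ℂ) × ((ℝ × ℝ) × (ℝ × ℝ)) =>
        (((z.2.1.1, z.1.1), z.2.1.2), ((z.2.2.1, z.1.2), z.2.2.2))) (𝓝 (0, y))
        (𝓝 (((y.1.1, (0 : ℂ)), y.1.2), ((y.2.1, (0 : ℂ)), y.2.2))) :=
      (by fun_prop : Continuous fun z : (ℂ × ℂ) × ((ℝ × ℝ) × (ℝ × ℝ)) =>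
        (((z.2.1.1, z.1.1), z.2.1.2), ((z.2.2.1, z.1.2), z.2.2.2))).tendsto' _ _ rfl
    exact hc.eventually (h y.1.1 y.1.2 hy.1.2 y.2.1 y.2.2 hy.2.2)
  obtain ⟨δ, hδ, hw⟩ := Metric.eventually_nhds_iff.1 h1
  refine ⟨δ, hδ, fun q hq s hs q' hq' s' hs' => ?_⟩
  have h2 := hw (y := (q.2, q'.2)) (by
    rw [dist_zero_right, Prod.norm_def]; exact max_lt hq hq')
    ((Int.fract q.1, s), (Int.fract q'.1, s'))
    ⟨⟨⟨Int.fract_nonneg _, (Int.fract_lt_one _).le⟩, hs⟩,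
      ⟨⟨Int.fract_nonneg _, (Int.fract_lt_one _).le⟩, hs'⟩⟩
  have h4 : ∀ q : ℝ × ℂ, (Int.fract q.1, q.2) + ((⌊q.1⌋ : ℝ), (0 : ℂ)) = q := fun q => by
    ext <;> simp
  have h3 := periodic_int (φ := fun q => p (q, s) ((Int.fract q'.1, q'.2), s'))
    (fun t w => propext (hper t w s _)) ⌊q.1⌋ (Int.fract q.1, q.2)
  have h5 := periodic_int (φ := fun q' => p (q, s) (q', s'))
    (fun t w => propext (hper' t w s' _)) ⌊q'.1⌋ (Int.fract q'.1, q'.2)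
  rw [h4] at h3 h5
  simp only at h3 h5 h2
  rwa [h5, h3]

/-- In finite dimension an injective derivative is bounded below by some `1 / K`. Near the diagonal,
strict differentiability bounds the error by half of that, so that equal values force equal points.
-/
theorem HasStrictFDerivAt.eventually_injective {E F : Type*} [NormedAddCommGroup E]
    [NormedSpace ℝ E] [FiniteDimensional ℝ E] [NormedAddCommGroup F] [NormedSpace ℝ F]
    {f : E → F} {f' : E →L[ℝ] F} {x : E} (hf : HasStrictFDerivAt f f' x)
    (hi : Function.Injective f') : ∀ᶠ p : E × E in 𝓝 (x, x), f p.1 = f p.2 → p.1 = p.2 := by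
  obtain ⟨K, hK0, hK⟩ := LinearMap.exists_antilipschitzWith (f' : E →ₗ[ℝ] F)
    (LinearMap.ker_eq_bot.2 hi)
  have hK0' : (0 : ℝ) < K := hK0
  have h1 := hf.isLittleO.def (c := (2 * K : ℝ)⁻¹) (by positivity)
  filter_upwards [h1] with p hp hpe
  rw [hpe, sub_self, zero_sub, norm_neg] at hp
  have h2 := hK.le_mul_dist (p.1 - p.2) 0
  simp only [map_zero, dist_zero_right, ContinuousLinearMap.coe_coe] at h2
  have h3 : ‖p.1 - p.2‖ ≤ 2⁻¹ * ‖p.1 - p.2‖ := by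
    calc ‖p.1 - p.2‖ ≤ K * ((2 * K : ℝ)⁻¹ * ‖p.1 - p.2‖) :=
          h2.trans (mul_le_mul_of_nonneg_left hp hK0'.le)
      _ = 2⁻¹ * ‖p.1 - p.2‖ := by field_simp
  have h4 : ‖p.1 - p.2‖ = 0 := by linarith [norm_nonneg (p.1 - p.2)]
  exact sub_eq_zero.1 (norm_eq_zero.1 h4)

/-- A map that is an immersion along the compact core and injective on it is an embedding of a
neighbourhood of the core. -/
theorem exists_embedded_neighbourhood {F : Type*} [NormedAddCommGroup F] [NormedSpace ℝ F]
    {Φ : (ℝ × ℂ) × ℝ → F} {a b : ℝ} (hper : ∀ t w s, Φ ((t + 1, w), s) = Φ ((t, w), s))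
    (hsm : ∀ t, ∀ s ∈ Icc a b, ∀ᶠ q in 𝓝 ((t, (0 : ℂ)), s), ContDiffAt ℝ ∞ Φ q)
    (hi : ∀ t t', ∀ s ∈ Icc a b, ∀ s' ∈ Icc a b,
      Φ ((t, 0), s) = Φ ((t', 0), s') → s = s' ∧ ∃ n : ℤ, t' = t + n)
    (hd : ∀ t, ∀ s ∈ Icc a b, Function.Injective (fderiv ℝ Φ ((t, 0), s))) :
    ∃ δ > 0,
      (∀ q ∈ disc δ, ∀ s ∈ Icc a b,
        ContDiffAt ℝ ∞ Φ (q, s) ∧ Function.Injective (fderiv ℝ Φ (q, s))) ∧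
      ∀ q ∈ disc δ, ∀ s ∈ Icc a b, ∀ q' ∈ disc δ, ∀ s' ∈ Icc a b, Φ (q, s) = Φ (q', s') →
        s = s' ∧ ∃ n : ℤ, q' = q + ((n : ℝ), 0) := by
  have htr : ∀ q : (ℝ × ℂ) × ℝ, ∀ n : ℤ, Φ (q + (((n : ℝ), 0), 0)) = Φ q := by
    intro q n
    have := periodic_int (φ := fun p => Φ (p, q.2)) (fun t w => hper t w _) n q.1
    convert this using 2
    ext <;> simp
  have hfd : ∀ q : (ℝ × ℂ) × ℝ, fderiv ℝ Φ (q + (((1 : ℝ), 0), 0)) = fderiv ℝ Φ q := by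
    intro q
    rw [← fderiv_comp_add_right]
    congr 1
    funext y
    simpa using htr y 1
  have hcd : ∀ q : (ℝ × ℂ) × ℝ,
      ContDiffAt ℝ ∞ Φ (q + (((1 : ℝ), 0), 0)) ↔ ContDiffAt ℝ ∞ Φ q := by
    intro q
    have h1 : (fun y => Φ (y + (((1 : ℝ), 0), 0))) = Φ := by
      funext y; simpa using htr y 1
    have h2 : (fun y => Φ (y - (((1 : ℝ), 0), 0))) = Φ := by
      funext y; simpa [sub_eq_add_neg] using htr y (-1)
    constructor
    · intro h
      rw [← h1]
      exact ContDiffAt.comp (g := Φ) (f := fun y => y + (((1 : ℝ), (0 : ℂ)), (0 : ℝ))) q h (by fun_prop)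
    · intro h
      rw [← h2]
      refine ContDiffAt.comp (g := Φ) (f := fun y => y - (((1 : ℝ), (0 : ℂ)), (0 : ℝ))) _ ?_
        (by fun_prop)
      simpa using h
  obtain ⟨δ₁, hδ₁, h₁⟩ := eventually_core_uniform
    (p := fun q => ContDiffAt ℝ ∞ Φ q ∧ Function.Injective (fderiv ℝ Φ q)) (a := a) (b := b)
    (by
      intro t w s
      have : ((t + 1, w), s) = ((t, w), s) + (((1 : ℝ), (0 : ℂ)), (0 : ℝ)) := by ext <;> simp
      rw [this, hcd, hfd])
    (by
      intro t s hs
      have h1 := hsm t s hs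
      refine h1.and ?_
      have h2 : ContinuousAt (fderiv ℝ Φ) ((t, 0), s) :=
        (h1.self_of_nhds.fderiv_right (m := 0) (by simp)).continuousAt
      exact h2.eventually
        ((ContinuousLinearMap.isOpen_injective (𝕜 := ℝ)).mem_nhds (hd t s hs)))
  obtain ⟨δ₂, hδ₂, h₂⟩ := eventually_core_pair_uniform
    (p := fun q q' => Φ q = Φ q' → ∃ n : ℤ, q' = q + (((n : ℝ), 0), 0)) (a := a) (b := b)
    (by
      intro t w s q
      rw [hper]
      refine imp_congr_right fun _ => ⟨?_, ?_⟩
      · rintro ⟨n, rfl⟩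
        exact ⟨n + 1, by ext <;> simp; ring⟩
      · rintro ⟨n, rfl⟩
        exact ⟨n - 1, by ext <;> simp⟩)
    (by
      intro t w s q
      rw [hper]
      refine imp_congr_right fun _ => ⟨?_, ?_⟩
      · rintro ⟨n, hn⟩
        refine ⟨n - 1, ?_⟩
        simp only [Prod.ext_iff, Prod.fst_add, Prod.snd_add] at hn ⊢
        refine ⟨⟨?_, hn.1.2⟩, hn.2⟩
        push_cast; linarith [hn.1.1]
      · rintro ⟨n, hn⟩
        refine ⟨n + 1, ?_⟩
        simp only [Prod.ext_iff, Prod.fst_add, Prod.snd_add] at hn ⊢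
        refine ⟨⟨?_, hn.1.2⟩, hn.2⟩
        push_cast; linarith [hn.1.1])
    (by
      intro t s hs t' s' hs'
      have hc := (hsm t s hs).self_of_nhds
      have hc' := (hsm t' s' hs').self_of_nhds
      -- Core points with equal images differ by a deck translation; once it is undone the pair is
      -- near the diagonal, where the derivative decides. Core points with different images are
      -- separated by continuity.
      by_cases he : Φ ((t, 0), s) = Φ ((t', 0), s')
      · obtain ⟨rfl, n, rfl⟩ := hi t t' s hs s' hs' he
        have h1 := (hc.hasStrictFDerivAt (by simp)).eventually_injective (hd t s hs)
        have h2 : Tendsto (fun q : ((ℝ × ℂ) × ℝ) × ((ℝ × ℂ) × ℝ) =>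
            (q.1, q.2 - (((n : ℝ), (0 : ℂ)), (0 : ℝ))))
            (𝓝 (((t, (0 : ℂ)), s), ((t + n, (0 : ℂ)), s)))
            (𝓝 (((t, (0 : ℂ)), s), ((t, (0 : ℂ)), s))) := by
          refine Continuous.tendsto' (by fun_prop) _ _ ?_
          ext <;> simp
        filter_upwards [h2.eventually h1] with q hq hqe
        refine ⟨n, ?_⟩
        have h3 := hq (by
          rw [hqe]
          have := htr (q.2 - (((n : ℝ), (0 : ℂ)), (0 : ℝ))) n
          simpa using this)
        rw [h3]; simp
      · have h1 : ContinuousAt (fun q : ((ℝ × ℂ) × ℝ) × ((ℝ × ℂ) × ℝ) => Φ q.1)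
            (((t, (0 : ℂ)), s), ((t', (0 : ℂ)), s')) :=
          ContinuousAt.comp (g := Φ) (f := Prod.fst) hc.continuousAt continuousAt_fst
        have h2 : ContinuousAt (fun q : ((ℝ × ℂ) × ℝ) × ((ℝ × ℂ) × ℝ) => Φ q.2)
            (((t, (0 : ℂ)), s), ((t', (0 : ℂ)), s')) :=
          ContinuousAt.comp (g := Φ) (f := Prod.snd) hc'.continuousAt continuousAt_snd
        filter_upwards [h1.ne_iff_eventually_ne h2 |>.1 he] with q hq hqe
        exact absurd hqe hq)
  refine ⟨min δ₁ δ₂, lt_min hδ₁ hδ₂, fun q hq s hs => h₁ q (disc_mono (min_le_left _ _) hq) s hs,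
    fun q hq s hs q' hq' s' hs' he => ?_⟩
  obtain ⟨n, hn⟩ := h₂ q (disc_mono (min_le_right _ _) hq) s hs q'
    (disc_mono (min_le_right _ _) hq') s' hs' he
  simp only [Prod.ext_iff, Prod.fst_add, Prod.snd_add, add_zero] at hn
  exact ⟨hn.2.symm, n, Prod.ext hn.1.1 (by simpa using hn.1.2)⟩

theorem injective_fderiv_graph {k : ℝ → R4} {t : ℝ} (s : ℝ) (hk : DifferentiableAt ℝ k t)
    (hk' : deriv k t ≠ 0) : Function.Injective (fderiv ℝ (fun p : ℝ × ℝ => (k p.1, p.2)) (t, s)) := by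
  have h1 : HasFDerivAt (fun p : ℝ × ℝ => k p.1) _ (t, s) :=
    HasFDerivAt.comp (g := k) (t, s) hk.hasDerivAt.hasFDerivAt hasFDerivAt_fst
  rw [(h1.prodMk hasFDerivAt_snd).fderiv]
  refine injective_of_forall_eq_zero fun v hv => ?_
  simp [Prod.ext_iff, hk'] at hv
  exact Prod.ext hv.1 hv.2

/-- A concordance of tubular neighbourhoods induces concordances of the satellites that are close
enough to the core. -/
theorem exists_collaredConcordant {Φ : (ℝ × ℂ) × ℝ → R4 × ℝ} {φ₀ φ₁ : ℝ × ℂ → R4} {L r : ℝ}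
    (hL : 0 < L) (hr : 0 < r) (hper : ∀ t w s, Φ ((t + 1, w), s) = Φ ((t, w), s))
    (hsm : ∀ t, ∀ s ∈ Icc 0 L, ∀ᶠ q in 𝓝 ((t, (0 : ℂ)), s), ContDiffAt ℝ ∞ Φ q ∧ (Φ q).1 ∈ S3)
    (h0 : ∀ p ∈ disc r, ∀ s ≤ 0, Φ (p, s) = (φ₀ p, s))
    (h1 : ∀ p ∈ disc r, ∀ s ≥ L, Φ (p, s) = (φ₁ p, s))
    (hm : ∀ p ∈ disc r, ∀ s ∈ Ioo 0 L, (Φ (p, s)).2 ∈ Ioo 0 L)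
    (hi : ∀ t t', ∀ s ∈ Icc 0 L, ∀ s' ∈ Icc 0 L,
      Φ ((t, 0), s) = Φ ((t', 0), s') → s = s' ∧ ∃ n : ℤ, t' = t + n)
    (hd : ∀ t, ∀ s ∈ Icc 0 L, Function.Injective (fderiv ℝ Φ ((t, 0), s)))
    {P : ℝ → ℝ × ℂ} (hP : TorusCurve P) :
    ∃ δ₀ > 0, ∀ δ ∈ Ioc 0 δ₀,
      CollaredConcordant (fun t => φ₀ (shrink δ (P t))) (fun t => φ₁ (shrink δ (P t))) := by
  obtain ⟨δ₁, hδ₁, hA, hB⟩ := exists_embedded_neighbourhood hper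
    (fun t s hs => (hsm t s hs).mono fun q hq => hq.1) hi hd
  obtain ⟨δ₂, hδ₂, hC⟩ := eventually_core_uniform (p := fun q => (Φ q).1 ∈ S3) (a := 0) (b := L)
    (fun t w s => by rw [hper]) (fun t s hs => (hsm t s hs).mono fun q hq => hq.2)
  obtain ⟨B, hB0, hPB⟩ := hP.exists_bound
  set ε := min r (min δ₁ δ₂) with hε
  have hε0 : 0 < ε := lt_min hr (lt_min hδ₁ hδ₂)
  -- Since `B` bounds the fibre coordinate of `P`, this puts the shrunk curve within distance `ε /
  -- 2` of the core.
  refine ⟨ε / (2 * B), by positivity, fun δ hδ => ?_⟩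
  have hδ0 : 0 < δ := hδ.1
  have hc' := hP.shrink hδ0.ne'
  set c : ℝ → ℝ × ℂ := fun t => shrink δ (P t) with hc
  have hcε : ∀ t, ‖(c t).2‖ < ε := by
    intro t
    rw [hc, norm_shrink_snd hδ0.le]
    calc δ * ‖(P t).2‖ ≤ ε / (2 * B) * B := mul_le_mul hδ.2 (hPB t) (norm_nonneg _) (by positivity)
      _ = ε / 2 := by field_simp
      _ < ε := by linarith
  have hcr : ∀ t, c t ∈ disc r := fun t => (hcε t).trans_le (min_le_left _ _)
  have hc1 : ∀ t, c t ∈ disc δ₁ := fun t =>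
    (hcε t).trans_le ((min_le_right _ _).trans (min_le_left _ _))
  have hc2 : ∀ t, c t ∈ disc δ₂ := fun t =>
    (hcε t).trans_le ((min_le_right _ _).trans (min_le_right _ _))
  set A : ℝ × ℝ → R4 × ℝ := fun p => Φ (c p.1, p.2) with hAdef
  have hg : ContDiff ℝ ∞ fun p : ℝ × ℝ => (c p.1, p.2) :=
    (hc'.smooth.comp contDiff_fst).prodMk contDiff_snd
  have hgd : ∀ p, Function.Injective (fderiv ℝ (fun p : ℝ × ℝ => (c p.1, p.2)) p) := by
    intro p
    have h1 : HasFDerivAt (fun p : ℝ × ℝ => c p.1) _ p :=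
      HasFDerivAt.comp (g := c) p
        (hc'.smooth.differentiable (by simp) p.1).hasDerivAt.hasFDerivAt hasFDerivAt_fst
    rw [(h1.prodMk hasFDerivAt_snd).fderiv]
    refine injective_of_forall_eq_zero fun v hv => ?_
    have hne := hc'.immersion p.1
    rw [ContinuousLinearMap.prod_apply, Prod.mk_eq_zero] at hv
    simp [hne] at hv
    exact Prod.ext hv.1 hv.2
  have hAmid : ∀ t, ∀ s ∈ Icc 0 L, ContDiffAt ℝ ∞ A (t, s) ∧
      Function.Injective (fderiv ℝ A (t, s)) := by
    intro t s hs
    have h := hA (c t) (hc1 t) s hs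
    exact ⟨ContDiffAt.comp (t, s) (g := Φ) h.1 hg.contDiffAt,
      injective_fderiv_comp (g := Φ) (f := fun p : ℝ × ℝ => (c p.1, p.2))
        (h.1.differentiableAt (by simp)) (hg.differentiable (by simp) _) h.2 (hgd _)⟩
  -- Outside the levels in `Icc 0 L` only the product form of `Φ` is known. Smoothness and
  -- immersivity of the collars are therefore read off from the end slices of the middle part.
  have key : ∀ (φ : ℝ × ℂ → R4) (s₀ : ℝ), s₀ ∈ Icc 0 L →
      (∀ p ∈ disc r, Φ (p, s₀) = (φ p, s₀)) →
      ∀ t, ContDiffAt ℝ ∞ (fun t => φ (c t)) t ∧ deriv (fun t => φ (c t)) t ≠ 0 := by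
    intro φ s₀ hs₀ hφ t
    have h2 : (fun t => A (t, s₀)) = fun t => (φ (c t), s₀) := by
      funext t; exact hφ _ (hcr t)
    have h3 : ContDiffAt ℝ ∞ (fun t => (φ (c t), s₀)) t := by
      rw [← h2]
      exact ContDiffAt.comp t (g := A) (hAmid t s₀ hs₀).1 (by fun_prop)
    have h4 : ContDiffAt ℝ ∞ (fun t => φ (c t)) t := h3.fst
    refine ⟨h4, fun h0 => ?_⟩
    have h5 : HasDerivAt (fun t : ℝ => (t, s₀)) ((1 : ℝ), (0 : ℝ)) t :=
      (hasDerivAt_id _).prodMk (hasDerivAt_const _ _)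
    have h6 := ((hAmid t s₀ hs₀).1.differentiableAt (by simp)).hasFDerivAt.comp_hasDerivAt t h5
    have h7 : HasDerivAt (fun t => A (t, s₀)) ((0 : R4), (0 : ℝ)) t := by
      rw [h2]
      refine HasDerivAt.prodMk ?_ (hasDerivAt_const _ _)
      rw [← h0]
      exact (h4.differentiableAt (by simp)).hasDerivAt
    have h8 := h6.unique h7
    have h9 := (hAmid t s₀ hs₀).2 (h8.trans (map_zero (fderiv ℝ A (t, s₀))).symm)
    simp at h9
  have k0 := key φ₀ 0 ⟨le_rfl, hL.le⟩ fun p hp => h0 p hp 0 le_rfl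
  have k1 := key φ₁ L ⟨hL.le, le_rfl⟩ fun p hp => h1 p hp L le_rfl
  have hAe : ∀ t s, (s < 0 → A =ᶠ[𝓝 (t, s)] fun p => (φ₀ (c p.1), p.2)) ∧
      (L < s → A =ᶠ[𝓝 (t, s)] fun p => (φ₁ (c p.1), p.2)) := by
    refine fun t s => ⟨fun hs => ?_, fun hs => ?_⟩
    · filter_upwards [(isOpen_lt continuous_snd continuous_const).mem_nhds (x := (t, s)) hs] with q hq
      exact h0 _ (hcr q.1) q.2 hq.le
    · filter_upwards [(isOpen_lt continuous_const continuous_snd).mem_nhds (x := (t, s)) hs] with q hq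
      exact h1 _ (hcr q.1) q.2 hq.le
  have hgraph : ∀ φ : ℝ × ℂ → R4, ∀ t s, ContDiffAt ℝ ∞ (fun t => φ (c t)) t →
      ContDiffAt ℝ ∞ (fun p : ℝ × ℝ => (φ (c p.1), p.2)) (t, s) := fun φ t s h =>
    (ContDiffAt.comp (t, s) (g := fun t => φ (c t)) h contDiffAt_fst).prodMk contDiffAt_snd
  have hAi : ∀ t t', ∀ s ∈ Icc 0 L, ∀ s' ∈ Icc 0 L, A (t, s) = A (t', s') →
      s = s' ∧ ∃ n : ℤ, t' = t + n := by
    intro t t' s hs s' hs' h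
    obtain ⟨h3, h4⟩ := hB _ (hc1 t) s hs _ (hc1 t') s' hs' h
    exact ⟨h3, hc'.injective _ _ h4⟩
  -- The last coordinate tells the two collars and the middle part from each other, so injectivity
  -- can be checked on each separately.
  have hsnd : ∀ t s, (s < 0 ∧ (A (t, s)).2 = s) ∨
      (s ∈ Icc 0 L ∧ (A (t, s)).2 ∈ Icc 0 L) ∨ (L < s ∧ (A (t, s)).2 = s) := by
    intro t s
    rcases lt_trichotomy s 0 with h | h | h
    · left; exact ⟨h, by simp only [hAdef, h0 _ (hcr t) s h.le]⟩
    · right; left; subst h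
      simp only [hAdef, h0 _ (hcr t) 0 le_rfl]
      exact ⟨⟨le_rfl, hL.le⟩, le_rfl, hL.le⟩
    · right
      rcases lt_trichotomy s L with h' | h' | h'
      · left; exact ⟨⟨h.le, h'.le⟩, Ioo_subset_Icc_self (hm _ (hcr t) s ⟨h, h'⟩)⟩
      · left; subst h'
        simp only [hAdef, h1 _ (hcr t) s le_rfl]
        exact ⟨⟨hL.le, le_rfl⟩, hL.le, le_rfl⟩
      · right; exact ⟨h', by simp only [hAdef, h1 _ (hcr t) s h'.le]⟩
  refine ⟨L, A, hL, ?_, ?_, ?_, ?_, ?_, ?_, ?_, ?_⟩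
  · rw [contDiff_iff_contDiffAt]
    rintro ⟨t, s⟩
    rcases lt_or_ge s 0 with h | h
    · exact (hgraph φ₀ t s (k0 t).1).congr_of_eventuallyEq ((hAe t s).1 h)
    rcases lt_or_ge L s with h' | h'
    · exact (hgraph φ₁ t s (k1 t).1).congr_of_eventuallyEq ((hAe t s).2 h')
    · exact (hAmid t s ⟨h, h'⟩).1
  · intro t s
    obtain ⟨l, hl⟩ := hc'.periodic
    simp only [hAdef, hl]
    exact periodic_int (φ := fun p => Φ (p, s)) (fun t w => hper t w s) l (c t)
  · intro t s
    rcases lt_or_ge s 0 with h | h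
    · have := hC _ (hc2 t) 0 ⟨le_rfl, hL.le⟩
      rw [h0 _ (hcr t) 0 le_rfl] at this
      simp only [hAdef, h0 _ (hcr t) s h.le]
      exact this
    rcases lt_or_ge L s with h' | h'
    · have := hC _ (hc2 t) L ⟨hL.le, le_rfl⟩
      rw [h1 _ (hcr t) L le_rfl] at this
      simp only [hAdef, h1 _ (hcr t) s h'.le]
      exact this
    · exact hC _ (hc2 t) s ⟨h, h'⟩
  · intro t s hs; exact h0 _ (hcr t) s hs
  · intro t s hs; exact h1 _ (hcr t) s hs
  · intro t s hs; exact hm _ (hcr t) s hs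
  · intro t s t' s' h
    have hh : (A (t, s)).2 = (A (t', s')).2 := by rw [h]
    rcases hsnd t s with ⟨a1, a2⟩ | ⟨a1, a2⟩ | ⟨a1, a2⟩ <;>
    rcases hsnd t' s' with ⟨b1, b2⟩ | ⟨b1, b2⟩ | ⟨b1, b2⟩
    · have hss : s = s' := by rw [← a2, ← b2, hh]
      subst hss
      refine ⟨rfl, (hAi t t' 0 ⟨le_rfl, hL.le⟩ 0 ⟨le_rfl, hL.le⟩ ?_).2⟩
      simp only [hAdef, h0 _ (hcr _) s a1.le, h0 _ (hcr _) 0 le_rfl, Prod.mk.injEq, and_true] at h ⊢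
      exact h
    · linarith [b2.1]
    · linarith
    · linarith [a2.1]
    · exact hAi t t' s a1 s' b1 h
    · linarith [a2.2]
    · linarith
    · linarith [b2.2]
    · have hss : s = s' := by rw [← a2, ← b2, hh]
      subst hss
      refine ⟨rfl, (hAi t t' L ⟨hL.le, le_rfl⟩ L ⟨hL.le, le_rfl⟩ ?_).2⟩
      simp only [hAdef, h1 _ (hcr _) s a1.le, h1 _ (hcr _) L le_rfl, Prod.mk.injEq, and_true] at h ⊢
      exact h
  · intro t s
    rcases lt_or_ge s 0 with h | h
    · rw [((hAe t s).1 h).fderiv_eq]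
      exact injective_fderiv_graph (k := fun t => φ₀ (c t)) s ((k0 t).1.differentiableAt (by simp)) (k0 t).2
    rcases lt_or_ge L s with h' | h'
    · rw [((hAe t s).2 h').fderiv_eq]
      exact injective_fderiv_graph (k := fun t => φ₁ (c t)) s ((k1 t).1.differentiableAt (by simp)) (k1 t).2
    · exact (hAmid t s ⟨h, h'⟩).2

/-! ### Isotopies of tubular neighbourhoods -/

/-- The derivative of a level-preserving map is block triangular, with the identity in the level
direction. -/
theorem injective_fderiv_level {E F : Type*} [NormedAddCommGroup E] [NormedSpace ℝ E]
    [NormedAddCommGroup F] [NormedSpace ℝ F] {G : E × ℝ → F} {x : E} {s : ℝ}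
    (hG : DifferentiableAt ℝ G (x, s)) (h : Function.Injective (fderiv ℝ (fun y => G (y, s)) x)) :
    Function.Injective (fderiv ℝ (fun p : E × ℝ => (G p, p.2)) (x, s)) := by
  have h1 : HasFDerivAt (fun p : E × ℝ => (G p, p.2)) _ (x, s) :=
    hG.hasFDerivAt.prodMk hasFDerivAt_snd
  rw [h1.fderiv]
  refine injective_of_forall_eq_zero fun v hv => ?_
  rw [ContinuousLinearMap.prod_apply, Prod.mk_eq_zero] at hv
  have hv2 : v.2 = 0 := hv.2
  have h2 : HasFDerivAt (fun y => G (y, s)) _ x :=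
    HasFDerivAt.comp x (f := fun y => (y, s)) hG.hasFDerivAt (hasFDerivAt_prodMk_left x s)
  rw [h2.fderiv] at h
  have h3 : v.1 = 0 := by
    refine h ?_
    rw [map_zero]
    have : v = (v.1, 0) := Prod.ext rfl hv2
    rw [this] at hv
    simpa using hv.1
  exact Prod.ext h3 hv2

/-- Level-preserving case of `exists_collaredConcordant`. Injectivity and immersivity are required
on the core only, so each level need not embed any tube of a prescribed radius. -/
theorem exists_collaredConcordant_of_isotopy {F : (ℝ × ℂ) × ℝ → R4}
    (hper : ∀ t w s, F ((t + 1, w), s) = F ((t, w), s))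
    (hsm : ∀ t, ∀ s ∈ Icc (0 : ℝ) 1, ∀ᶠ q in 𝓝 ((t, (0 : ℂ)), s), ContDiffAt ℝ ∞ F q ∧ F q ∈ S3)
    (hi : ∀ s ∈ Icc (0 : ℝ) 1, ∀ t t', F ((t, 0), s) = F ((t', 0), s) → ∃ n : ℤ, t' = t + n)
    (hd : ∀ t, ∀ s ∈ Icc (0 : ℝ) 1, Function.Injective (fderiv ℝ (fun p => F (p, s)) (t, 0)))
    {P : ℝ → ℝ × ℂ} (hP : TorusCurve P) :
    ∃ δ₀ > 0, ∀ δ ∈ Ioc 0 δ₀,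
      CollaredConcordant (fun t => F (shrink δ (P t), 0)) (fun t => F (shrink δ (P t), 1)) := by
  set σ := Real.smoothTransition
  have hσ : ∀ s, σ s ∈ Icc (0 : ℝ) 1 := fun s =>
    ⟨Real.smoothTransition.nonneg s, Real.smoothTransition.le_one s⟩
  have hσs : ContDiff ℝ ∞ σ := Real.smoothTransition.contDiff
  have hgs : ContDiff ℝ ∞ fun q : (ℝ × ℂ) × ℝ => (q.1, σ q.2) :=
    contDiff_fst.prodMk (hσs.comp contDiff_snd)
  have hev : ∀ t s, ∀ᶠ q : (ℝ × ℂ) × ℝ in 𝓝 ((t, (0 : ℂ)), s),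
      ContDiffAt ℝ ∞ (fun q : (ℝ × ℂ) × ℝ => F (q.1, σ q.2)) q ∧ F (q.1, σ q.2) ∈ S3 := by
    intro t s
    have h1 : Tendsto (fun q : (ℝ × ℂ) × ℝ => (q.1, σ q.2)) (𝓝 ((t, 0), s))
        (𝓝 ((t, 0), σ s)) := hgs.continuous.tendsto' _ _ rfl
    filter_upwards [h1.eventually (hsm t (σ s) (hσ s))] with q hq
    exact ⟨ContDiffAt.comp q (g := F) hq.1 hgs.contDiffAt, hq.2⟩
  refine exists_collaredConcordant (Φ := fun q => (F (q.1, σ q.2), q.2)) (φ₀ := fun p => F (p, 0))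
    (φ₁ := fun p => F (p, 1)) one_pos one_pos ?_ ?_ ?_ ?_ ?_ ?_ ?_ hP
  · intro t w s; simp only [hper]
  · intro t s _
    filter_upwards [hev t s] with q hq
    exact ⟨hq.1.prodMk contDiffAt_snd, hq.2⟩
  · intro p _ s hs; simp only [σ, Real.smoothTransition.zero_of_nonpos hs]
  · intro p _ s hs; simp only [σ, Real.smoothTransition.one_of_one_le hs]
  · intro p _ s hs; exact hs
  · intro t t' s _ s' _ h
    simp only [Prod.mk.injEq] at h
    obtain ⟨h1, rfl⟩ := h
    exact ⟨rfl, hi _ (hσ s) _ _ h1⟩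
  · intro t s _
    exact injective_fderiv_level ((hev t s).self_of_nhds.1.differentiableAt (by simp)) (hd t _ (hσ s))

theorem EmbOn.curve {D : Set (ℝ × ℂ)} {ψ : ℝ × ℂ → R4} (hψ : EmbOn D ψ) {c : ℝ → ℝ × ℂ}
    (hc : TorusCurve c) (hD : ∀ t, c t ∈ D) :
    (∀ t, ψ (c (t + 1)) = ψ (c t)) ∧ (∀ t t', ψ (c t) = ψ (c t') → ∃ n : ℤ, t' = t + n) ∧
      ∀ t, deriv (fun t => ψ (c t)) t ≠ 0 := by
  refine ⟨fun t => ?_, fun t t' h => ?_, fun t h => ?_⟩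
  · obtain ⟨l, hl⟩ := hc.periodic
    rw [hl]
    exact periodic_int hψ.periodic l _
  · obtain ⟨n, hn⟩ := hψ.injective _ (hD t) _ (hD t') h
    exact hc.injective _ _ ⟨n, hn⟩
  · have h1 := ((hψ.smooth _ (hD t)).differentiableAt (by simp)).hasFDerivAt.comp_hasDerivAt t
      (hc.smooth.differentiable (by simp) t).hasDerivAt
    have h2 : deriv (fun t => ψ (c t)) t = _ := h1.deriv
    rw [h2] at h
    exact hc.immersion t (hψ.immersion _ (hD t) (h.trans (map_zero _).symm))

/-- Fibrewise contraction keeps the curve embedded in `S¹ × ℂ`, and `ψ` is an embedding on `D`.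
Hence no smallness of `δ` is needed, and the lemma also serves to enlarge curves again. -/
theorem EmbOn.collaredConcordant_shrink {D : Set (ℝ × ℂ)} {ψ : ℝ × ℂ → R4} (hψ : EmbOn D ψ)
    {P : ℝ → ℝ × ℂ} (hP : TorusCurve P) {δ : ℝ} (hδ : 0 < δ) (hδ1 : δ ≤ 1)
    (hD : ∀ u ∈ Icc δ 1, ∀ t, shrink u (P t) ∈ D) :
    CollaredConcordant (fun t => ψ (P t)) (fun t => ψ (shrink δ (P t))) := by
  have hu : ∀ s ∈ Icc (0 : ℝ) 1, 1 - s * (1 - δ) ∈ Icc δ 1 := fun s hs =>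
    ⟨by nlinarith [hs.2], by nlinarith [hs.1]⟩
  have hu0 : ∀ s ∈ Icc (0 : ℝ) 1, 1 - s * (1 - δ) ≠ 0 := fun s hs =>
    (hδ.trans_le (hu s hs).1).ne'
  have h := collaredConcordant_of_isotopy
    (k := fun p : ℝ × ℝ => ψ (shrink (1 - p.2 * (1 - δ)) (P p.1))) ?_ ?_ ?_ ?_ ?_
  · simpa [shrink_one] using h
  · intro t s hs
    have h1 : ContDiff ℝ ∞ fun p : ℝ × ℝ => shrink (1 - p.2 * (1 - δ)) (P p.1) := by
      have := hP.smooth.comp (contDiff_fst (𝕜 := ℝ) (E := ℝ) (F := ℝ))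
      refine this.fst.prodMk (ContDiff.mul ?_ this.snd)
      exact Complex.ofRealCLM.contDiff.comp (contDiff_const.sub (contDiff_snd.mul contDiff_const))
    exact ContDiffAt.comp (t, s) (g := ψ) (hψ.smooth _ (hD _ (hu s hs) t)) h1.contDiffAt
  · intro t s hs
    exact (hψ.curve (hP.shrink (hu0 s hs)) (hD _ (hu s hs))).1 t
  · intro t s hs
    exact hψ.mem_sphere _ (hD _ (hu s hs) t)
  · intro s hs t t'
    exact (hψ.curve (hP.shrink (hu0 s hs)) (hD _ (hu s hs))).2.1 t t'
  · intro t s hs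
    exact (hψ.curve (hP.shrink (hu0 s hs)) (hD _ (hu s hs))).2.2 t

/-- A smooth family of germs of embeddings of a neighbourhood of `S¹ × {0}` in `S¹ × ℂ`. -/
structure TorusFamily (F : (ℝ × ℂ) × ℝ → ℝ × ℂ) : Prop where
  smooth : ∀ t, ∀ s ∈ Icc (0 : ℝ) 1, ∀ᶠ q in 𝓝 ((t, (0 : ℂ)), s), ContDiffAt ℝ ∞ F q
  equivariant : ∀ t w s, F ((t + 1, w), s) = F ((t, w), s) + (1, 0)
  core_injective : ∀ s ∈ Icc (0 : ℝ) 1, ∀ t t', ∀ k : ℤ,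
    F ((t', 0), s) = F ((t, 0), s) + ((k : ℝ), 0) → ∃ n : ℤ, t' = t + n
  immersion : ∀ t, ∀ s ∈ Icc (0 : ℝ) 1, Function.Injective (fderiv ℝ (fun p => F (p, s)) (t, 0))

theorem ContDiffAt.comp_prodMk_left {E F : Type*} [NormedAddCommGroup E] [NormedSpace ℝ E]
    [NormedAddCommGroup F] [NormedSpace ℝ F] {G : E × ℝ → F} {x : E} {s : ℝ}
    (hG : ContDiffAt ℝ ∞ G (x, s)) : ContDiffAt ℝ ∞ (fun y => G (y, s)) x :=
  ContDiffAt.comp x (g := G) (f := fun y => (y, s)) hG (by fun_prop)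

theorem EmbOn.isotopy_family {R : ℝ} {ψ : ℝ × ℂ → R4} (hψ : EmbOn (disc R) ψ)
    {F : (ℝ × ℂ) × ℝ → ℝ × ℂ} (hF : TorusFamily F)
    (hcore : ∀ t, ∀ s ∈ Icc (0 : ℝ) 1, ‖(F ((t, 0), s)).2‖ < R) :
    (∀ t w s, ψ (F ((t + 1, w), s)) = ψ (F ((t, w), s))) ∧
    (∀ t, ∀ s ∈ Icc (0 : ℝ) 1, ∀ᶠ q in 𝓝 ((t, (0 : ℂ)), s),
      ContDiffAt ℝ ∞ (fun q => ψ (F q)) q ∧ ψ (F q) ∈ S3) ∧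
    (∀ s ∈ Icc (0 : ℝ) 1, ∀ t t', ψ (F ((t, 0), s)) = ψ (F ((t', 0), s)) → ∃ n : ℤ, t' = t + n) ∧
    ∀ t, ∀ s ∈ Icc (0 : ℝ) 1, Function.Injective (fderiv ℝ (fun p => ψ (F (p, s))) (t, 0)) := by
  refine ⟨fun t w s => ?_, fun t s hs => ?_, fun s hs t t' h => ?_, fun t s hs => ?_⟩
  · rw [hF.equivariant]
    have := periodic_int hψ.periodic 1 (F ((t, w), s))
    simpa using this
  · have h1 := (hF.smooth t s hs).self_of_nhds.continuousAt.eventually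
      ((isOpen_disc R).mem_nhds (hcore t s hs))
    filter_upwards [hF.smooth t s hs, h1] with q hq hq'
    exact ⟨ContDiffAt.comp q (g := ψ) (hψ.smooth _ hq') hq, hψ.mem_sphere _ hq'⟩
  · obtain ⟨n, hn⟩ := hψ.injective _ (hcore t s hs) _ (hcore t' s hs) h
    exact hF.core_injective s hs t t' n hn
  · exact injective_fderiv_comp (g := ψ) (f := fun p => F (p, s))
      ((hψ.smooth _ (hcore t s hs)).differentiableAt (by simp))
      ((hF.smooth t s hs).self_of_nhds.comp_prodMk_left.differentiableAt (by simp))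
      (hψ.immersion _ (hcore t s hs)) (hF.immersion t s hs)

theorem EmbOn.exists_collaredConcordant_family {R : ℝ} {ψ : ℝ × ℂ → R4} (hψ : EmbOn (disc R) ψ)
    {F : (ℝ × ℂ) × ℝ → ℝ × ℂ} (hF : TorusFamily F)
    (hcore : ∀ t, ∀ s ∈ Icc (0 : ℝ) 1, ‖(F ((t, 0), s)).2‖ < R)
    {P : ℝ → ℝ × ℂ} (hP : TorusCurve P) :
    ∃ δ₀ > 0, ∀ δ ∈ Ioc 0 δ₀, CollaredConcordant (fun t => ψ (F (shrink δ (P t), 0)))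
      (fun t => ψ (F (shrink δ (P t), 1))) := by
  obtain ⟨h1, h2, h3, h4⟩ := hψ.isotopy_family hF hcore
  exact exists_collaredConcordant_of_isotopy (F := fun q => ψ (F q)) h1 h2 h3 h4 hP

theorem IsTube.embOn {φ : ℝ × ℂ → R4} (h : IsTube φ) : EmbOn solidTorus φ where
  smooth := h.smooth
  periodic := h.periodic
  mem_sphere := h.mem_sphere
  injective := h.injective
  immersion := by
    intro p hp
    refine injective_of_forall_eq_zero fun v hv => ?_
    by_contra hne
    -- A kernel vector of the derivative is a linear relation among the last three rows of the
    -- orientation matrix; the row of `φ p` gets the coefficient zero.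
    refine (h.oriented p hp).ne' (Matrix.exists_vecMul_eq_zero_iff.1
      ⟨![0, v.1, v.2.re, v.2.im], ?_, ?_⟩)
    · intro h0
      refine hne (Prod.ext (congrFun h0 1) (Complex.ext (congrFun h0 2) (congrFun h0 3)))
    · have hv' : v = v.1 • ((1 : ℝ), (0 : ℂ)) + v.2.re • ((0 : ℝ), (1 : ℂ))
          + v.2.im • ((0 : ℝ), Complex.I) := by
        refine Prod.ext (by simp) ?_
        simp [Complex.re_add_im]
      rw [hv', map_add, map_add, map_smul, map_smul, map_smul] at hv
      funext j
      have := congrArg (fun x : R4 => x j) hv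
      simp only [PiLp.add_apply, PiLp.smul_apply, PiLp.zero_apply, smul_eq_mul] at this
      simp only [Matrix.vecMul, dotProduct, Fin.sum_univ_four, Matrix.of_apply, Pi.zero_apply]
      simpa using this

theorem disc_one_subset_solidTorus : disc 1 ⊆ solidTorus := fun p hp =>
  show ‖p.2‖ ≤ 1 from le_of_lt hp

/-! ### The standard solid torus -/

/-- The factor that projects `ℂ²` to the 3-sphere. -/
noncomputable def stdScale (p : ℝ × ℂ) : ℝ := (Real.sqrt (1 + ‖p.2‖ ^ 2))⁻¹

/-- The standard solid torus before projection to the 3-sphere. -/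
noncomputable def stdLift (p : ℝ × ℂ) : R4 :=
  !₂[Real.cos (2 * Real.pi * p.1), Real.sin (2 * Real.pi * p.1), p.2.re, p.2.im]

theorem stdTorus_eq (p : ℝ × ℂ) : stdTorus p = stdScale p • stdLift p := rfl

theorem stdScale_pos (p : ℝ × ℂ) : 0 < stdScale p := by
  unfold stdScale; positivity

theorem contDiff_stdScale : ContDiff ℝ ∞ stdScale := by
  unfold stdScale
  have h : ContDiff ℝ ∞ fun p : ℝ × ℂ => 1 + ‖p.2‖ ^ 2 := contDiff_const.add (contDiff_snd.norm_sq ℝ)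
  exact (h.sqrt fun p => by positivity).inv fun p => by positivity

theorem contDiff_stdLift : ContDiff ℝ ∞ stdLift := by
  rw [contDiff_euclidean]
  intro i
  have hre : ContDiff ℝ ∞ fun p : ℝ × ℂ => p.2.re := Complex.reCLM.contDiff.comp contDiff_snd
  have him : ContDiff ℝ ∞ fun p : ℝ × ℂ => p.2.im := Complex.imCLM.contDiff.comp contDiff_snd
  fin_cases i <;> simp [stdLift]
  · fun_prop
  · fun_prop
  · exact hre
  · exact him

theorem contDiff_stdTorus : ContDiff ℝ ∞ stdTorus :=
  contDiff_stdScale.smul contDiff_stdLift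

theorem norm_stdTorus (p : ℝ × ℂ) : ‖stdTorus p‖ = 1 := by
  have h1 : ‖stdLift p‖ = Real.sqrt (1 + ‖p.2‖ ^ 2) := by
    rw [EuclideanSpace.norm_eq]
    congr 1
    simp only [Fin.sum_univ_four, stdLift, Real.norm_eq_abs, sq_abs]
    simp only [Fin.isValue, Matrix.cons_val]
    rw [Complex.sq_norm, Complex.normSq_apply]
    nlinarith [Real.sin_sq_add_cos_sq (2 * Real.pi * p.1)]
  rw [stdTorus_eq, norm_smul, h1, Real.norm_of_nonneg (stdScale_pos p).le, stdScale]
  exact inv_mul_cancel₀ (by positivity)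

theorem stdTorus_zero (p : ℝ × ℂ) : stdTorus p 0 = stdScale p * Real.cos (2 * Real.pi * p.1) := rfl
theorem stdTorus_one (p : ℝ × ℂ) : stdTorus p 1 = stdScale p * Real.sin (2 * Real.pi * p.1) := rfl
theorem stdTorus_two (p : ℝ × ℂ) : stdTorus p 2 = stdScale p * p.2.re := rfl
theorem stdTorus_three (p : ℝ × ℂ) : stdTorus p 3 = stdScale p * p.2.im := rfl

theorem embOn_stdTorus : EmbOn univ stdTorus where
  smooth _ _ := contDiff_stdTorus.contDiffAt
  periodic t w := by
    have h1 : 2 * Real.pi * (t + 1) = 2 * Real.pi * t + 2 * Real.pi := by ring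
    simp only [stdTorus, h1, Real.cos_add_two_pi, Real.sin_add_two_pi]
  mem_sphere p _ := by simpa using norm_stdTorus p
  injective p _ q _ h := by
    have e0 := congrArg (fun x : R4 => x 0) h
    have e1 := congrArg (fun x : R4 => x 1) h
    have e2 := congrArg (fun x : R4 => x 2) h
    have e3 := congrArg (fun x : R4 => x 3) h
    simp only [stdTorus_zero, stdTorus_one, stdTorus_two, stdTorus_three] at e0 e1 e2 e3
    have hp := stdScale_pos p
    have hq := stdScale_pos q
    have hs : stdScale p = stdScale q := by
      have h1 : stdScale p ^ 2 = stdScale q ^ 2 := by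
        have h2 := Real.sin_sq_add_cos_sq (2 * Real.pi * p.1)
        have h3 := Real.sin_sq_add_cos_sq (2 * Real.pi * q.1)
        calc stdScale p ^ 2 = (stdScale p * Real.cos (2 * Real.pi * p.1)) ^ 2
              + (stdScale p * Real.sin (2 * Real.pi * p.1)) ^ 2 := by
                linear_combination (-stdScale p ^ 2) * h2
          _ = stdScale q ^ 2 := by rw [e0, e1]; linear_combination (stdScale q ^ 2) * h3
      exact (sq_eq_sq₀ hp.le hq.le).1 h1
    rw [hs] at e0 e1 e2 e3
    have e0 := mul_left_cancel₀ hq.ne' e0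
    have e1 := mul_left_cancel₀ hq.ne' e1
    have e2 := mul_left_cancel₀ hq.ne' e2
    have e3 := mul_left_cancel₀ hq.ne' e3
    obtain ⟨k, hk⟩ := Real.Angle.angle_eq_iff_two_pi_dvd_sub.1 (Real.Angle.cos_sin_inj e0.symm e1.symm)
    refine ⟨k, Prod.ext ?_ ?_⟩
    · have : q.1 - p.1 = k := by
        have h5 : (2 * Real.pi) * (q.1 - p.1) = (2 * Real.pi) * k := by linarith
        exact mul_left_cancel₀ (by positivity) h5
      simp; linarith
    · simpa using (Complex.ext e2 e3).symm
  immersion p _ := by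
    refine injective_of_forall_eq_zero fun v hv => ?_
    have h1 := (contDiff_stdScale.differentiable (by simp) p).hasFDerivAt.smul
      (contDiff_stdLift.differentiable (by simp) p).hasFDerivAt
    have h2 : fderiv ℝ stdTorus p = _ := h1.fderiv
    rw [h2] at hv
    set u := fderiv ℝ stdLift p v with hu
    set m := fderiv ℝ stdScale p v with hm
    have hv' : stdScale p • u + m • stdLift p = 0 := by simpa using hv
    have hcomp : ∀ i : Fin 4, ∀ f : ℝ × ℂ → ℝ, (∀ q, stdLift q i = f q) →
        ∀ f' : ℝ × ℂ →L[ℝ] ℝ, HasFDerivAt f f' p → u i = f' v := by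
      intro i f hf f' hf'
      have h3 := (EuclideanSpace.proj (𝕜 := ℝ) i : R4 →L[ℝ] ℝ).hasFDerivAt.comp p
        (contDiff_stdLift.differentiable (by simp) p).hasFDerivAt
      have h4 : HasFDerivAt f ((EuclideanSpace.proj (𝕜 := ℝ) i : R4 →L[ℝ] ℝ).comp
          (fderiv ℝ stdLift p)) p := by
        refine h3.congr_of_eventuallyEq (Eventually.of_forall fun q => ?_)
        rw [← hf]; rfl
      rw [hf'.unique h4]; rfl
    have ha : HasFDerivAt (fun q : ℝ × ℂ => 2 * Real.pi * q.1)
        ((2 * Real.pi) • ContinuousLinearMap.fst ℝ ℝ ℂ) p := hasFDerivAt_fst.const_mul _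
    have u0 := hcomp 0 _ (fun q => rfl) _ ha.cos
    have u1 := hcomp 1 _ (fun q => rfl) _ ha.sin
    have u2 := hcomp 2 (fun q => q.2.re) (fun q => rfl) _
      (Complex.reCLM.hasFDerivAt.comp p (hasFDerivAt_snd (𝕜 := ℝ)))
    have u3 := hcomp 3 (fun q => q.2.im) (fun q => rfl) _
      (Complex.imCLM.hasFDerivAt.comp p (hasFDerivAt_snd (𝕜 := ℝ)))
    have c0 := congrArg (fun x : R4 => x 0) hv'
    have c1 := congrArg (fun x : R4 => x 1) hv'
    have c2 := congrArg (fun x : R4 => x 2) hv'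
    have c3 := congrArg (fun x : R4 => x 3) hv'
    have l0 : stdLift p 0 = Real.cos (2 * Real.pi * p.1) := rfl
    have l1 : stdLift p 1 = Real.sin (2 * Real.pi * p.1) := rfl
    simp [u0, u1, u2, u3, l0, l1] at c0 c1 c2 c3
    have hs := stdScale_pos p
    have h5 := Real.sin_sq_add_cos_sq (2 * Real.pi * p.1)
    -- Pairing the first two coordinates with the unit vector of cosine and sine isolates the
    -- derivative of the scale; pairing with its quarter turn isolates the angular part.
    have hm0 : m = 0 := by
      linear_combination (Real.cos (2 * Real.pi * p.1)) * c0 + (Real.sin (2 * Real.pi * p.1)) * c1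
        - m * h5
    have hv1 : stdScale p * (2 * Real.pi * v.1) = 0 := by
      linear_combination (-Real.sin (2 * Real.pi * p.1)) * c0 + (Real.cos (2 * Real.pi * p.1)) * c1
        - (stdScale p * (2 * Real.pi * v.1)) * h5
    have hpi := Real.pi_pos.ne'
    simp [hs.ne', hpi] at hv1
    simp [hm0, hs.ne'] at c2 c3
    exact Prod.ext hv1 (Complex.ext c2 c3)

/-! ### Degrees of loops -/

theorem circle_exp_eq_iff {a b : ℝ} :
    Circle.exp (2 * Real.pi * a) = Circle.exp (2 * Real.pi * b) ↔ ∃ k : ℤ, a = b + k := by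
  rw [Circle.exp_eq_exp]
  have hpi := Real.pi_pos
  refine exists_congr fun k => ⟨fun h => ?_, fun h => by rw [h]; ring⟩
  have : (2 * Real.pi) * a = (2 * Real.pi) * (b + k) := by linarith
  exact mul_left_cancel₀ (by positivity) this

theorem exists_circle_lift {X : Type*} [NormedAddCommGroup X] [NormedSpace ℝ X] {f : X → Circle}
    (hf : Continuous f) : ∃ θ : X → ℝ, Continuous θ ∧ ∀ x, f x = Circle.exp (2 * Real.pi * θ x) := by
  obtain ⟨e₀, he₀⟩ := Circle.exp_surjective (f 0)
  obtain ⟨F, ⟨_, hF⟩, _⟩ := Circle.isCoveringMap_exp.existsUnique_continuousMap_lifts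
    (⟨f, hf⟩ : C(X, Circle)) 0 e₀ he₀
  refine ⟨fun x => F x / (2 * Real.pi), by fun_prop, fun x => ?_⟩
  have h1 : 2 * Real.pi * (F x / (2 * Real.pi)) = F x := by
    have := Real.pi_pos; field_simp
  rw [h1]
  exact (congrFun hF x).symm

theorem eq_of_continuous_of_int {X : Type*} [TopologicalSpace X] [PreconnectedSpace X] {d : X → ℝ}
    (hd : Continuous d) (hi : ∀ x, ∃ k : ℤ, d x = k) (x y : X) : d x = d y := by
  choose k hk using hi
  have h1 : Continuous k := by
    rw [Int.isClosedEmbedding_coe_real.isInducing.continuous_iff]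
    convert hd using 1
    funext x; exact (hk x).symm
  rw [hk, hk, PreconnectedSpace.constant ‹_› h1 (x := x) (y := y)]

theorem exists_shift_of_lift {X : Type*} [TopologicalSpace X] [PreconnectedSpace X] [Nonempty X]
    {Θ : X → ℝ} (hΘ : Continuous Θ) {T : X → X} (hT : Continuous T)
    (h : ∀ x, Circle.exp (2 * Real.pi * Θ (T x)) = Circle.exp (2 * Real.pi * Θ x)) :
    ∃ k : ℤ, ∀ x, Θ (T x) = Θ x + k := by
  have h1 : ∀ x, ∃ k : ℤ, Θ (T x) - Θ x = k := fun x => by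
    obtain ⟨k, hk⟩ := circle_exp_eq_iff.1 (h x)
    exact ⟨k, by linarith⟩
  obtain ⟨x₀⟩ := ‹Nonempty X›
  obtain ⟨k, hk⟩ := h1 x₀
  refine ⟨k, fun x => ?_⟩
  have : Θ (T x) - Θ x = Θ (T x₀) - Θ x₀ :=
    eq_of_continuous_of_int (d := fun x => Θ (T x) - Θ x) (by fun_prop) h1 x x₀
  linarith

theorem HasDegree.unique {γ : ℝ → Circle} {m n : ℤ} (hm : HasDegree γ m) (hn : HasDegree γ n) :
    m = n := by
  obtain ⟨θ, hθ, h1, h2⟩ := hm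
  obtain ⟨θ', hθ', h1', h2'⟩ := hn
  have h := eq_of_continuous_of_int (d := fun t => θ t - θ' t) (by fun_prop) (fun t => by
    obtain ⟨k, hk⟩ := circle_exp_eq_iff.1 ((h1 t).symm.trans (h1' t))
    exact ⟨k, by linarith⟩) 0 1
  have e1 := h2 0
  have e2 := h2' 0
  simp only [zero_add] at e1 e2 h
  have : (m : ℝ) = n := by linarith
  exact_mod_cast this

/-- A lift of the homotopy gains one and the same integer in every period, at all times. Clamping
the time extends the map to the plane, where a lift exists. -/
theorem HasDegree.of_homotopy {F : ℝ × ℝ → Circle} (hF : ContinuousOn F (Icc (0 : ℝ) 1 ×ˢ univ))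
    (hp : ∀ s ∈ Icc (0 : ℝ) 1, ∀ t, F (s, t + 1) = F (s, t)) {n : ℤ}
    (h0 : HasDegree (fun t => F (0, t)) n) : HasDegree (fun t => F (1, t)) n := by
  set c : ℝ → ℝ := fun s => max 0 (min 1 s) with hc
  have hcI : ∀ s, c s ∈ Icc (0 : ℝ) 1 := fun s =>
    ⟨le_max_left _ _, max_le zero_le_one (min_le_left _ _)⟩
  have h1 : Continuous fun p : ℝ × ℝ => F (c p.1, p.2) := by
    refine hF.comp_continuous (by fun_prop) fun p => ⟨hcI _, mem_univ _⟩
  obtain ⟨Θ, hΘ, hΘF⟩ := exists_circle_lift h1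
  obtain ⟨k, hk⟩ := exists_shift_of_lift hΘ (T := fun p => (p.1, p.2 + 1)) (by fun_prop) fun p => by
    rw [← hΘF, ← hΘF]; exact hp _ (hcI _) _
  have hk0 : HasDegree (fun t => F (0, t)) k :=
    ⟨fun t => Θ (0, t), by fun_prop, fun t => by rw [← hΘF]; simp [hc], fun t => hk (0, t)⟩
  rw [h0.unique hk0]
  exact ⟨fun t => Θ (1, t), by fun_prop, fun t => by rw [← hΘF]; simp [hc], fun t => hk (1, t)⟩

theorem HasDegree.div {γ γ' : ℝ → Circle} {m n : ℤ} (h : HasDegree γ m) (h' : HasDegree γ' n) :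
    HasDegree (fun t => γ t / γ' t) (m - n) := by
  obtain ⟨θ, hθ, h1, h2⟩ := h
  obtain ⟨θ', hθ', h1', h2'⟩ := h'
  refine ⟨fun t => θ t - θ' t, by fun_prop, fun t => ?_, fun t => ?_⟩
  · beta_reduce; rw [h1, h1', mul_sub, Circle.exp_sub]
  · beta_reduce; rw [h2, h2']; push_cast; ring

theorem hasDegree_exp_mul (d : ℤ) : HasDegree (fun t => Circle.exp (2 * Real.pi * (d * t))) d :=
  ⟨fun t => d * t, by fun_prop, fun _ => rfl, fun t => by ring⟩

/-! ### Local inverses of embeddings in the 3-sphere -/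

theorem inner_fderiv_eq_zero {E : Type*} [NormedAddCommGroup E] [NormedSpace ℝ E] {φ : E → R4}
    {p : E} (hφ : DifferentiableAt ℝ φ p) (hS : ∀ᶠ q in 𝓝 p, φ q ∈ S3) (v : E) :
    inner ℝ (φ p) (fderiv ℝ φ p v) = 0 := by
  have h1 := hφ.hasFDerivAt.norm_sq
  have h2 : HasFDerivAt (‖φ ·‖ ^ 2) (0 : E →L[ℝ] ℝ) p := by
    refine (hasFDerivAt_const (1 : ℝ) p).congr_of_eventuallyEq ?_
    filter_upwards [hS] with q hq
    have : ‖φ q‖ = 1 := by simpa using hq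
    simp [this]
  have h3 := congrArg (fun T : E →L[ℝ] ℝ => T v) (h1.unique h2)
  simpa using h3

/-- The cone `(c, q) ↦ c • φ q` is a local diffeomorphism of `ℝ⁴`, because `φ p` is orthogonal to
the image of the derivative. On the sphere a comparison of norms forces `c = 1`, so its inverse
restricts to one of `φ`. -/
theorem exists_local_inverse {φ : ℝ × ℂ → R4} {p : ℝ × ℂ} (hφ : ContDiffAt ℝ ∞ φ p)
    (hS : ∀ᶠ q in 𝓝 p, φ q ∈ S3) (hi : Function.Injective (fderiv ℝ φ p)) :
    ∃ g : R4 → ℝ × ℂ, ContDiffAt ℝ ∞ g (φ p) ∧ (∀ᶠ q in 𝓝 p, g (φ q) = q) ∧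
      ∀ᶠ x in 𝓝[S3] φ p, φ (g x) = x := by
  have hp1 : ‖φ p‖ = 1 := by simpa using hS.self_of_nhds
  set B : ℝ × (ℝ × ℂ) → R4 := fun q => q.1 • φ q.2 with hB
  have hBs : ContDiffAt ℝ ∞ B (1, p) :=
    contDiffAt_fst.smul (ContDiffAt.comp (1, p) (g := φ) hφ contDiffAt_snd)
  have hBd : HasFDerivAt B _ (1, p) :=
    (hasFDerivAt_fst (𝕜 := ℝ) (p := ((1 : ℝ), p))).smul
      (HasFDerivAt.comp (g := φ) ((1 : ℝ), p) (hφ.differentiableAt (by simp)).hasFDerivAt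
        hasFDerivAt_snd)
  set B' := fderiv ℝ B (1, p) with hB'
  have hBv : ∀ v, B' v = fderiv ℝ φ p v.2 + v.1 • φ p := by
    intro v; rw [hB', hBd.fderiv]; simp
  have hinj : Function.Injective B' := by
    refine injective_of_forall_eq_zero fun v hv => ?_
    rw [hBv] at hv
    have h1 := congrArg (fun x => inner ℝ (φ p) x) hv
    simp only [inner_add_right, inner_fderiv_eq_zero (hφ.differentiableAt (by simp)) hS,
      inner_smul_right, real_inner_self_eq_norm_sq, hp1, inner_zero_right] at h1
    have h2 : v.1 = 0 := by linarith
    rw [h2, zero_smul, add_zero] at hv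
    exact Prod.ext h2 (hi (hv.trans (map_zero _).symm))
  have hrank : Module.finrank ℝ (ℝ × (ℝ × ℂ)) = Module.finrank ℝ R4 := by
    simp [Module.finrank_prod]
  set e : (ℝ × (ℝ × ℂ)) ≃L[ℝ] R4 :=
    (LinearEquiv.ofBijective (B' : (ℝ × (ℝ × ℂ)) →ₗ[ℝ] R4)
      ⟨hinj, (LinearMap.injective_iff_surjective_of_finrank_eq_finrank hrank).1 hinj⟩
      ).toContinuousLinearEquiv with he
  have heB : (e : (ℝ × (ℝ × ℂ)) →L[ℝ] R4) = B' := ContinuousLinearMap.ext fun _ => rfl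
  have hBe : HasFDerivAt B (e : (ℝ × (ℝ × ℂ)) →L[ℝ] R4) (1, p) := by
    rw [heB]; exact (hBs.differentiableAt (by simp)).hasFDerivAt
  have hn : (∞ : WithTop ℕ∞) ≠ 0 := by simp
  have hst := hBs.hasStrictFDerivAt' hBe hn
  set I := hst.localInverse B e (1, p) with hI
  have hBp : B (1, p) = φ p := by simp [hB]
  have hIs : ContDiffAt ℝ ∞ I (φ p) := by
    rw [← hBp]; exact hBs.to_localInverse hBe hn
  refine ⟨fun x => (I x).2, hIs.snd, ?_, ?_⟩
  · have h1 : Tendsto (fun q : ℝ × ℂ => ((1 : ℝ), q)) (𝓝 p) (𝓝 (1, p)) :=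
      Continuous.tendsto' (by fun_prop) _ _ rfl
    filter_upwards [h1.eventually hst.eventually_left_inverse] with q hq
    have : B (1, q) = φ q := by simp [hB]
    rw [← this, hI, hq]
  · have h1 := hst.eventually_right_inverse
    rw [hBp] at h1
    have h2 : Tendsto I (𝓝 (φ p)) (𝓝 (1, p)) := by
      have h3 := hIs.continuousAt.tendsto
      have h4 : I (φ p) = (1, p) := by rw [← hBp]; exact hst.localInverse_apply_image
      rwa [h4] at h3
    have h3 : ∀ᶠ x in 𝓝 (φ p), 0 < (I x).1 :=
      ((continuous_fst.tendsto _).comp h2).eventually (lt_mem_nhds one_pos)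
    have h5 : ∀ᶠ x in 𝓝 (φ p), φ (I x).2 ∈ S3 :=
      ((continuous_snd.tendsto _).comp h2).eventually hS
    filter_upwards [nhdsWithin_le_nhds h1, nhdsWithin_le_nhds h3, nhdsWithin_le_nhds h5,
      self_mem_nhdsWithin] with x hx hx1 hx2 hx3
    have e1 : ‖x‖ = 1 := by simpa using hx3
    have e2 : ‖φ (I x).2‖ = 1 := by simpa using hx2
    have e3 : (I x).1 • φ (I x).2 = x := hx
    have e4 : (I x).1 = 1 := by
      have := congrArg norm e3
      rw [norm_smul, e1, e2, mul_one, Real.norm_of_nonneg hx1.le] at this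
      exact this
    rwa [e4, one_smul] at e3

theorem EmbOn.exists_local_inverse {D : Set (ℝ × ℂ)} (hD : IsOpen D) {φ : ℝ × ℂ → R4}
    (h : EmbOn D φ) {p : ℝ × ℂ} (hp : p ∈ D) :
    ∃ g : R4 → ℝ × ℂ, ContDiffAt ℝ ∞ g (φ p) ∧ (∀ᶠ q in 𝓝 p, g (φ q) = q) ∧
      ∀ᶠ x in 𝓝[S3] φ p, φ (g x) = x :=
  _root_.exists_local_inverse (h.smooth p hp)
    (by filter_upwards [hD.mem_nhds hp] with q hq using h.mem_sphere q hq) (h.immersion p hp)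

/-! ### Maps from a knot complement to the circle -/

theorem EmbOn.notMem_core {R : ℝ} {β : ℝ × ℂ → R4} (hβ : EmbOn (disc R) β) {p : ℝ × ℂ}
    (hp : p ∈ disc R) (h0 : p.2 ≠ 0) : β p ∈ S3 \ range fun t : ℝ => β (t, 0) := by
  refine ⟨hβ.mem_sphere p hp, ?_⟩
  rintro ⟨t, ht⟩
  have hR : 0 < R := lt_of_le_of_lt (norm_nonneg _) hp
  obtain ⟨n, hn⟩ := hβ.injective _ (core_mem_disc hR t) _ hp ht
  exact h0 (by rw [hn]; simp)

theorem norm_mul_circle_exp (w : ℂ) :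
    ((‖w‖ : ℝ) : ℂ) * (Circle.exp (2 * Real.pi * (w.arg / (2 * Real.pi))) : ℂ) = w := by
  have h1 : 2 * Real.pi * (w.arg / (2 * Real.pi)) = w.arg := by
    have := Real.pi_pos; field_simp
  rw [h1, Circle.coe_exp]
  exact Complex.norm_mul_exp_arg_mul_I w

/-- A map from a knot complement to the circle that has degree zero on the meridian has degree zero
on every longitude. -/
theorem EmbOn.degree_longitude_eq_zero {R : ℝ} {β : ℝ × ℂ → R4} (hβ : EmbOn (disc R) β)
    {g : R4 → Circle} (hg : ContinuousOn g (S3 \ range fun t : ℝ => β (t, 0))) {d : ℤ} {δ : ℝ}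
    (hδ : δ ∈ Ioo 0 R)
    (hmer : HasDegree (fun θ => g (β (0, (δ : ℂ) * (Circle.exp (2 * Real.pi * θ) : ℂ)))) 0)
    (hlong : HasDegree (fun t => g (β (t, (δ : ℂ)))) d) : d = 0 := by
  have hδ0 := hδ.1
  have hδR := hδ.2
  have hR : 0 < R := hδ0.trans hδR
  -- The radii satisfy `r₁ < δ < r₃ < R`. Clamping the radius between `r₁` and `r₃` keeps away from
  -- the core and inside the tube, so `g` in polar coordinates becomes a map on all of `ℝ³` and
  -- lifts.
  set r₁ := δ / 2 with hr₁
  set r₃ := (δ + R) / 2 with hr₃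
  set c : ℝ → ℝ := fun ρ => max r₁ (min ρ r₃) with hc
  have hc1 : ∀ ρ, r₁ ≤ c ρ := fun ρ => le_max_left _ _
  have hc3 : ∀ ρ, c ρ < R := fun ρ => by
    refine lt_of_le_of_lt (max_le ?_ (min_le_right _ _)) (by linarith : r₃ < R); linarith
  have hr1 : 0 < r₁ := by positivity
  have hmem : ∀ (t ρ θ : ℝ), (t, ((c ρ : ℝ) : ℂ) * (Circle.exp (2 * Real.pi * θ) : ℂ)) ∈ disc R := by
    intro t ρ θ
    simp only [disc, mem_ofPred_eq, norm_mul, Circle.norm_coe, mul_one, Complex.norm_real,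
      Real.norm_eq_abs]
    rw [abs_of_pos (hr1.trans_le (hc1 ρ))]
    exact hc3 ρ
  have hcont : Continuous fun q : ℝ × ℝ × ℝ =>
      g (β (q.1, ((c q.2.1 : ℝ) : ℂ) * (Circle.exp (2 * Real.pi * q.2.2) : ℂ))) := by
    have hin : Continuous fun q : ℝ × ℝ × ℝ =>
      (q.1, ((c q.2.1 : ℝ) : ℂ) * (Circle.exp (2 * Real.pi * q.2.2) : ℂ)) := by fun_prop
    have hβc : ContinuousOn β (disc R) := fun p hp => (hβ.smooth p hp).continuousAt.continuousWithinAt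
    refine hg.comp_continuous (hβc.comp_continuous hin fun q => hmem _ _ _) fun q => ?_
    refine hβ.notMem_core (hmem _ _ _) ?_
    have := (hr1.trans_le (hc1 q.2.1)).ne'
    simp [this]
  obtain ⟨Θ, hΘ, hΘg⟩ := exists_circle_lift hcont
  have hcδ : c δ = δ := by
    simp only [hc]
    rw [min_eq_left (by linarith : δ ≤ r₃), max_eq_right (by linarith : r₁ ≤ δ)]
  obtain ⟨k, hk⟩ := exists_shift_of_lift hΘ (T := fun q => (q.1, q.2.1, q.2.2 + 1)) (by fun_prop)
    fun q => by
      rw [← hΘg, ← hΘg]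
      simp only [mul_add, mul_one, Circle.exp_add_two_pi]
  obtain ⟨k', hk'⟩ := exists_shift_of_lift hΘ (T := fun q => (q.1 + 1, q.2.1, q.2.2)) (by fun_prop)
    fun q => by
      rw [← hΘg, ← hΘg]
      simp only [hβ.periodic]
  have hk0 : k = 0 := by
    refine HasDegree.unique ⟨fun θ => Θ (0, δ, θ), by fun_prop, fun θ => ?_, fun θ => hk (0, δ, θ)⟩ hmer
    rw [← hΘg]; simp only [hcδ]
  have hkd : k' = d := by
    refine HasDegree.unique ⟨fun t => Θ (t, δ, 0), by fun_prop, fun t => ?_, fun t => hk' (t, δ, 0)⟩ hlong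
    rw [← hΘg]; simp [hcδ]
  subst hk0 hkd
  simp only [Int.cast_zero, add_zero] at hk
  have hkint : ∀ (n : ℤ) (t ρ θ : ℝ), Θ (t, ρ, θ + n) = Θ (t, ρ, θ) := by
    intro n t ρ θ
    have h1 : Function.Periodic (fun θ => Θ (t, ρ, θ)) 1 := fun θ => hk (t, ρ, θ)
    simpa using h1.int_mul n θ
  -- Meridional degree zero makes the lift independent of the branch of the argument, and
  -- subtracting the linear term makes it periodic. Thus `L` is a real function on the tube without
  -- its core.
  set L : ℝ × ℂ → ℝ := fun p => Θ (p.1, ‖p.2‖, p.2.arg / (2 * Real.pi)) - k' * p.1 with hL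
  have hLc : ∀ p : ℝ × ℂ, p.2 ≠ 0 → ContinuousAt L p := by
    intro p hp
    have h1 : ContinuousAt (fun q : ℝ × ℂ =>
        Θ (q.1, ‖q.2‖, (p.2.arg + (q.2 / p.2).arg) / (2 * Real.pi)) - k' * q.1) p := by
      have h2 : ContinuousAt (fun q : ℝ × ℂ => (q.2 / p.2).arg) p := by
        refine ContinuousAt.comp (g := Complex.arg) (f := fun q : ℝ × ℂ => q.2 / p.2) ?_ (by fun_prop)
        refine Complex.continuousAt_arg ?_
        rw [div_self hp]; exact Complex.one_mem_slitPlane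
      have h3 : ContinuousAt (fun q : ℝ × ℂ =>
          (q.1, ‖q.2‖, (p.2.arg + (q.2 / p.2).arg) / (2 * Real.pi))) p := by fun_prop
      exact (ContinuousAt.comp (g := Θ) hΘ.continuousAt h3).sub (by fun_prop)
    refine h1.congr ?_
    have h4 : ∀ᶠ q : ℝ × ℂ in 𝓝 p, q.2 ≠ 0 :=
      continuousAt_snd.eventually_ne hp
    filter_upwards [h4] with q hq
    have h5 := Complex.arg_mul_coe_angle hp (div_ne_zero hq hp)
    rw [mul_div_cancel₀ _ hp, ← Real.Angle.coe_add] at h5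
    obtain ⟨n, hn⟩ := Real.Angle.angle_eq_iff_two_pi_dvd_sub.1 h5
    have h6 : q.2.arg / (2 * Real.pi) = (p.2.arg + (q.2 / p.2).arg) / (2 * Real.pi) + n := by
      have := Real.pi_pos
      field_simp
      linarith
    simp only [hL]
    rw [h6, hkint]
  have hLp : ∀ t w, L (t + 1, w) = L (t, w) := by
    intro t w
    simp only [hL]
    have := hk' (t, ‖w‖, w.arg / (2 * Real.pi))
    simp only at this
    rw [this]; ring
  -- The cut-off is `0` up to radius `r₁` and `1` from radius `δ = 2 * r₁` on. So `Γ` passes from a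
  -- function of `t` alone, which makes sense on the core, to `g ∘ β`.
  set l : ℝ → ℝ := fun ρ => max 0 (min 1 ((ρ - r₁) / r₁)) with hl
  set Γ : ℝ × ℂ → Circle := fun p => Circle.exp (2 * Real.pi * (k' * p.1 + l ‖p.2‖ * L p)) with hΓ
  have hΓ0 : ∀ p : ℝ × ℂ, ‖p.2‖ ≤ r₁ → Γ p = Circle.exp (2 * Real.pi * (k' * p.1)) := by
    intro p hp
    have : l ‖p.2‖ = 0 := by
      simp only [hl]
      refine max_eq_left ((min_le_right _ _).trans ?_)
      exact div_nonpos_of_nonpos_of_nonneg (by linarith) hr1.le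
    simp [hΓ, this]
  have hΓc : ∀ p, ContinuousAt Γ p := by
    intro p
    by_cases hp : p.2 = 0
    · have h1 : ContinuousAt (fun p : ℝ × ℂ => Circle.exp (2 * Real.pi * (k' * p.1))) p := by fun_prop
      refine h1.congr ?_
      have h2 : ∀ᶠ q : ℝ × ℂ in 𝓝 p, ‖q.2‖ < r₁ :=
        (by fun_prop : Continuous fun q : ℝ × ℂ => ‖q.2‖).continuousAt.eventually_lt
          continuousAt_const (by simpa [hp] using hr1)
      filter_upwards [h2] with q hq
      exact (hΓ0 q hq.le).symm
    · have h1 := hLc p hp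
      have h2 : ContinuousAt (fun q : ℝ × ℂ => l ‖q.2‖) p := by
        have : Continuous fun q : ℝ × ℂ => l ‖q.2‖ := by simp only [hl]; fun_prop
        exact this.continuousAt
      have h3 : ContinuousAt (fun p : ℝ × ℂ => 2 * Real.pi * (k' * p.1 + l ‖p.2‖ * L p)) p := by
        fun_prop
      exact Circle.exp.continuous.continuousAt.comp h3
  have hΓp : ∀ t w, Γ (t + 1, w) = Γ (t, w) := by
    intro t w
    simp only [hΓ, hLp]
    exact circle_exp_eq_iff.2 ⟨k', by ring⟩
  have hΓg : ∀ p : ℝ × ℂ, δ ≤ ‖p.2‖ → ‖p.2‖ ≤ r₃ → Γ p = g (β p) := by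
    intro p hp1 hp3
    have h1 : l ‖p.2‖ = 1 := by
      simp only [hl]
      rw [min_eq_left, max_eq_right zero_le_one]
      rw [le_div_iff₀ hr1]; linarith
    have h2 : c ‖p.2‖ = ‖p.2‖ := by
      simp only [hc]; rw [min_eq_left hp3, max_eq_right (by linarith)]
    have h3 := hΘg (p.1, ‖p.2‖, p.2.arg / (2 * Real.pi))
    simp only [h2, norm_mul_circle_exp] at h3
    simp only [hΓ, h1, hL]
    rw [show β p = β (p.1, p.2) from rfl, h3]
    congr 1; ring
  have hβd : EmbOn (disc r₃) β := hβ.mono (disc_mono (by linarith))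
  classical
  set G : R4 → Circle := fun x => if h : ∃ p ∈ disc r₃, β p = x then Γ h.choose else g x with hG
  have hGβ : ∀ p ∈ disc r₃, G (β p) = Γ p := by
    intro p hp
    have h : ∃ q ∈ disc r₃, β q = β p := ⟨p, hp, rfl⟩
    simp only [hG]
    rw [dif_pos h]
    obtain ⟨n, hn⟩ := hβd.injective _ hp _ h.choose_spec.1 h.choose_spec.2.symm
    rw [hn]
    exact periodic_int hΓp n p
  set K : Set R4 := β '' (Icc (0 : ℝ) 1 ×ˢ Metric.closedBall (0 : ℂ) δ) with hK
  have hKc : IsClosed K := by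
    refine IsCompact.isClosed (IsCompact.image_of_continuousOn
      (isCompact_Icc.prod (isCompact_closedBall _ _)) fun p hp => ?_)
    refine (hβ.smooth p ?_).continuousAt.continuousWithinAt
    have : ‖p.2‖ ≤ δ := by simpa using hp.2
    exact lt_of_le_of_lt this hδR
  have hKm : ∀ p : ℝ × ℂ, ‖p.2‖ ≤ δ → β p ∈ K := by
    intro p hp
    refine ⟨(Int.fract p.1, p.2), ⟨⟨Int.fract_nonneg _, (Int.fract_lt_one _).le⟩, by simpa using hp⟩, ?_⟩
    rw [← periodic_int hβ.periodic ⌊p.1⌋]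
    congr 1; ext <;> simp
  have hGg : ∀ x, x ∉ K → G x = g x := by
    intro x hx
    by_cases h : ∃ p ∈ disc r₃, β p = x
    · obtain ⟨p, hp, rfl⟩ := h
      rw [hGβ p hp]
      refine hΓg p ?_ (le_of_lt hp)
      by_contra hlt
      exact hx (hKm p (not_le.1 hlt).le)
    · simp only [hG]; rw [dif_neg h]
  have hGc : ContinuousOn G S3 := by
    intro x hx
    by_cases h : ∃ p ∈ disc r₃, β p = x
    · obtain ⟨p, hp, rfl⟩ := h
      obtain ⟨f, hf1, hf2, hf3⟩ := hβd.exists_local_inverse (isOpen_disc _) hp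
      have hfp : f (β p) = p := hf2.self_of_nhds
      have h1 : ContinuousAt (fun x => Γ (f x)) (β p) := by
        refine ContinuousAt.comp (g := Γ) ?_ hf1.continuousAt
        exact hΓc _
      refine h1.continuousWithinAt.congr_of_eventuallyEq ?_ (by rw [hGβ p hp, hfp])
      have h2 : ∀ᶠ x in 𝓝[S3] β p, f x ∈ disc r₃ := by
        refine nhdsWithin_le_nhds (hf1.continuousAt.eventually ?_)
        rw [hfp]; exact (isOpen_disc _).mem_nhds hp
      filter_upwards [hf3, h2] with y hy hy2
      rw [← hGβ _ hy2, hy]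
    · have hxK : x ∉ K := by
        rintro ⟨p, hp, rfl⟩
        refine h ⟨p, ?_, rfl⟩
        have : ‖p.2‖ ≤ δ := by simpa using hp.2
        exact lt_of_le_of_lt this (by linarith)
      have hxc : x ∈ S3 \ range fun t : ℝ => β (t, 0) := by
        refine ⟨hx, ?_⟩
        rintro ⟨t, rfl⟩
        exact hxK (hKm _ (by simpa using hδ0.le))
      have h1 : ContinuousWithinAt G (S3 \ range fun t : ℝ => β (t, 0)) x := by
        refine (hg x hxc).congr_of_eventuallyEq ?_ (hGg x hxK)
        filter_upwards [nhdsWithin_le_nhds (hKc.isOpen_compl.mem_nhds hxK)] with y hy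
        exact hGg y hy
      refine h1.mono_of_mem_nhdsWithin ?_
      filter_upwards [nhdsWithin_le_nhds (hKc.isOpen_compl.mem_nhds hxK), self_mem_nhdsWithin] with y hy hyS
      refine ⟨hyS, ?_⟩
      rintro ⟨t, rfl⟩
      exact hy (hKm _ (by simpa using hδ0.le))
  -- The modified map `G` is continuous on the whole sphere. Off the point `β (0, 0)`, that is on a
  -- copy of `ℝ³`, it lifts to the line and has degree zero on every loop; the longitude of radius
  -- `r₁` avoids this point and has degree `k'`.
  have hv : ‖β (0, 0)‖ = 1 := by
    simpa using hβ.mem_sphere _ (core_mem_disc hR 0)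
  set st := stereographic hv with hst
  have hr1R : ∀ t : ℝ, (t, ((r₁ : ℝ) : ℂ)) ∈ disc R := fun t => by
    simp only [disc, mem_ofPred_eq, Complex.norm_real, Real.norm_eq_abs, abs_of_pos hr1]; linarith
  set γ : ℝ → Metric.sphere (0 : R4) 1 := fun t => ⟨β (t, (r₁ : ℂ)), hβ.mem_sphere _ (hr1R t)⟩ with hγ
  have hγc : Continuous γ := by
    refine Continuous.subtype_mk ?_ _
    rw [continuous_iff_continuousAt]
    intro t
    exact ContinuousAt.comp (g := β) (f := fun t : ℝ => (t, (r₁ : ℂ)))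
      (hβ.smooth _ (hr1R t)).continuousAt (by fun_prop)
  have hγs : ∀ t, γ t ∈ st.source := by
    intro t
    rw [hst, stereographic_source]
    intro h
    have h1 : β (t, (r₁ : ℂ)) = β (0, 0) := congrArg Subtype.val h
    refine (hβ.notMem_core (hr1R t) ?_).2 ⟨0, h1.symm⟩
    simpa using hr1.ne'
  have hΦ : Continuous fun y => G (st.symm y : R4) := by
    have h1 : Continuous st.symm := by
      rw [← continuousOn_univ]
      have := st.continuousOn_symm
      rwa [hst, stereographic_target] at this
    exact hGc.comp_continuous (continuous_subtype_val.comp h1) fun y => (st.symm y).2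
  obtain ⟨Λ, hΛ, hΛG⟩ := exists_circle_lift hΦ
  have hstγ : Continuous fun t => st (γ t) :=
    st.continuousOn.comp_continuous hγc hγs
  refine (hasDegree_exp_mul k').unique ⟨fun t => Λ (st (γ t)), hΛ.comp hstγ, fun t => ?_, fun t => ?_⟩
  · rw [← hΛG, st.left_inv (hγs t)]
    have hp : ((t, (r₁ : ℂ)) : ℝ × ℂ) ∈ disc r₃ := by
      simp only [disc, mem_ofPred_eq, Complex.norm_real, Real.norm_eq_abs, abs_of_pos hr1]; linarith
    simp only [hγ]
    rw [hGβ _ hp, hΓ0]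
    simp [abs_of_pos hr1]
  · have : γ (t + 1) = γ t := Subtype.ext (hβ.periodic _ _)
    beta_reduce; rw [this]; simp

/-! ### Framings and the uniqueness of tubular neighbourhoods -/

/-- Positivity of this determinant says that `φ` preserves the orientation at `p`. -/
noncomputable def orientation (φ : ℝ × ℂ → R4) (p : ℝ × ℂ) : ℝ :=
  Matrix.det (Matrix.of fun i j : Fin 4 =>
    (![φ p, fderiv ℝ φ p (1, 0), fderiv ℝ φ p (0, 1), fderiv ℝ φ p (0, Complex.I)] i) j)

/-- The framing of the germ of a tube of radius `R`. -/
def GermFraming (R : ℝ) (φ : ℝ × ℂ → R4) (n : ℤ) : Prop :=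
  ∃ f : R4 → Circle, ContinuousOn f (S3 \ range fun t : ℝ => φ (t, 0)) ∧ ∀ δ ∈ Ioo 0 R,
    HasDegree (fun θ => f (φ (0, (δ : ℂ) * (Circle.exp (2 * Real.pi * θ) : ℂ)))) 1 ∧
    HasDegree (fun t => f (φ (t, (δ : ℂ)))) n

/-- Twisting of the solid torus by the angle function `τ`. -/
noncomputable def twist (τ : ℝ → ℝ) (p : ℝ × ℂ) : ℝ × ℂ :=
  (p.1, (Circle.exp (2 * Real.pi * τ p.1) : ℂ) * p.2)

theorem clm_prod_complex_apply {F : Type*} [NormedAddCommGroup F] [NormedSpace ℝ F]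
    (A : ℝ × ℂ →L[ℝ] F) (x : ℝ) (w : ℂ) :
    A (x, w) = x • A (1, 0) + w.re • A (0, 1) + w.im • A (0, Complex.I) := by
  have h : ((x, w) : ℝ × ℂ) = x • ((1 : ℝ), (0 : ℂ)) + w.re • ((0 : ℝ), (1 : ℂ))
      + w.im • ((0 : ℝ), Complex.I) := by
    refine Prod.ext (by simp) ?_
    simp [Complex.re_add_im]
  rw [h, map_add, map_add, map_smul, map_smul, map_smul]

/-- This is `α⁻¹ ∘ β`, lifted to the universal cover. Two lifts differ by an integer, so at most one
is within `1 / 4` of `(t, 0)`. Uniqueness gives equivariance, and smoothness by comparison with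
local inverses of `α`. -/
theorem EmbOn.exists_transition {R : ℝ} (hR : 0 < R) {α β : ℝ × ℂ → R4} (hα : EmbOn (disc R) α)
    (hβ : EmbOn (disc R) β) (hcore : ∀ t, α (t, 0) = β (t, 0)) :
    ∃ ζ : ℝ × ℂ → ℝ × ℂ, ∃ r > 0, (∀ p ∈ disc r, ContDiffAt ℝ ∞ ζ p ∧ α (ζ p) = β p) ∧
      (∀ t w, ζ (t + 1, w) = ζ (t, w) + (1, 0)) ∧ ∀ t, ζ (t, 0) = (t, 0) := by
  set ε := min (1 / 4) R with hε
  have hε0 : 0 < ε := lt_min (by norm_num) hR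
  have hεR : ∀ q : ℝ × ℂ, ∀ t : ℝ, dist q (t, 0) < ε → q ∈ disc R ∧ |q.1 - t| < 1 / 4 := by
    intro q t h
    rw [Prod.dist_eq, max_lt_iff, dist_zero_right, Real.dist_eq] at h
    exact ⟨h.2.trans_le (min_le_right _ _), h.1.trans_le (min_le_left _ _)⟩
  have huniq : ∀ t : ℝ, ∀ q q' : ℝ × ℂ, dist q (t, 0) < ε → dist q' (t, 0) < ε → α q = α q' →
      q = q' := by
    intro t q q' hq hq' h
    obtain ⟨h1, h2⟩ := hεR q t hq
    obtain ⟨h1', h2'⟩ := hεR q' t hq'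
    obtain ⟨n, rfl⟩ := hα.injective q h1 q' h1' h
    simp only [Prod.fst_add] at h2'
    rw [abs_lt] at h2 h2'
    have h3 : (n : ℝ) < 1 := by linarith
    have h4 : (-1 : ℝ) < n := by linarith
    have h5 : n < 1 := by exact_mod_cast h3
    have h6 : -1 < n := by exact_mod_cast h4
    have h7 : n = 0 := by omega
    subst h7; ext <;> simp
  have hlocal : ∀ p ∈ disc R, ∀ q ∈ disc R, α q = β p → dist q (p.1, 0) < ε →
      ∃ g : R4 → ℝ × ℂ, ContDiffAt ℝ ∞ g (β p) ∧
        ∀ᶠ p' in 𝓝 p, dist (g (β p')) (p'.1, 0) < ε ∧ α (g (β p')) = β p' := by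
    intro p hp q hq hqp hd
    obtain ⟨g, hg1, hg2, hg3⟩ := hα.exists_local_inverse (isOpen_disc R) hq
    have hgq := hg2.self_of_nhds
    rw [hqp] at hg1 hg3 hgq
    have hβc : ContinuousAt β p := (hβ.smooth p hp).continuousAt
    have hc : ContinuousAt (fun p' => g (β p')) p := ContinuousAt.comp (g := g) hg1.continuousAt hβc
    refine ⟨g, hg1, ?_⟩
    have h1 : ContinuousAt (fun p' : ℝ × ℂ => dist (g (β p')) (p'.1, (0 : ℂ))) p :=
      hc.dist (continuous_fst.prodMk continuous_const).continuousAt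
    have h2 : Tendsto β (𝓝 p) (𝓝[S3] (β p)) := by
      refine tendsto_nhdsWithin_iff.2 ⟨hβc, ?_⟩
      filter_upwards [(isOpen_disc R).mem_nhds hp] with p' hp' using hβ.mem_sphere p' hp'
    exact (h1.eventually_lt continuousAt_const (by rw [hgq]; exact hd)).and (h2.eventually hg3)
  obtain ⟨r, hr, hex⟩ := eventually_core_uniform (a := 0) (b := 0)
    (p := fun x => ∃ q : ℝ × ℂ, dist q (x.1.1, 0) < ε ∧ α q = β x.1)
    (by
      intro t w s
      constructor
      · rintro ⟨q, hq, hq'⟩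
        refine ⟨q + (((-1 : ℤ) : ℝ), 0), ?_, ?_⟩
        · rw [Prod.dist_eq, Real.dist_eq] at hq ⊢
          convert hq using 3 <;> (simp; try ring)
        · rw [periodic_int hα.periodic, hq', hβ.periodic]
      · rintro ⟨q, hq, hq'⟩
        refine ⟨q + (((1 : ℤ) : ℝ), 0), ?_, ?_⟩
        · rw [Prod.dist_eq, Real.dist_eq] at hq ⊢
          convert hq using 3 <;> simp
        · rw [periodic_int hα.periodic, hq', hβ.periodic])
    (by
      intro t s _
      obtain ⟨g, -, hg⟩ := hlocal _ (core_mem_disc hR t) _ (core_mem_disc hR t) (hcore t)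
        (by simpa using hε0)
      have h1 : Tendsto (fun x : (ℝ × ℂ) × ℝ => x.1) (𝓝 ((t, 0), s)) (𝓝 (t, 0)) :=
        continuous_fst.tendsto' _ _ rfl
      filter_upwards [h1.eventually hg] with x hx
      exact ⟨_, hx⟩)
  have hex' : ∀ p ∈ disc r, ∃ q : ℝ × ℂ, dist q (p.1, 0) < ε ∧ α q = β p := fun p hp =>
    hex p hp 0 ⟨le_rfl, le_rfl⟩
  classical
  set ζ : ℝ × ℂ → ℝ × ℂ := fun p =>
    if h : ∃ q : ℝ × ℂ, dist q (p.1, 0) < ε ∧ α q = β p then h.choose else (p.1, 0) with hζ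
  have hζ1 : ∀ p q, dist q (p.1, 0) < ε → α q = β p → ζ p = q := by
    intro p q h1 h2
    have h : ∃ q : ℝ × ℂ, dist q (p.1, 0) < ε ∧ α q = β p := ⟨q, h1, h2⟩
    simp only [hζ]
    rw [dif_pos h]
    exact huniq p.1 _ _ h.choose_spec.1 h1 (h.choose_spec.2.trans h2.symm)
  refine ⟨ζ, min r R, lt_min hr hR, fun p hp => ?_, fun t w => ?_, fun t => ?_⟩
  · have hpR : p ∈ disc R := disc_mono (min_le_right _ _) hp
    obtain ⟨q, hq1, hq2⟩ := hex' p (disc_mono (min_le_left _ _) hp)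
    obtain ⟨g, hg1, hg2⟩ := hlocal p hpR q (hεR q _ hq1).1 hq2 hq1
    refine ⟨?_, by rw [hζ1 p q hq1 hq2, hq2]⟩
    refine (ContDiffAt.comp p (g := g) hg1 (hβ.smooth p hpR)).congr_of_eventuallyEq ?_
    filter_upwards [hg2] with p' hp'
    exact hζ1 p' _ hp'.1 hp'.2
  · by_cases h : ∃ q : ℝ × ℂ, dist q (t, 0) < ε ∧ α q = β (t, w)
    · obtain ⟨q, hq1, hq2⟩ := h
      rw [hζ1 (t, w) q hq1 hq2]
      refine hζ1 _ _ ?_ ?_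
      · rw [Prod.dist_eq, Real.dist_eq] at hq1 ⊢
        convert hq1 using 3 <;> simp
      · have := periodic_int hα.periodic 1 q
        rw [Int.cast_one] at this
        rw [this, hβ.periodic, hq2]
    · have h' : ¬ ∃ q : ℝ × ℂ, dist q (t + 1, 0) < ε ∧ α q = β (t + 1, w) := by
        rintro ⟨q, hq1, hq2⟩
        refine h ⟨q + (((-1 : ℤ) : ℝ), 0), ?_, ?_⟩
        · rw [Prod.dist_eq, Real.dist_eq] at hq1 ⊢
          convert hq1 using 3 <;> (simp; try ring)
        · rw [periodic_int hα.periodic, hq2, hβ.periodic]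
      simp only [hζ]
      rw [dif_neg h, dif_neg h']
      simp
  · exact hζ1 _ _ (by simpa using hε0) (hcore t)

theorem det_combination (v₀ v₁ v₂ v₃ : R4) (c p q c' p' q' : ℝ) :
    Matrix.det (Matrix.of fun i j : Fin 4 =>
      (![v₀, v₁, c • v₁ + p • v₂ + q • v₃, c' • v₁ + p' • v₂ + q' • v₃] i) j) =
    (p * q' - q * p') * Matrix.det (Matrix.of fun i j : Fin 4 => (![v₀, v₁, v₂, v₃] i) j) := by
  simp [Matrix.det_succ_row_zero, Fin.sum_univ_succ, Fin.succAbove]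
  ring

/-- Integrate the logarithmic derivative, starting from a logarithm of `a 0`. The integer `k` is the
winding number of the loop `a`. -/
theorem exists_complex_log_lift {a : ℝ → ℂ} (ha : ContDiff ℝ ∞ a) (h0 : ∀ t, a t ≠ 0)
    (hp : ∀ t, a (t + 1) = a t) : ∃ l : ℝ → ℂ, ContDiff ℝ ∞ l ∧ (∀ t, Complex.exp (l t) = a t) ∧
      ∃ k : ℤ, ∀ t, l (t + 1) = l t + 2 * Real.pi * k * Complex.I := by
  set d : ℝ → ℂ := fun t => deriv a t / a t with hd
  have hds : ContDiff ℝ ∞ d := by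
    simp only [hd, div_eq_mul_inv]
    exact (contDiff_infty_iff_deriv.1 ha).2.mul (ha.inv h0)
  set l : ℝ → ℂ := fun t => Complex.log (a 0) + ∫ x in (0 : ℝ)..t, d x with hl
  have hld : ∀ t, HasDerivAt l (d t) t := fun t =>
    (hds.continuous.integral_hasStrictDerivAt 0 t).hasDerivAt.const_add _
  have hls : ContDiff ℝ ∞ l := by
    rw [contDiff_infty_iff_deriv]
    refine ⟨fun t => (hld t).differentiableAt, ?_⟩
    rwa [show deriv l = d from funext fun t => (hld t).deriv]
  have hexp : ∀ t, Complex.exp (l t) = a t := by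
    have h1 : ∀ t, HasDerivAt (fun t => Complex.exp (l t) / a t) 0 t := by
      intro t
      have h2 := ((hld t).cexp).div (ha.differentiable (by simp) t).hasDerivAt (h0 t)
      refine h2.congr_deriv ?_
      have h3 : d t * a t = deriv a t := div_mul_cancel₀ _ (h0 t)
      rw [← h3]
      ring
    intro t
    have h3 := is_const_of_deriv_eq_zero (fun t => (h1 t).differentiableAt) (fun t => (h1 t).deriv) t 0
    have h4 : l 0 = Complex.log (a 0) := by simp [hl]
    rw [h4, Complex.exp_log (h0 0), div_self (h0 0), div_eq_one_iff_eq (h0 t)] at h3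
    exact h3
  refine ⟨l, hls, hexp, ?_⟩
  have h1 : ∀ t, HasDerivAt (fun t => l (t + 1) - l t) 0 t := by
    intro t
    have h2 := ((hld (t + 1)).comp_add_const t 1).sub (hld t)
    have h3 : d (t + 1) = d t := by
      simp only [hd, hp]
      have : deriv a (t + 1) = deriv a t := by
        rw [← deriv_comp_add_const]
        congr 1; funext x; exact hp x
      rw [this]
    rwa [h3, sub_self] at h2
  have h2 : Complex.exp (l 1) = Complex.exp (l 0) := by
    rw [hexp, hexp]; simpa using hp 0
  obtain ⟨k, hk⟩ := Complex.exp_eq_exp_iff_exists_int.1 h2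
  refine ⟨k, fun t => ?_⟩
  have h3 := is_const_of_deriv_eq_zero (fun t => (h1 t).differentiableAt) (fun t => (h1 t).deriv) t 0
  simp only [zero_add] at h3
  rw [hk] at h3
  linear_combination h3

/-- Degrees along loops in a family of tubes with a common core. -/
theorem EmbOn.exists_degree_family {R : ℝ} {α : ℝ × ℂ → R4} (hα : EmbOn (disc R) α)
    (hR : 0 < R) {F : (ℝ × ℂ) × ℝ → ℝ × ℂ} (hF : TorusFamily F)
    (hcore : ∀ t, ∀ s ∈ Icc (0 : ℝ) 1, F ((t, 0), s) = (t, 0)) :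
    ∃ δ₀ : ℝ, 0 < δ₀ ∧ ∀ δ ∈ Ioo 0 δ₀, ∀ f : R4 → Circle,
      ContinuousOn f (S3 \ range fun t : ℝ => α (t, 0)) → ∀ n : ℤ,
      (HasDegree (fun t => f (α (F ((t, (δ : ℂ)), 0)))) n →
        HasDegree (fun t => f (α (F ((t, (δ : ℂ)), 1)))) n) ∧
      (HasDegree (fun θ => f (α (F ((0, (δ : ℂ) * (Circle.exp (2 * Real.pi * θ) : ℂ)), 0)))) n →
        HasDegree (fun θ => f (α (F ((0, (δ : ℂ) * (Circle.exp (2 * Real.pi * θ) : ℂ)), 1)))) n) := by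
  obtain ⟨h1, h2, h3, h4⟩ := hα.isotopy_family hF
    (fun t s hs => by rw [hcore t s hs]; simpa using hR)
  obtain ⟨δ₁, hδ₁, hA, hB⟩ := exists_embedded_neighbourhood
    (Φ := fun q : (ℝ × ℂ) × ℝ => (α (F q), q.2)) (a := 0) (b := 1)
    (fun t w s => by simp only [h1])
    (fun t s hs => by
      filter_upwards [h2 t s hs] with q hq
      exact hq.1.prodMk contDiffAt_snd)
    (fun t t' s hs s' hs' h => by
      simp only [Prod.mk.injEq] at h
      obtain ⟨h5, rfl⟩ := h
      exact ⟨rfl, h3 s hs t t' h5⟩)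
    (fun t s hs => injective_fderiv_level ((h2 t s hs).self_of_nhds.1.differentiableAt (by simp))
      (h4 t s hs))
  obtain ⟨δ₂, hδ₂, hC⟩ := eventually_core_uniform (p := fun q => α (F q) ∈ S3) (a := 0) (b := 1)
    (fun t w s => by simp only [h1]) (fun t s hs => (h2 t s hs).mono fun q hq => hq.2)
  refine ⟨min δ₁ δ₂, lt_min hδ₁ hδ₂, fun δ hδ f hf n => ?_⟩
  have hm1 : ∀ w : ℂ, ‖w‖ = δ → ∀ t : ℝ, (t, w) ∈ disc δ₁ := fun w hw t =>
    show ‖w‖ < δ₁ from hw ▸ hδ.2.trans_le (min_le_left _ _)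
  have hm2 : ∀ w : ℂ, ‖w‖ = δ → ∀ t : ℝ, (t, w) ∈ disc δ₂ := fun w hw t =>
    show ‖w‖ < δ₂ from hw ▸ hδ.2.trans_le (min_le_right _ _)
  have key : ∀ c : ℝ → ℝ × ℂ, Continuous c → (∀ t, ‖(c t).2‖ = δ) →
      (∀ t s, α (F (c (t + 1), s)) = α (F (c t, s))) →
      HasDegree (fun t => f (α (F (c t, 0)))) n → HasDegree (fun t => f (α (F (c t, 1)))) n := by
    intro c hc hcδ hcp h
    refine HasDegree.of_homotopy (F := fun q => f (α (F (c q.2, q.1)))) ?_ ?_ h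
    · have hin : ContinuousOn (fun q : ℝ × ℝ => α (F (c q.2, q.1))) (Icc (0 : ℝ) 1 ×ˢ univ) := by
        intro q hq
        have h5 := (hA (c q.2) (hm1 _ (hcδ _) _) q.1 hq.1).1.continuousAt.fst
        refine ContinuousAt.continuousWithinAt ?_
        exact ContinuousAt.comp (g := fun q => α (F q)) (f := fun q : ℝ × ℝ => (c q.2, q.1)) h5
          (by fun_prop)
      -- The family fixes the core and embeds a neighbourhood of it, so a loop at distance `δ > 0`
      -- never meets the core.
      refine hf.comp hin fun q hq => ⟨hC _ (hm2 _ (hcδ _) _) _ hq.1, ?_⟩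
      rintro ⟨t, ht⟩
      simp only at ht
      have h6 : α (F ((t, 0), q.1)) = α (F (c q.2, q.1)) := by rw [hcore t q.1 hq.1, ht]
      obtain ⟨-, m, hm⟩ := hB (t, 0) (core_mem_disc hδ₁ t) q.1 hq.1 (c q.2) (hm1 _ (hcδ _) _) q.1 hq.1
        (Prod.ext h6 rfl)
      have h7 := hcδ q.2
      rw [hm] at h7
      simp at h7
      exact hδ.1.ne h7
    · intro s _ t
      simp only [hcp]
  refine ⟨fun h => ?_, fun h => ?_⟩
  · refine key (fun t => (t, (δ : ℂ))) (by fun_prop) (fun t => by simp [abs_of_pos hδ.1]) ?_ h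
    intro t s; exact h1 _ _ _
  · refine key (fun θ => (0, (δ : ℂ) * (Circle.exp (2 * Real.pi * θ) : ℂ))) (by fun_prop)
      (fun t => by
        rw [norm_mul, Circle.norm_coe, mul_one, Complex.norm_real, Real.norm_of_nonneg hδ.1.le]) ?_ h
    intro θ s
    simp only [mul_add, mul_one, Circle.exp_add_two_pi]

/-- Degrees along loops on a torus around the core. -/
theorem EmbOn.exists_degrees_on_torus {R : ℝ} {α : ℝ × ℂ → R4} (hα : EmbOn (disc R) α)
    {f : R4 → Circle} (hf : ContinuousOn f (S3 \ range fun t : ℝ => α (t, 0))) {δ : ℝ}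
    (hδ : δ ∈ Ioo 0 R) : ∃ x y : ℤ,
      HasDegree (fun θ => f (α (0, (δ : ℂ) * (Circle.exp (2 * Real.pi * θ) : ℂ)))) y ∧
      HasDegree (fun t => f (α (t, (δ : ℂ)))) x ∧
      ∀ (τ : ℝ → ℝ) (k : ℤ), Continuous τ → (∀ t, τ (t + 1) = τ t + k) →
        HasDegree (fun t => f (α (twist τ (t, (δ : ℂ))))) (x + k * y) ∧
        HasDegree (fun θ => f (α (twist τ (0, (δ : ℂ) * (Circle.exp (2 * Real.pi * θ) : ℂ))))) y := by
  have hmem : ∀ (t θ : ℝ), (t, (δ : ℂ) * (Circle.exp (2 * Real.pi * θ) : ℂ)) ∈ disc R := by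
    intro t θ
    simp only [disc, mem_ofPred_eq, norm_mul, Circle.norm_coe, mul_one, Complex.norm_real,
      Real.norm_eq_abs]
    rw [abs_of_pos hδ.1]
    exact hδ.2
  have hcont : Continuous fun q : ℝ × ℝ =>
      f (α (q.1, (δ : ℂ) * (Circle.exp (2 * Real.pi * q.2) : ℂ))) := by
    have hin : Continuous fun q : ℝ × ℝ =>
      (q.1, (δ : ℂ) * (Circle.exp (2 * Real.pi * q.2) : ℂ)) := by fun_prop
    have hβc : ContinuousOn α (disc R) := fun p hp => (hα.smooth p hp).continuousAt.continuousWithinAt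
    refine hf.comp_continuous (hβc.comp_continuous hin fun q => hmem _ _) fun q => ?_
    refine hα.notMem_core (hmem _ _) ?_
    simp [hδ.1.ne']
  obtain ⟨Θ, hΘ, hΘg⟩ := exists_circle_lift hcont
  obtain ⟨y, hy⟩ := exists_shift_of_lift hΘ (T := fun q => (q.1, q.2 + 1)) (by fun_prop)
    fun q => by
      rw [← hΘg, ← hΘg]
      simp only [mul_add, mul_one, Circle.exp_add_two_pi]
  obtain ⟨x, hx⟩ := exists_shift_of_lift hΘ (T := fun q => (q.1 + 1, q.2)) (by fun_prop)
    fun q => by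
      rw [← hΘg, ← hΘg]
      simp only [hα.periodic]
  -- The lift gains `x` along the longitude and `y` along the meridian. A longitude twisted `k`
  -- times is the path `t ↦ (t, τ t)`, which gains `x + k * y`.
  have hyint : ∀ (k : ℤ) (t θ : ℝ), Θ (t, θ + k) = Θ (t, θ) + k * y := by
    intro k t θ
    have h1 : Function.Periodic (fun θ => Θ (t, θ) - θ * y) 1 := fun θ => by
      have := hy (t, θ)
      simp only at this ⊢
      rw [this]; ring
    have h2 := h1.int_mul k θ
    simp only [mul_one] at h2
    linarith
  refine ⟨x, y, ⟨fun θ => Θ (0, θ), by fun_prop, fun θ => hΘg (0, θ), fun θ => hy (0, θ)⟩,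
    ⟨fun t => Θ (t, 0), by fun_prop, fun t => by rw [← hΘg]; simp, fun t => hx (t, 0)⟩,
    fun τ k hτ hτk => ⟨⟨fun t => Θ (t, τ t), by fun_prop, fun t => ?_, fun t => ?_⟩,
      ⟨fun θ => Θ (0, θ + τ 0), by fun_prop, fun θ => ?_, fun θ => ?_⟩⟩⟩
  · rw [← hΘg]
    simp only [twist, mul_comm (δ : ℂ)]
  · beta_reduce
    rw [hτk, hyint]
    have := hx (t, τ t)
    simp only at this
    rw [this]; push_cast; ring
  · rw [← hΘg]
    simp only [twist]
    congr 3
    rw [mul_add, Circle.exp_add]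
    push_cast; ring
  · beta_reduce
    have := hy (0, θ + τ 0)
    simp only at this
    rw [← this]; congr 2; ring

/-! ### Fibrewise linear maps and their deformation to rotations. -/

open scoped ComplexConjugate in
theorem hasFDerivAt_linear_fibre {A B : ℝ → ℂ} {t : ℝ} (hA : DifferentiableAt ℝ A t)
    (hB : DifferentiableAt ℝ B t) :
    HasFDerivAt (fun p : ℝ × ℂ => (p.1, A p.1 * (p.2 + B p.1 * conj p.2)))
      ((ContinuousLinearMap.fst ℝ ℝ ℂ).prod (A t • (ContinuousLinearMap.snd ℝ ℝ ℂ +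
        B t • (Complex.conjCLE : ℂ →L[ℝ] ℂ).comp (ContinuousLinearMap.snd ℝ ℝ ℂ)))) (t, 0) := by
  have hA' : HasFDerivAt (fun p : ℝ × ℂ => A p.1) _ (t, 0) :=
    HasFDerivAt.comp (g := A) (t, (0 : ℂ)) hA.hasFDerivAt hasFDerivAt_fst
  have hB' : HasFDerivAt (fun p : ℝ × ℂ => B p.1) _ (t, 0) :=
    HasFDerivAt.comp (g := B) (t, (0 : ℂ)) hB.hasFDerivAt hasFDerivAt_fst
  have hc : HasFDerivAt (fun p : ℝ × ℂ => conj p.2) _ (t, 0) :=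
    HasFDerivAt.comp (g := fun w : ℂ => conj w) (t, (0 : ℂ))
      (Complex.conjCLE : ℂ →L[ℝ] ℂ).hasFDerivAt hasFDerivAt_snd
  have h := (hasFDerivAt_fst (𝕜 := ℝ) (p := (t, (0 : ℂ)))).prodMk
    (hA'.mul (hasFDerivAt_snd.add (hB'.mul hc)))
  refine h.congr_fderiv ?_
  ext v <;> simp

/-- The antilinear term has norm `‖b‖ * ‖w‖`, too small to cancel `w` unless `w = 0`. -/
theorem injective_add_mul_conj {a b w : ℂ} (ha : a ≠ 0) (hb : ‖b‖ < 1)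
    (h : a * (w + b * (starRingEnd ℂ) w) = 0) : w = 0 := by
  have h1 : w = -(b * (starRingEnd ℂ) w) := by
    have := (mul_eq_zero.1 h).resolve_left ha
    linear_combination this
  have h2 : ‖w‖ = ‖b‖ * ‖w‖ := by
    conv_lhs => rw [h1]
    rw [norm_neg, norm_mul, Complex.norm_conj]
  by_contra hw
  have := norm_pos_iff.2 hw
  nlinarith

open scoped ComplexConjugate in
/-- A path of loops of orientation-preserving real-linear automorphisms of `ℂ`. -/
theorem torusFamily_linear {A B : ℝ × ℝ → ℂ} (hA : ContDiff ℝ ∞ A) (hB : ContDiff ℝ ∞ B)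
    (hA0 : ∀ t, ∀ s ∈ Icc (0 : ℝ) 1, A (t, s) ≠ 0) (hB1 : ∀ t, ∀ s ∈ Icc (0 : ℝ) 1, ‖B (t, s)‖ < 1)
    (hAp : ∀ t s, A (t + 1, s) = A (t, s)) (hBp : ∀ t s, B (t + 1, s) = B (t, s)) :
    TorusFamily fun q => (q.1.1, A (q.1.1, q.2) * (q.1.2 + B (q.1.1, q.2) * conj q.1.2)) where
  smooth t s _ := by
    refine Eventually.of_forall fun q => ContDiff.contDiffAt ?_
    have h1 : ContDiff ℝ ∞ fun q : (ℝ × ℂ) × ℝ => (q.1.1, q.2) := by fun_prop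
    have h2 : ContDiff ℝ ∞ fun q : (ℝ × ℂ) × ℝ => conj q.1.2 :=
      (Complex.conjCLE : ℂ →L[ℝ] ℂ).contDiff.comp (contDiff_snd.comp contDiff_fst)
    exact (contDiff_fst.comp contDiff_fst).prodMk ((hA.comp h1).mul
      ((contDiff_snd.comp contDiff_fst).add ((hB.comp h1).mul h2)))
  equivariant t w s := by simp [hAp, hBp]
  core_injective s _ t t' k h := by
    refine ⟨k, ?_⟩
    simp [Prod.ext_iff] at h
    exact h
  immersion t s hs := by
    have h := hasFDerivAt_linear_fibre (A := fun t => A (t, s)) (B := fun t => B (t, s)) (t := t)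
      ((hA.comp (contDiff_id.prodMk contDiff_const)).differentiable (by simp) t)
      ((hB.comp (contDiff_id.prodMk contDiff_const)).differentiable (by simp) t)
    rw [h.fderiv]
    refine injective_of_forall_eq_zero fun v hv => ?_
    simp only [ContinuousLinearMap.prod_apply, Prod.mk_eq_zero] at hv
    exact Prod.ext hv.1 (injective_add_mul_conj (hA0 t s hs) (hB1 t s hs) (by
      have h := hv.2
      simp at h
      linear_combination h))

/-- Angle functions with a given winding number form a convex set, so any two twists with the same
number of turns are joined by a segment. -/
theorem torusFamily_twist {τ τ' : ℝ → ℝ} (hτ : ContDiff ℝ ∞ τ) (hτ' : ContDiff ℝ ∞ τ') {k : ℤ}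
    (hk : ∀ t, τ (t + 1) = τ t + k) (hk' : ∀ t, τ' (t + 1) = τ' t + k) :
    TorusFamily fun q => twist (fun t => (1 - q.2) * τ t + q.2 * τ' t) q.1 := by
  have h1 : ContDiff ℝ ∞ fun p : ℝ × ℝ =>
      (((2 * Real.pi * ((1 - p.2) * τ p.1 + p.2 * τ' p.1) : ℝ) : ℂ)) := by
    refine Complex.ofRealCLM.contDiff.comp (contDiff_const.mul (ContDiff.add ?_ ?_))
    · exact (contDiff_const.sub contDiff_snd).mul (hτ.comp contDiff_fst)
    · exact contDiff_snd.mul (hτ'.comp contDiff_fst)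
  have h := torusFamily_linear
    (A := fun p => Complex.exp (((2 * Real.pi * ((1 - p.2) * τ p.1 + p.2 * τ' p.1) : ℝ) : ℂ) * Complex.I))
    (B := fun _ => 0)
    (h1.mul contDiff_const).cexp
    contDiff_const (fun _ _ _ => Complex.exp_ne_zero _) (by simp) (fun t s => by
      rw [← Circle.coe_exp, ← Circle.coe_exp, Circle.coe_inj]
      exact circle_exp_eq_iff.2 ⟨k, by simp only [hk, hk']; ring⟩) (by simp)
  convert h using 2
  simp [twist, Circle.coe_exp]

theorem fderiv_equivariant {ζ : ℝ × ℂ → ℝ × ℂ} (hζ : ∀ t w, ζ (t + 1, w) = ζ (t, w) + (1, 0)) (t : ℝ)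
    (w : ℂ) : fderiv ℝ ζ (t + 1, w) = fderiv ℝ ζ (t, w) := by
  have h1 : (fun p => ζ (p + (1, 0))) = fun p => ζ p + (1, 0) := by
    funext p
    have := hζ p.1 p.2
    rw [show p + (1, 0) = (p.1 + 1, p.2) by ext <;> simp]
    exact this
  have h2 : fderiv ℝ (fun p => ζ (p + (1, 0))) (t, w) = fderiv ℝ ζ ((t, w) + (1, 0)) :=
    fderiv_comp_add_right _
  rw [h1, fderiv_add_const] at h2
  rw [h2]; congr 1; ext <;> simp

-- In this form, preserving the orientation of the fibre means that the complex linear coefficient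
-- dominates the antilinear one, a condition that survives scaling the latter to zero.
open scoped ComplexConjugate in
theorem snd_apply_eq_wirtinger (D : ℝ × ℂ →L[ℝ] ℝ × ℂ) (w : ℂ) :
    (D (0, w)).2 = ((D (0, 1)).2 - Complex.I * (D (0, Complex.I)).2) / 2 * w
      + ((D (0, 1)).2 + Complex.I * (D (0, Complex.I)).2) / 2 * conj w := by
  have h1 : (D (0, w)).2 = w.re * (D (0, 1)).2 + w.im * (D (0, Complex.I)).2 := by
    rw [clm_prod_complex_apply D 0 w]
    simp
  have h2 : conj w = w.re - w.im * Complex.I := by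
    apply Complex.ext <;> simp
  rw [h1, h2]
  have hw : w = w.re + w.im * Complex.I := (Complex.re_add_im w).symm
  linear_combination (w.im * (D (0, Complex.I)).2) * Complex.I_sq
    - ((D (0, 1)).2 - Complex.I * (D (0, Complex.I)).2) / 2 * hw

/-- An orientation-preserving linear map has a dominant complex linear part. -/
theorem norm_lt_of_orientation_pos {α β : ℝ × ℂ → R4} {p q : ℝ × ℂ} {D : ℝ × ℂ →L[ℝ] ℝ × ℂ}
    (hβα : β p = α q) (hD : fderiv ℝ β p = (fderiv ℝ α q).comp D) (hD1 : D (1, 0) = (1, 0))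
    (oα : 0 < orientation α q) (oβ : 0 < orientation β p) :
    ‖((D (0, 1)).2 + Complex.I * (D (0, Complex.I)).2) / 2‖
      < ‖((D (0, 1)).2 - Complex.I * (D (0, Complex.I)).2) / 2‖ := by
  have h3 : ∀ w, fderiv ℝ β p (0, w) = (D (0, w)).1 • fderiv ℝ α q (1, 0)
      + (D (0, w)).2.re • fderiv ℝ α q (0, 1) + (D (0, w)).2.im • fderiv ℝ α q (0, Complex.I) := by
    intro w
    rw [hD, ContinuousLinearMap.comp_apply]
    exact clm_prod_complex_apply _ _ _
  -- The first components of `D (0, 1)` and `D (0, I)` only add multiples of the row of the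
  -- `t`-derivative. The remaining factor is the determinant of the fibre part, equal to the
  -- difference of the squared norms of its two coefficients.
  have h4 : orientation β p = ((D (0, 1)).2.re * (D (0, Complex.I)).2.im
      - (D (0, 1)).2.im * (D (0, Complex.I)).2.re) * orientation α q := by
    unfold orientation
    rw [← det_combination, h3, h3, hβα]
    have h5 : fderiv ℝ β p (1, 0) = fderiv ℝ α q (1, 0) := by
      rw [hD, ContinuousLinearMap.comp_apply, hD1]
    rw [h5]
  rw [h4] at oβ
  have h5 := pos_of_mul_pos_left oβ oα.le
  refine lt_of_pow_lt_pow_left₀ 2 (norm_nonneg _) ?_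
  rw [← sub_pos]
  refine h5.trans_eq ?_
  rw [Complex.sq_norm, Complex.sq_norm, Complex.normSq_apply, Complex.normSq_apply]
  simp
  ring

open scoped ComplexConjugate in
/-- Two tubular neighbourhoods of the same knot differ, up to isotopy, by a twist. -/
theorem EmbOn.exists_straightening {R : ℝ} (hR : 0 < R) {α β : ℝ × ℂ → R4} (hα : EmbOn (disc R) α)
    (hβ : EmbOn (disc R) β) (hcore : ∀ t, α (t, 0) = β (t, 0))
    (oα : ∀ t : ℝ, 0 < orientation α (t, 0)) (oβ : ∀ t : ℝ, 0 < orientation β (t, 0)) :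
    ∃ F : (ℝ × ℂ) × ℝ → ℝ × ℂ, TorusFamily F ∧ (∀ t s, F ((t, 0), s) = (t, 0)) ∧
      (∃ r > 0, ∀ p ∈ disc r, α (F (p, 0)) = β p) ∧
      ∃ k : ℤ, ∀ τ : ℝ → ℝ, ContDiff ℝ ∞ τ → (∀ t, τ (t + 1) = τ t + k) →
        ∃ F' : (ℝ × ℂ) × ℝ → ℝ × ℂ, TorusFamily F' ∧ (∀ t s, F' ((t, 0), s) = (t, 0)) ∧
          (∀ p, F' (p, 0) = F (p, 1)) ∧ ∀ p, F' (p, 1) = twist τ p := by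
  obtain ⟨ζ, r, hr, hζ, hζe, hζ0⟩ := hα.exists_transition hR hβ hcore
  have hζs : ∀ t : ℝ, ContDiffAt ℝ ∞ ζ (t, 0) := fun t => (hζ _ (core_mem_disc hr t)).1
  have hζd : ∀ t : ℝ, DifferentiableAt ℝ ζ (t, 0) := fun t => (hζs t).differentiableAt (by simp)
  set D : ℝ → ℝ × ℂ →L[ℝ] ℝ × ℂ := fun t => fderiv ℝ ζ (t, 0) with hD
  have hDs : ContDiff ℝ ∞ D := by
    rw [contDiff_iff_contDiffAt]
    intro t
    exact ContDiffAt.comp t (g := fderiv ℝ ζ) (f := fun t : ℝ => (t, (0 : ℂ)))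
      ((hζs t).fderiv_right (by simp)) (by fun_prop)
  have hDp : ∀ t, D (t + 1) = D t := fun t => fderiv_equivariant hζe t 0
  have hD1 : ∀ t, D t (1, 0) = (1, 0) := by
    intro t
    have h1 : HasDerivAt (fun t : ℝ => (t, (0 : ℂ))) ((1 : ℝ), (0 : ℂ)) t :=
      (hasDerivAt_id _).prodMk (hasDerivAt_const _ _)
    have h2 := (hζd t).hasFDerivAt.comp_hasDerivAt t h1
    have h3 : (ζ ∘ fun t : ℝ => (t, (0 : ℂ))) = fun t : ℝ => (t, (0 : ℂ)) := funext hζ0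
    rw [h3] at h2
    exact h2.unique h1
  set M : ℂ → ℝ → ℂ := fun w t => (D t (0, w)).2 with hM
  have hMs : ∀ w, ContDiff ℝ ∞ (M w) := fun w => (hDs.clm_apply contDiff_const).snd
  set a : ℝ → ℂ := fun t => (M 1 t - Complex.I * M Complex.I t) / 2 with ha
  set b : ℝ → ℂ := fun t => (M 1 t + Complex.I * M Complex.I t) / 2 with hb
  have has : ContDiff ℝ ∞ a :=
    ((hMs 1).sub (contDiff_const.mul (hMs Complex.I))).div_const 2
  have hbs : ContDiff ℝ ∞ b :=
    ((hMs 1).add (contDiff_const.mul (hMs Complex.I))).div_const 2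
  have hMab : ∀ t w, M w t = a t * w + b t * conj w := fun t w => snd_apply_eq_wirtinger _ w
  have hdet : ∀ t, ‖b t‖ < ‖a t‖ := by
    intro t
    have h1 : β =ᶠ[𝓝 (t, 0)] fun p => α (ζ p) := by
      filter_upwards [(isOpen_disc r).mem_nhds (core_mem_disc hr t)] with p hp
      exact (hζ p hp).2.symm
    have hαd : HasFDerivAt α (fderiv ℝ α (t, 0)) (ζ (t, 0)) := by
      rw [hζ0]
      exact ((hα.smooth _ (core_mem_disc hR t)).differentiableAt (by simp)).hasFDerivAt
    have h2 : fderiv ℝ β (t, 0) = (fderiv ℝ α (t, 0)).comp (D t) := by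
      rw [h1.fderiv_eq]
      exact (HasFDerivAt.comp (t, (0 : ℂ)) hαd (hζd t).hasFDerivAt).fderiv
    exact norm_lt_of_orientation_pos (hcore t).symm h2 (hD1 t) (oα t) (oβ t)
  have ha0 : ∀ t, a t ≠ 0 := fun t => norm_pos_iff.1 ((norm_nonneg _).trans_lt (hdet t))
  have hMp : ∀ w t, M w (t + 1) = M w t := fun w t => by simp only [hM, hDp]
  have hap : ∀ t, a (t + 1) = a t := fun t => by simp only [ha, hMp]
  have hbp : ∀ t, b (t + 1) = b t := fun t => by simp only [hb, hMp]
  set μ : ℝ → ℂ := fun t => b t * (a t)⁻¹ with hμ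
  have hμs : ContDiff ℝ ∞ μ := hbs.mul (has.inv ha0)
  have hμ1 : ∀ t, ‖μ t‖ < 1 := by
    intro t
    rw [hμ, norm_mul, norm_inv, ← div_eq_mul_inv, div_lt_one (norm_pos_iff.2 (ha0 t))]
    exact hdet t
  have hμa : ∀ t w, a t * (w + μ t * conj w) = M w t := by
    intro t w
    have := ha0 t
    rw [hMab]
    simp only [hμ]
    field_simp
  obtain ⟨l, hl, hla, k, hlk⟩ := exists_complex_log_lift has ha0 hap
  -- Linear interpolation between the transition map and its fibre derivative. Both fix the core and
  -- have the same normal derivative `M` there, so the interpolation stays immersive along the core.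
  refine ⟨fun q => (1 - q.2) • ζ q.1 + q.2 • (q.1.1, a q.1.1 * (q.1.2 + μ q.1.1 * conj q.1.2)),
    ?_, ?_, ⟨r, hr, fun p hp => ?_⟩, k, fun τ hτ hτk => ?_⟩
  · have hlin : ContDiff ℝ ∞ fun p : ℝ × ℂ => (p.1, a p.1 * (p.2 + μ p.1 * conj p.2)) := by
      have h2 : ContDiff ℝ ∞ fun q : ℝ × ℂ => conj q.2 :=
        (Complex.conjCLE : ℂ →L[ℝ] ℂ).contDiff.comp contDiff_snd
      exact contDiff_fst.prodMk ((has.comp contDiff_fst).mul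
        (contDiff_snd.add ((hμs.comp contDiff_fst).mul h2)))
    refine ⟨fun t s _ => ?_, fun t w s => ?_, fun s _ t t' n h => ?_, fun t s hs => ?_⟩
    · have h1 : ∀ᶠ q : (ℝ × ℂ) × ℝ in 𝓝 ((t, 0), s), q.1 ∈ disc r :=
        continuousAt_fst.eventually ((isOpen_disc r).mem_nhds (core_mem_disc hr t))
      filter_upwards [h1] with q hq
      exact ((contDiffAt_const.sub contDiffAt_snd).smul
        (ContDiffAt.comp q (g := ζ) (hζ _ hq).1 contDiffAt_fst)).add
        (contDiffAt_snd.smul (hlin.contDiffAt.comp q contDiffAt_fst))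
    · simp only [hζe, hap]
      have : μ (t + 1) = μ t := by simp only [hμ, hap, hbp]
      rw [this]
      ext
      · simp; ring
      · simp
    · simp only [hζ0] at h
      refine ⟨n, ?_⟩
      simp [Prod.ext_iff] at h
      linarith
    · have h1 : HasFDerivAt (fun p : ℝ × ℂ => (1 - s) • ζ p
          + s • (p.1, a p.1 * (p.2 + μ p.1 * conj p.2))) _ (t, 0) :=
        ((hζd t).hasFDerivAt.const_smul (1 - s)).add
        ((hasFDerivAt_linear_fibre (has.differentiable (by simp) t)
          (hμs.differentiable (by simp) t)).const_smul s)
      rw [h1.fderiv]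
      refine injective_of_forall_eq_zero fun v hv => ?_
      have h2 : D t v = (v.1, 0) + D t (0, v.2) := by
        have h3 : v = v.1 • ((1 : ℝ), (0 : ℂ)) + (0, v.2) := by ext <;> simp
        conv_lhs => rw [h3]
        rw [map_add, map_smul, hD1]
        ext <;> simp
      have h4 : (1 - s) • D t v + s • (v.1, a t * (v.2 + μ t * conj v.2)) = 0 := by
        rw [← hv]; simp [hD, mul_add]
      rw [h2, hμa] at h4
      have h5 : M v.2 t = 0 := by
        have := congrArg Prod.snd h4
        simp only [Prod.snd_add, Prod.smul_snd, zero_add, Prod.snd_zero] at this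
        rw [show (D t (0, v.2)).2 = M v.2 t from rfl, ← add_smul] at this
        simpa using this
      have h6 : v.2 = 0 := by
        rw [← hμa] at h5
        exact injective_add_mul_conj (ha0 t) (hμ1 t) h5
      have h7 := congrArg Prod.fst h4
      rw [h6] at h7
      have h8 : D t (0, 0) = 0 := map_zero (D t)
      rw [h8] at h7
      simp at h7
      exact Prod.ext (show v.1 = 0 by linarith) h6
  · intro t s
    simp only [hζ0]
    ext
    · simp; ring
    · simp
  · simp only [sub_zero, one_smul, zero_smul, add_zero]
    exact (hζ p hp).2
  -- The antilinear part is scaled to zero while a logarithm of the linear part moves straight to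
  -- `2πiτ`. Both logarithms gain `2πik` per period, so all stages are periodic; this is why the
  -- winding number of `τ` must be `k`.
  · refine ⟨fun q => (q.1.1, Complex.exp ((1 - q.2 : ℝ) * l q.1.1
      + q.2 * ((2 * Real.pi * τ q.1.1 : ℝ) * Complex.I)) * (q.1.2 + ((1 - q.2 : ℝ) * μ q.1.1) * conj q.1.2)),
      ?_, ?_, ?_, ?_⟩
    · refine torusFamily_linear (A := fun p => Complex.exp ((1 - p.2 : ℝ) * l p.1
        + p.2 * ((2 * Real.pi * τ p.1 : ℝ) * Complex.I))) (B := fun p => (1 - p.2 : ℝ) * μ p.1)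
        ?_ ?_ (fun _ _ _ => Complex.exp_ne_zero _) ?_ ?_ ?_
      · refine ContDiff.cexp (ContDiff.add (ContDiff.mul ?_ (hl.comp contDiff_fst)) (ContDiff.mul ?_
          (ContDiff.mul ?_ contDiff_const)))
        · exact Complex.ofRealCLM.contDiff.comp (contDiff_const.sub contDiff_snd)
        · exact Complex.ofRealCLM.contDiff.comp contDiff_snd
        · exact Complex.ofRealCLM.contDiff.comp (contDiff_const.mul (hτ.comp contDiff_fst))
      · exact (Complex.ofRealCLM.contDiff.comp (contDiff_const.sub contDiff_snd)).mul
          (hμs.comp contDiff_fst)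
      · intro t s hs
        rw [norm_mul, Complex.norm_real, Real.norm_of_nonneg (by linarith [hs.2])]
        have h1 := hμ1 t
        have h2 := norm_nonneg (μ t)
        nlinarith [hs.1, hs.2]
      · intro t s
        rw [Complex.exp_eq_exp_iff_exists_int]
        refine ⟨k, ?_⟩
        simp only [hlk, hτk]
        push_cast
        ring
      · intro t s
        simp only [hμ, hap, hbp]
    · intro t s; simp
    · intro p
      simp [hla]
    · intro p
      simp [twist, Circle.coe_exp]

/-- Two tubes with the same core and framings `a`, `b` differ, up to isotopy, by `b - a` twists. -/
theorem EmbOn.exists_collaredConcordant_twist {R : ℝ} (hR : 0 < R) {α β : ℝ × ℂ → R4}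
    (hα : EmbOn (disc R) α) (hβ : EmbOn (disc R) β) (hcore : ∀ t, α (t, 0) = β (t, 0))
    (oα : ∀ t : ℝ, 0 < orientation α (t, 0)) (oβ : ∀ t : ℝ, 0 < orientation β (t, 0)) {a b : ℤ}
    (fα : GermFraming R α a) (fβ : GermFraming R β b) {τ : ℝ → ℝ} (hτ : ContDiff ℝ ∞ τ)
    (hτk : ∀ t, τ (t + 1) = τ t + (b - a : ℤ)) {P : ℝ → ℝ × ℂ} (hP : TorusCurve P) :
    ∃ δ₀ > 0, ∀ δ ∈ Ioc 0 δ₀, CollaredConcordant (fun t => β (shrink δ (P t)))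
      (fun t => α (twist τ (shrink δ (P t)))) := by
  obtain ⟨F, hF, hF0, ⟨r, hr, hFr⟩, k, hk⟩ := hα.exists_straightening hR hβ hcore oα oβ
  -- The number of turns is found by testing with the linear twist `k * t`: a framing function of
  -- `β` is followed through both deformations and compared with a framing function of `α`.
  have hkab : k = b - a := by
    obtain ⟨F', hF', hF'0, hF'F, hF'τ⟩ := hk (fun t => k * t) (by fun_prop) (fun t => by ring)
    obtain ⟨δ₁, hδ₁, h₁⟩ := hα.exists_degree_family hR hF fun t s _ => hF0 t s
    obtain ⟨δ₂, hδ₂, h₂⟩ := hα.exists_degree_family hR hF' fun t s _ => hF'0 t s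
    set δ := min (min R r) (min δ₁ δ₂) / 2 with hδ
    have hm : 0 < min (min R r) (min δ₁ δ₂) := lt_min (lt_min hR hr) (lt_min hδ₁ hδ₂)
    have hδ0 : 0 < δ := by positivity
    have hδm : δ < min (min R r) (min δ₁ δ₂) := by rw [hδ]; linarith
    have hδR : δ ∈ Ioo 0 R := ⟨hδ0, hδm.trans_le ((min_le_left _ _).trans (min_le_left _ _))⟩
    have hδr : δ < r := hδm.trans_le ((min_le_left _ _).trans (min_le_right _ _))
    have hδ1 : δ ∈ Ioo 0 δ₁ := ⟨hδ0, hδm.trans_le ((min_le_right _ _).trans (min_le_left _ _))⟩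
    have hδ2 : δ ∈ Ioo 0 δ₂ := ⟨hδ0, hδm.trans_le ((min_le_right _ _).trans (min_le_right _ _))⟩
    obtain ⟨f, hf, hfd⟩ := fα
    obtain ⟨g, hg, hgd⟩ := fβ
    have hcore' : (range fun t : ℝ => β (t, 0)) = range fun t : ℝ => α (t, 0) := by
      simp only [hcore]
    rw [hcore'] at hg
    obtain ⟨g1, g2⟩ := hgd δ hδR
    obtain ⟨f1, f2⟩ := hfd δ hδR
    obtain ⟨x, y, hy, hx, hxy⟩ := hα.exists_degrees_on_torus hg hδR
    obtain ⟨e1, e2⟩ := hxy (fun t => k * t) k (by fun_prop) (fun t => by ring)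
    have hnorm : ∀ θ : ℝ, ‖(δ : ℂ) * (Circle.exp (2 * Real.pi * θ) : ℂ)‖ < r := fun θ => by
      rw [norm_mul, Circle.norm_coe, mul_one, Complex.norm_real, Real.norm_of_nonneg hδ0.le]
      exact hδr
    have hlong : HasDegree (fun t => g (α (twist (fun t => k * t) (t, (δ : ℂ))))) b := by
      have h3 := (h₂ δ hδ2 g hg b).1
      simp only [hF'F, hF'τ] at h3
      refine h3 ((h₁ δ hδ1 g hg b).1 ?_)
      have h4 : ∀ t : ℝ, α (F ((t, (δ : ℂ)), 0)) = β (t, (δ : ℂ)) := fun t =>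
        hFr _ (by
          show ‖(δ : ℂ)‖ < r
          rw [Complex.norm_real, Real.norm_of_nonneg hδ0.le]; exact hδr)
      simpa only [h4] using g2
    have hmer : HasDegree (fun θ => g (α (twist (fun t => k * t)
        (0, (δ : ℂ) * (Circle.exp (2 * Real.pi * θ) : ℂ))))) 1 := by
      have h3 := (h₂ δ hδ2 g hg 1).2
      simp only [hF'F, hF'τ] at h3
      refine h3 ((h₁ δ hδ1 g hg 1).2 ?_)
      have h4 : ∀ θ : ℝ, α (F ((0, (δ : ℂ) * (Circle.exp (2 * Real.pi * θ) : ℂ)), 0))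
        = β (0, (δ : ℂ) * (Circle.exp (2 * Real.pi * θ) : ℂ)) := fun θ => hFr _ (hnorm θ)
      simpa only [h4] using g1
    have hy1 : y = 1 := e2.unique hmer
    have hxb : x + k * y = b := e1.unique hlong
    subst hy1
    -- Both framing functions have degree one on the meridian of `α`, so their quotient has degree
    -- zero there and hence on the longitude. This gives `x = a`, while `x + k = b`.
    have h5 := hα.degree_longitude_eq_zero (g := fun x => f x / g x) (d := a - x) (hf.div' hg) hδR
      (by simpa using f1.div hy) (f2.div hx)
    linarith
  subst hkab
  obtain ⟨F', hF', hF'0, hF'F, hF'τ⟩ := hk τ hτ hτk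
  obtain ⟨δ₁, hδ₁, h₁⟩ := hα.exists_collaredConcordant_family hF
    (fun t s _ => by rw [hF0]; simpa using hR) hP
  obtain ⟨δ₂, hδ₂, h₂⟩ := hα.exists_collaredConcordant_family hF'
    (fun t s _ => by rw [hF'0]; simpa using hR) hP
  obtain ⟨B, hB, hPB⟩ := hP.exists_bound
  refine ⟨min (r / (2 * B)) (min δ₁ δ₂), by positivity, fun δ hδ => ?_⟩
  have c1 := h₁ δ ⟨hδ.1, hδ.2.trans ((min_le_right _ _).trans (min_le_left _ _))⟩
  have c2 := h₂ δ ⟨hδ.1, hδ.2.trans ((min_le_right _ _).trans (min_le_right _ _))⟩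
  have h3 : ∀ t, α (F (shrink δ (P t), 0)) = β (shrink δ (P t)) := fun t => by
    refine hFr _ ?_
    show ‖(shrink δ (P t)).2‖ < r
    rw [norm_shrink_snd hδ.1.le]
    calc δ * ‖(P t).2‖ ≤ r / (2 * B) * B :=
          mul_le_mul (hδ.2.trans (min_le_left _ _)) (hPB t) (norm_nonneg _) (by positivity)
      _ = r / 2 := by field_simp
      _ < r := by linarith
  simp only [h3] at c1
  simp only [hF'F, hF'τ] at c2
  exact c1.trans c2

/-! ### Framed tubes and their transport along isotopies -/

/-- An oriented tube of radius `R` with framing `n`. -/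
structure FramedTube (R : ℝ) (ψ : ℝ × ℂ → R4) (n : ℤ) : Prop where
  embOn : EmbOn (disc R) ψ
  orientation_pos : ∀ t : ℝ, 0 < orientation ψ (t, 0)
  framing : GermFraming R ψ n

/-- The framing is prescribed at radius one. Moving the meridian and the longitude inwards through
the tube without its core carries the degrees to every smaller radius. -/
theorem IsTube.framedTube {φ : ℝ × ℂ → R4} {n : ℤ} (h : IsTube φ) (hn : HasFraming φ n) :
    FramedTube 1 φ n where
  embOn := h.embOn.mono disc_one_subset_solidTorus
  orientation_pos t := h.oriented _ (disc_one_subset_solidTorus (core_mem_disc one_pos t))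
  framing := by
    obtain ⟨f, hf, h1, h2⟩ := hn
    refine ⟨f, hf, fun δ hδ => ?_⟩
    have hmem : ∀ p ∈ solidTorus, p.2 ≠ 0 → φ p ∈ S3 \ range fun t : ℝ => φ (t, 0) := by
      intro p hp h0
      refine ⟨h.mem_sphere p hp, ?_⟩
      rintro ⟨t, ht⟩
      obtain ⟨n, hn⟩ := h.injective _ (disc_one_subset_solidTorus (core_mem_disc one_pos t)) _ hp ht
      exact h0 (by rw [hn]; simp)
    have hu : ∀ s ∈ Icc (0 : ℝ) 1, 0 < 1 - s * (1 - δ) ∧ 1 - s * (1 - δ) ≤ 1 := fun s hs =>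
      ⟨by nlinarith [hs.2, hδ.1, hδ.2], by nlinarith [hs.1, hδ.2]⟩
    have key : ∀ (F : ℝ × ℝ → ℝ × ℂ), Continuous F →
        (∀ s t, ‖(F (s, t)).2‖ = |1 - s * (1 - δ)|) →
        (∀ s t, φ (F (s, t + 1)) = φ (F (s, t))) → ∀ k, HasDegree (fun t => f (φ (F (0, t)))) k →
        HasDegree (fun t => f (φ (F (1, t)))) k := by
      intro F hF hFn hFp k hk
      have hFm : ∀ q ∈ Icc (0 : ℝ) 1 ×ˢ (univ : Set ℝ), F q ∈ solidTorus ∧ (F q).2 ≠ 0 := by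
        rintro ⟨s, t⟩ ⟨hs, -⟩
        have h3 := hFn s t
        rw [abs_of_pos (hu s hs).1] at h3
        exact ⟨h3.le.trans (hu s hs).2, norm_pos_iff.1 (by rw [h3]; exact (hu s hs).1)⟩
      refine HasDegree.of_homotopy (F := fun q => f (φ (F q))) ?_
        (fun s _ t => by simp only [hFp]) hk
      refine ContinuousOn.comp hf (fun q hq => ?_) fun q hq => hmem _ (hFm q hq).1 (hFm q hq).2
      exact (ContinuousAt.comp (f := F) (h.smooth _ (hFm q hq).1).continuousAt
        hF.continuousAt).continuousWithinAt
    constructor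
    · have := key (fun q => (0, ((1 - q.1 * (1 - δ) : ℝ) : ℂ) * (Circle.exp (2 * Real.pi * q.2) : ℂ)))
        (by fun_prop) (fun s t => by simp only [norm_mul, Circle.norm_coe, mul_one, Complex.norm_real,
          Real.norm_eq_abs]) (fun s t => by
            have h3 : Circle.exp (2 * Real.pi * (t + 1)) = Circle.exp (2 * Real.pi * t) :=
              circle_exp_eq_iff.2 ⟨1, by simp⟩
            simp only [h3]) 1 (by simpa using h1)
      simpa using this
    · have := key (fun q => (q.2, ((1 - q.1 * (1 - δ) : ℝ) : ℂ)))
        (by fun_prop) (fun s t => by simp only [Complex.norm_real, Real.norm_eq_abs])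
        (fun s t => h.periodic _ _) n (by simpa using h2)
      simpa using this

/-- The position vector is orthogonal to the image of the derivative. A relation among the four rows
therefore does not involve it and gives a kernel vector of the derivative. -/
theorem EmbOn.orientation_ne_zero {D : Set (ℝ × ℂ)} (hD : IsOpen D) {φ : ℝ × ℂ → R4}
    (h : EmbOn D φ) {p : ℝ × ℂ} (hp : p ∈ D) : orientation φ p ≠ 0 := by
  intro h0
  obtain ⟨v, hv, hvM⟩ := Matrix.exists_vecMul_eq_zero_iff.2 h0
  have hd := (h.smooth p hp).differentiableAt (by simp)
  have hS : ∀ᶠ q in 𝓝 p, φ q ∈ S3 := by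
    filter_upwards [hD.mem_nhds hp] with q hq using h.mem_sphere q hq
  set w : ℝ × ℂ := (v 1, ⟨v 2, v 3⟩) with hw
  have h1 : v 0 • φ p + fderiv ℝ φ p w = 0 := by
    rw [hw, clm_prod_complex_apply]
    ext j
    have := congrFun hvM j
    simp only [Matrix.vecMul, dotProduct, Fin.sum_univ_four, Matrix.of_apply, Pi.zero_apply] at this
    simp only [PiLp.add_apply, PiLp.smul_apply, PiLp.zero_apply, smul_eq_mul]
    simp at this
    linarith
  have h2 : v 0 = 0 := by
    have h3 := congrArg (fun x => inner ℝ (φ p) x) h1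
    have h4 : ‖φ p‖ = 1 := by simpa using h.mem_sphere p hp
    simpa [inner_add_right, inner_smul_right, inner_fderiv_eq_zero hd hS,
      real_inner_self_eq_norm_sq, h4] using h3
  have h5 : w = 0 := h.immersion p hp (by rw [map_zero]; simpa [h2] using h1)
  refine hv (funext fun i => ?_)
  have h6 : v 1 = 0 := congrArg Prod.fst h5
  have h7 : v 2 = 0 := congrArg (fun x : ℝ × ℂ => x.2.re) h5
  have h8 : v 3 = 0 := congrArg (fun x : ℝ × ℂ => x.2.im) h5
  fin_cases i <;> simp [h2, h6, h7, h8]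

theorem EmbOn.isKnot {D : Set (ℝ × ℂ)} {ψ : ℝ × ℂ → R4} (hψ : EmbOn D ψ) {P : ℝ → ℝ × ℂ}
    (hP : TorusCurve P) (hD : ∀ t, P t ∈ D) : IsKnot fun t => ψ (P t) := by
  obtain ⟨h1, h2, h3⟩ := hψ.curve hP hD
  refine ⟨?_, h1, fun t => hψ.mem_sphere _ (hD t), h2, h3⟩
  rw [contDiff_iff_contDiffAt]
  exact fun t => ContDiffAt.comp t (hψ.smooth _ (hD t)) hP.smooth.contDiffAt

/-- Run the isotopy backwards, after the inverse of its final diffeomorphism, so that it starts at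
the identity again. -/
theorem Isotopic.symm {K K' : ℝ → R4} (hK : ∀ t, K t ∈ S3) (h : Isotopic K K') : Isotopic K' K := by
  obtain ⟨H, G, hHG, h0, h1⟩ := h
  have hI : ∀ s ∈ Icc (0 : ℝ) 1, 1 - s ∈ Icc (0 : ℝ) 1 := fun s hs =>
    ⟨by linarith [hs.2], by linarith [hs.1]⟩
  have i1 : (1 : ℝ) ∈ Icc (0 : ℝ) 1 := right_mem_Icc.2 zero_le_one
  refine ⟨fun q => H (1 - q.1, G (1, q.2)), fun q => H (1, G (1 - q.1, q.2)), fun s hs x hx => ?_,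
    fun x hx => ?_, fun t => ?_⟩
  · obtain ⟨a1, a2, a3, a4, a5, a6⟩ := hHG 1 i1 x hx
    obtain ⟨b1, b2, b3, b4, b5, b6⟩ := hHG (1 - s) (hI s hs) _ a4
    obtain ⟨c1, c2, c3, c4, c5, c6⟩ := hHG (1 - s) (hI s hs) x hx
    obtain ⟨d1, d2, d3, d4, d5, d6⟩ := hHG 1 i1 _ c4
    refine ⟨?_, ?_, b3, d3, ?_, ?_⟩
    · refine ContDiffAt.comp (s, x) (g := H) (f := fun q : ℝ × R4 => (1 - q.1, G (1, q.2))) b1 ?_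
      refine (contDiffAt_const.sub contDiffAt_fst).prodMk ?_
      exact ContDiffAt.comp (s, x) (g := G) (f := fun q : ℝ × R4 => ((1 : ℝ), q.2)) a2
        (contDiffAt_const.prodMk contDiffAt_snd)
    · refine ContDiffAt.comp (s, x) (g := H) (f := fun q : ℝ × R4 => (1, G (1 - q.1, q.2))) d1 ?_
      refine contDiffAt_const.prodMk ?_
      exact ContDiffAt.comp (s, x) (g := G) (f := fun q : ℝ × R4 => (1 - q.1, q.2)) c2
        ((contDiffAt_const.sub contDiffAt_fst).prodMk contDiffAt_snd)
    · simp only [b5, a6]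
    · simp only [d5, c6]
  · simp only [sub_zero]
    exact (hHG 1 i1 x hx).2.2.2.2.2
  · simp only [sub_self, ← h1]
    obtain ⟨a1, a2, a3, a4, a5, a6⟩ := hHG 1 i1 _ (hK t)
    rw [a5, h0 _ (hK t)]

/-- The diffeomorphism at the end of an isotopy changes knots by concordances, and it maps framed
tubes to framed tubes. -/
theorem Isotopic.exists_transport {K K' : ℝ → R4} (h : Isotopic K K') :
    ∃ g : R4 → R4, (∀ t, g (K t) = K' t) ∧
      (∀ c, IsKnot c → CollaredConcordant c fun t => g (c t)) ∧
      ∀ R ψ n, 0 < R → FramedTube R ψ n → FramedTube R (fun p => g (ψ p)) n := by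
  obtain ⟨H, G, hHG, h0, h1⟩ := h
  have i1 : (1 : ℝ) ∈ Icc (0 : ℝ) 1 := right_mem_Icc.2 zero_le_one
  have i0 : (0 : ℝ) ∈ Icc (0 : ℝ) 1 := left_mem_Icc.2 zero_le_one
  have hinj : ∀ s ∈ Icc (0 : ℝ) 1, ∀ x ∈ S3, ∀ y ∈ S3, H (s, x) = H (s, y) → x = y := by
    intro s hs x hx y hy hxy
    rw [← (hHG s hs x hx).2.2.2.2.1, hxy, (hHG s hs y hy).2.2.2.2.1]
  have hHs : ∀ s ∈ Icc (0 : ℝ) 1, ∀ x ∈ S3, ContDiffAt ℝ ∞ (fun y => H (s, y)) x := fun s hs x hx =>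
    ContDiffAt.comp x (g := H) (hHG s hs x hx).1 (contDiffAt_const.prodMk contDiffAt_id)
  have hGs : ∀ s ∈ Icc (0 : ℝ) 1, ∀ x ∈ S3, ContDiffAt ℝ ∞ (fun y => G (s, y)) x := fun s hs x hx =>
    ContDiffAt.comp x (g := G) (hHG s hs x hx).2.1 (contDiffAt_const.prodMk contDiffAt_id)
  refine ⟨fun x => H (1, x), h1, fun c hc => ?_, fun R ψ n hR hψ => ?_⟩
  · have hc0 : ∀ t, H (0, c t) = c t := fun t => h0 _ (hc.mem_sphere t)
    have := collaredConcordant_of_isotopy (k := fun p => H (p.2, c p.1)) (fun t s hs => ?_)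
      (fun t s hs => by simp only [hc.periodic]) (fun t s hs => (hHG s hs _ (hc.mem_sphere t)).2.2.1)
      (fun s hs t t' htt => hc.injective _ _
        (hinj s hs _ (hc.mem_sphere t) _ (hc.mem_sphere t') htt)) (fun t s hs hd => ?_)
    · simpa only [hc0] using this
    · exact ContDiffAt.comp (t, s) (g := H) (f := fun p : ℝ × ℝ => (p.2, c p.1))
        (hHG s hs _ (hc.mem_sphere t)).1 (contDiffAt_snd.prodMk
          (ContDiffAt.comp (t, s) (g := c) hc.smooth.contDiffAt contDiffAt_fst))
    · have hm := hc.mem_sphere t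
      have e1 : DifferentiableAt ℝ (fun t => H (s, c t)) t :=
        (((hHs s hs _ hm).differentiableAt (by simp)).hasFDerivAt.comp_hasDerivAt t
          (hc.smooth.differentiable (by simp) t).hasDerivAt).differentiableAt
      have e2 : DifferentiableAt ℝ (fun y => G (s, y)) (H (s, c t)) :=
        (hGs s hs _ (hHG s hs _ hm).2.2.1).differentiableAt (by simp)
      have e3 := e2.hasFDerivAt.comp_hasDerivAt t e1.hasDerivAt
      have e4 : ((fun y => G (s, y)) ∘ fun t => H (s, c t)) = c := funext fun t =>
        (hHG s hs _ (hc.mem_sphere t)).2.2.2.2.1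
      rw [e4] at e3
      refine hc.immersion t ?_
      rw [e3.deriv]
      simp only at hd
      rw [hd, map_zero]
  · have hE := hψ.embOn
    have hemb : ∀ s ∈ Icc (0 : ℝ) 1, EmbOn (disc R) fun p => H (s, ψ p) := by
      intro s hs
      refine ⟨fun p hp => ?_, fun t w => by simp only [hE.periodic], fun p hp =>
        (hHG s hs _ (hE.mem_sphere p hp)).2.2.1, fun p hp q hq hpq => hE.injective p hp q hq
          (hinj s hs _ (hE.mem_sphere p hp) _ (hE.mem_sphere q hq) hpq), fun p hp => ?_⟩
      · exact ContDiffAt.comp p (g := fun y => H (s, y)) (hHs s hs _ (hE.mem_sphere p hp))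
          (hE.smooth p hp)
      · have hm := hE.mem_sphere p hp
        refine injective_fderiv_of_comp (g := fun y => G (s, y))
          ((hGs s hs _ (hHG s hs _ hm).2.2.1).differentiableAt (by simp))
          ((ContDiffAt.comp p (g := fun y => H (s, y)) (hHs s hs _ hm)
            (hE.smooth p hp)).differentiableAt (by simp)) ?_
        have e1 : (fun q => G (s, H (s, ψ q))) =ᶠ[𝓝 p] ψ := by
          filter_upwards [(isOpen_disc R).mem_nhds hp] with q hq
          exact (hHG s hs _ (hE.mem_sphere q hq)).2.2.2.2.1
        rw [e1.fderiv_eq]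
        exact hE.immersion p hp
    refine ⟨hemb 1 i1, fun t => ?_, ?_⟩
    · have hp := core_mem_disc hR t
      have hsm : ∀ s ∈ Icc (0 : ℝ) 1,
          ContDiffAt ℝ ∞ (fun q : (ℝ × ℂ) × ℝ => H (q.2, ψ q.1)) ((t, 0), s) := fun s hs =>
        ContDiffAt.comp ((t, (0 : ℂ)), s) (g := H) (f := fun q : (ℝ × ℂ) × ℝ => (q.2, ψ q.1))
          (hHG s hs _ (hE.mem_sphere _ hp)).1 (contDiffAt_snd.prodMk
          (ContDiffAt.comp ((t, (0 : ℂ)), s) (g := ψ) (hE.smooth _ hp) contDiffAt_fst))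
      have hd : ∀ v, ContinuousOn (fun s => fderiv ℝ (fun p => H (s, ψ p)) (t, 0) v)
          (Icc (0 : ℝ) 1) := by
        intro v
        have e1 : ContinuousOn (fun s : ℝ => fderiv ℝ (fun q : (ℝ × ℂ) × ℝ => H (q.2, ψ q.1))
            ((t, 0), s) (v, 0)) (Icc (0 : ℝ) 1) := by
          intro s hs
          refine ContinuousAt.continuousWithinAt ?_
          have e2 := ((hsm s hs).fderiv_right (m := 0) (by simp)).continuousAt
          exact (ContinuousAt.comp (f := fun s : ℝ => ((t, (0 : ℂ)), s)) e2
            (by fun_prop)).clm_apply continuousAt_const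
        refine e1.congr fun s hs => ?_
        have e3 : HasFDerivAt (fun p : ℝ × ℂ => (p, s))
            ((ContinuousLinearMap.id ℝ (ℝ × ℂ)).prod 0) (t, 0) :=
          (hasFDerivAt_id _).prodMk (hasFDerivAt_const _ _)
        have e4 := HasFDerivAt.comp (t, (0 : ℂ)) (f := fun p : ℝ × ℂ => (p, s))
          ((hsm s hs).differentiableAt (by simp)).hasFDerivAt e3
        have e5 : fderiv ℝ (fun p => H (s, ψ p)) (t, 0) = _ := e4.fderiv
        rw [e5]
        simp
      have h0' : ContinuousOn (fun s => H (s, ψ (t, 0))) (Icc (0 : ℝ) 1) := by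
        intro s hs
        exact (ContinuousAt.comp (f := fun s : ℝ => ((t, (0 : ℂ)), s)) (hsm s hs).continuousAt
          (by fun_prop)).continuousWithinAt
      have hcont : ContinuousOn (fun s => orientation (fun p => H (s, ψ p)) (t, 0))
          (Icc (0 : ℝ) 1) := by
        have c1 := hd (1, 0)
        have c2 := hd (0, 1)
        have c3 := hd (0, Complex.I)
        have hco : ∀ {k : ℝ → R4}, ContinuousOn k (Icc (0 : ℝ) 1) → ∀ j,
            ContinuousOn (fun s => k s j) (Icc (0 : ℝ) 1) := fun hk j =>
          (EuclideanSpace.proj (𝕜 := ℝ) j : R4 →L[ℝ] ℝ).continuous.comp_continuousOn hk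
        unfold orientation
        simp only [Matrix.det_succ_row_zero, Fin.sum_univ_succ]
        simp
        have d0 := fun j => hco h0' j
        have d1 := fun j => hco c1 j
        have d2 := fun j => hco c2 j
        have d3 := fun j => hco c3 j
        fun_prop
      -- The orientation determinant depends continuously on `s`, is positive for the identity at `s
      -- = 0`, and never vanishes because every stage embeds the tube. Hence it cannot change sign.
      by_contra hneg
      have hle := not_lt.1 hneg
      have hpos : 0 < orientation (fun p => H (0, ψ p)) (t, 0) := by
        have e1 : (fun p => H (0, ψ p)) =ᶠ[𝓝 (t, 0)] ψ := by
          filter_upwards [(isOpen_disc R).mem_nhds hp] with q hq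
          exact h0 _ (hE.mem_sphere q hq)
        have := hψ.orientation_pos t
        unfold orientation at this ⊢
        have e2 : H (0, ψ (t, 0)) = ψ (t, 0) := e1.eq_of_nhds
        simpa only [e1.fderiv_eq, e2] using this
      obtain ⟨s, hs, hs0⟩ := intermediate_value_Icc' zero_le_one hcont ⟨hle, hpos.le⟩
      exact (hemb s hs).orientation_ne_zero (isOpen_disc R) hp hs0
    · obtain ⟨f, hf, hfd⟩ := hψ.framing
      have hGH : ∀ p ∈ disc R, G (1, H (1, ψ p)) = ψ p := fun p hp =>
        (hHG 1 i1 _ (hE.mem_sphere p hp)).2.2.2.2.1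
      refine ⟨fun x => f (G (1, x)), ?_, fun δ hδ => ?_⟩
      · refine ContinuousOn.comp hf (fun x hx => (hGs 1 i1 x hx.1).continuousAt.continuousWithinAt)
          fun x hx => ⟨(hHG 1 i1 x hx.1).2.2.2.1, ?_⟩
        rintro ⟨t, ht⟩
        refine hx.2 ⟨t, ?_⟩
        beta_reduce at ht ⊢
        rw [ht, (hHG 1 i1 x hx.1).2.2.2.2.2]
      · obtain ⟨d1, d2⟩ := hfd δ hδ
        have hn : ‖(δ : ℂ)‖ < R := by
          rw [Complex.norm_real, Real.norm_of_nonneg hδ.1.le]; exact hδ.2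
        have e1 : ∀ θ : ℝ, G (1, H (1, ψ (0, (δ : ℂ) * (Circle.exp (2 * Real.pi * θ) : ℂ))))
            = ψ (0, (δ : ℂ) * (Circle.exp (2 * Real.pi * θ) : ℂ)) := fun θ => hGH _ (by
          show ‖_‖ < R
          rwa [norm_mul, Circle.norm_coe, mul_one])
        have e2 : ∀ t : ℝ, G (1, H (1, ψ (t, (δ : ℂ)))) = ψ (t, (δ : ℂ)) := fun t => hGH _ hn
        simp only [e1, e2]
        exact ⟨d1, d2⟩

/-! ### The standard tube, reflections and rotations -/

theorem HasDegree.comp_neg {γ : ℝ → Circle} {n : ℤ} (h : HasDegree γ n) :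
    HasDegree (fun t => γ (-t)) (-n) := by
  obtain ⟨θ, hθ, h1, h2⟩ := h
  refine ⟨fun t => θ (-t), by fun_prop, fun t => h1 _, fun t => ?_⟩
  have := h2 (-(t + 1))
  beta_reduce
  rw [show -(t + 1) + 1 = -t by ring] at this
  rw [this]; push_cast; ring

/-- The scale factor is maximal on the core, so its derivative vanishes there and `stdLift` can
replace `stdTorus`; the determinant is `2π`. -/
theorem orientation_stdTorus_pos (t : ℝ) : 0 < orientation stdTorus (t, 0) := by
  have h1 : stdScale (t, 0) = 1 := by simp [stdScale]
  have h2 : fderiv ℝ stdScale (t, 0) = 0 := by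
    refine IsLocalMax.fderiv_eq_zero (Eventually.of_forall fun p => ?_)
    rw [h1]
    refine inv_le_one_of_one_le₀ (Real.one_le_sqrt.2 ?_)
    nlinarith [sq_nonneg ‖p.2‖]
  have h3 : fderiv ℝ stdTorus (t, 0) = fderiv ℝ stdLift (t, 0) := by
    have h4 := (contDiff_stdScale.differentiable (by simp) (t, 0)).hasFDerivAt.smul
      (contDiff_stdLift.differentiable (by simp) (t, 0)).hasFDerivAt
    have h5 : fderiv ℝ stdTorus (t, 0) = _ := h4.fderiv
    rw [h5, h1, h2]
    exact ContinuousLinearMap.ext fun v => by simp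
  have hcomp : ∀ v, ∀ i : Fin 4, ∀ f : ℝ × ℂ → ℝ, (∀ q, stdLift q i = f q) →
      ∀ f' : ℝ × ℂ →L[ℝ] ℝ, HasFDerivAt f f' (t, 0) → fderiv ℝ stdLift (t, 0) v i = f' v := by
    intro v i f hf f' hf'
    have h3 := (EuclideanSpace.proj (𝕜 := ℝ) i : R4 →L[ℝ] ℝ).hasFDerivAt.comp (t, (0 : ℂ))
      (contDiff_stdLift.differentiable (by simp) (t, 0)).hasFDerivAt
    have h4 : HasFDerivAt f ((EuclideanSpace.proj (𝕜 := ℝ) i : R4 →L[ℝ] ℝ).comp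
        (fderiv ℝ stdLift (t, 0))) (t, 0) := by
      refine h3.congr_of_eventuallyEq (Eventually.of_forall fun q => ?_)
      rw [← hf]; rfl
    rw [hf'.unique h4]; rfl
  have ha : HasFDerivAt (fun q : ℝ × ℂ => 2 * Real.pi * q.1)
      ((2 * Real.pi) • ContinuousLinearMap.fst ℝ ℝ ℂ) (t, 0) := hasFDerivAt_fst.const_mul _
  have u0 := fun v => hcomp v 0 _ (fun q => rfl) _ ha.cos
  have u1 := fun v => hcomp v 1 _ (fun q => rfl) _ ha.sin
  have u2 := fun v => hcomp v 2 (fun q => q.2.re) (fun q => rfl) _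
    (Complex.reCLM.hasFDerivAt.comp (t, (0 : ℂ)) (hasFDerivAt_snd (𝕜 := ℝ)))
  have u3 := fun v => hcomp v 3 (fun q => q.2.im) (fun q => rfl) _
    (Complex.imCLM.hasFDerivAt.comp (t, (0 : ℂ)) (hasFDerivAt_snd (𝕜 := ℝ)))
  have hcs := Real.sin_sq_add_cos_sq (2 * Real.pi * t)
  have hfin : orientation stdTorus (t, 0) = 2 * Real.pi := by
    unfold orientation
    rw [h3]
    simp [Matrix.det_succ_row_zero, Fin.sum_univ_succ, Fin.succAbove, u0, u1, u2, u3,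
      stdTorus_zero, stdTorus_one, stdTorus_two, stdTorus_three, h1]
    linear_combination (2 * Real.pi) * hcs
  rw [hfin]
  positivity

/-- The argument of the second complex coordinate is defined, as a point of the circle, off the
core. It turns once along a meridian and is constant along the longitude. -/
theorem framedTube_stdTorus : FramedTube 1 stdTorus 0 where
  embOn := embOn_stdTorus.mono (subset_univ _)
  orientation_pos := orientation_stdTorus_pos
  framing := by
    refine ⟨fun x => Circle.exp (Complex.arg (x 2 + x 3 * Complex.I)), ?_, fun δ hδ => ?_⟩
    · intro x hx
      have hz : (x 2 + x 3 * Complex.I : ℂ) ≠ 0 := by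
        intro h0
        have e2 : x 2 = 0 := by simpa using congrArg Complex.re h0
        have e3 : x 3 = 0 := by simpa using congrArg Complex.im h0
        have hn : ‖x‖ = 1 := by simpa using hx.1
        rw [EuclideanSpace.norm_eq, Real.sqrt_eq_one] at hn
        simp only [Fin.sum_univ_four, Real.norm_eq_abs, sq_abs, e2, e3] at hn
        set z : ℂ := ⟨x 0, x 1⟩ with hzd
        have hz1 : ‖z‖ = 1 := by
          rw [Complex.norm_def, Complex.normSq_apply, Real.sqrt_eq_one]
          simp only [hzd]; nlinarith
        have h4 := norm_mul_circle_exp z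
        rw [hz1, Complex.ofReal_one, one_mul, Circle.coe_exp] at h4
        refine hx.2 ⟨z.arg / (2 * Real.pi), ?_⟩
        have h5 := congrArg Complex.re h4
        have h6 := congrArg Complex.im h4
        rw [Complex.exp_ofReal_mul_I_re] at h5
        rw [Complex.exp_ofReal_mul_I_im] at h6
        have h7 : stdScale (z.arg / (2 * Real.pi), 0) = 1 := by simp [stdScale]
        ext i
        fin_cases i
        · simpa [stdTorus_zero, h7] using h5
        · simpa [stdTorus_one, h7] using h6
        · simpa [stdTorus_two, h7] using e2.symm
        · simpa [stdTorus_three, h7] using e3.symm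
      refine ContinuousAt.continuousWithinAt ?_
      have hI : Topology.IsInducing (fun z : Circle => (z : ℂ)) := ⟨rfl⟩
      rw [hI.continuousAt_iff]
      have hc : Continuous fun x : R4 => (x 2 + x 3 * Complex.I : ℂ) := by fun_prop
      have h8 : ContinuousAt (fun x : R4 => (x 2 + x 3 * Complex.I : ℂ)
          * ((‖(x 2 + x 3 * Complex.I : ℂ)‖ : ℝ) : ℂ)⁻¹) x := by
        refine hc.continuousAt.mul (ContinuousAt.inv₀ ?_ (by simpa using hz))
        exact (Complex.continuous_ofReal.comp hc.norm).continuousAt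
      refine h8.congr ?_
      filter_upwards [hc.continuousAt.eventually_ne hz] with y hy
      simp only [Function.comp, Circle.coe_exp]
      have h9 := Complex.norm_mul_exp_arg_mul_I (y 2 + y 3 * Complex.I : ℂ)
      have h10 : ((‖(y 2 + y 3 * Complex.I : ℂ)‖ : ℝ) : ℂ) ≠ 0 := by simpa using hy
      rw [← div_eq_mul_inv, div_eq_iff h10]; linear_combination -h9
    · have key : ∀ p : ℝ × ℂ, (stdTorus p 2 + stdTorus p 3 * Complex.I : ℂ) = stdScale p * p.2 := by
        intro p
        rw [stdTorus_two, stdTorus_three]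
        push_cast
        linear_combination (stdScale p : ℂ) * Complex.re_add_im p.2
      simp only [key, Complex.arg_real_mul _ (stdScale_pos _), Complex.arg_real_mul _ hδ.1]
      constructor
      · have h1 : ∀ θ : ℝ, Circle.exp (Complex.arg (Circle.exp (2 * Real.pi * θ) : ℂ))
            = Circle.exp (2 * Real.pi * ((1 : ℤ) * θ)) := fun θ => by
          rw [Circle.exp_arg]; simp
        simp only [h1]
        exact hasDegree_exp_mul 1
      · rw [Complex.arg_ofReal_of_nonneg hδ.1.le]
        exact ⟨fun _ => 0, continuous_const, fun _ => by simp, fun _ => by simp⟩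

/-- The reflection of `ℝ⁴` in the second coordinate. -/
noncomputable def reflectOne (x : R4) : R4 := !₂[x 0, -x 1, x 2, x 3]

theorem reflectOne_reflectOne (x : R4) : reflectOne (reflectOne x) = x := by
  ext i; fin_cases i <;> simp [reflectOne]

noncomputable def reflectOneCLM : R4 →L[ℝ] R4 :=
  LinearMap.toContinuousLinearMap
    { toFun := reflectOne
      map_add' := fun x y => by ext i; fin_cases i <;> simp [reflectOne]; ring
      map_smul' := fun c x => by ext i; fin_cases i <;> simp [reflectOne] }

theorem contDiff_reflectOne : ContDiff ℝ ∞ reflectOne := reflectOneCLM.contDiff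

theorem reflectOne_mem {x : R4} (hx : x ∈ S3) : reflectOne x ∈ S3 := by
  have h : ‖x‖ = 1 := by simpa using hx
  have h2 : ‖reflectOne x‖ = 1 := by
    rw [EuclideanSpace.norm_eq] at h ⊢
    simpa [Fin.sum_univ_four, reflectOne] using h
  simpa using h2

/-- Reflecting the sphere and reversing the circle direction are two orientation reversals, so the
tube stays oriented. Pulled back by the reflection, the framing function sees the old meridian, but
the longitude runs backwards; this is the sign. -/
theorem FramedTube.reflect {R : ℝ} {α : ℝ × ℂ → R4} {n : ℤ} (hR : 0 < R) (h : FramedTube R α n) :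
    FramedTube R (fun p => reflectOne (α (-p.1, p.2))) (-n) := by
  have hE := h.embOn
  set ν : ℝ × ℂ →L[ℝ] ℝ × ℂ :=
    (-ContinuousLinearMap.fst ℝ ℝ ℂ).prod (ContinuousLinearMap.snd ℝ ℝ ℂ) with hν
  have hνp : ∀ p, ν p = (-p.1, p.2) := fun p => rfl
  have hinj : ∀ x y, reflectOne x = reflectOne y → x = y := fun x y hxy => by
    rw [← reflectOne_reflectOne x, hxy, reflectOne_reflectOne]
  have hm : ∀ p ∈ disc R, ν p ∈ disc R := fun p hp => hp
  have hd : ∀ p ∈ disc R, HasFDerivAt (fun p => reflectOne (α (-p.1, p.2)))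
      (reflectOneCLM.comp ((fderiv ℝ α (ν p)).comp ν)) p := fun p hp =>
    reflectOneCLM.hasFDerivAt.comp p (HasFDerivAt.comp p (g := α)
      ((hE.smooth _ (hm p hp)).differentiableAt (by simp)).hasFDerivAt ν.hasFDerivAt)
  refine ⟨⟨fun p hp => ?_, fun t w => ?_, fun p hp => reflectOne_mem (hE.mem_sphere _ (hm p hp)),
    fun p hp q hq hpq => ?_, fun p hp => ?_⟩, fun t => ?_, ?_⟩
  · exact contDiff_reflectOne.contDiffAt.comp p
      (ContDiffAt.comp p (g := α) (f := ν) (hE.smooth _ (hm p hp)) ν.contDiff.contDiffAt)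
  · have := hE.periodic (-(t + 1)) w
    rw [show -(t + 1) + 1 = -t by ring] at this
    simp only [this]
  · obtain ⟨k, hk⟩ := hE.injective _ (hm p hp) _ (hm q hq) (hinj _ _ hpq)
    have e1 := congrArg Prod.fst hk
    have e2 := congrArg Prod.snd hk
    simp [hνp] at e1 e2
    exact ⟨-k, Prod.ext (by simp; linarith) (by simpa using e2)⟩
  · rw [(hd p hp).fderiv]
    refine injective_of_forall_eq_zero fun v hv => ?_
    have e1 : reflectOne (fderiv ℝ α (ν p) (ν v)) = reflectOne 0 := hv.trans (map_zero reflectOneCLM).symm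
    have e2 : ν v = 0 := hE.immersion _ (hm p hp) ((hinj _ _ e1).trans (map_zero _).symm)
    exact Prod.ext (by simpa [hνp] using congrArg Prod.fst e2) (by simpa [hνp] using congrArg Prod.snd e2)
  · have hp := core_mem_disc hR t
    have h1 : orientation (fun p => reflectOne (α (-p.1, p.2))) (t, 0) = orientation α (-t, 0) := by
      unfold orientation
      rw [(hd _ hp).fderiv]
      have e1 : (reflectOneCLM.comp ((fderiv ℝ α (ν (t, 0))).comp ν)) (1, 0)
          = -reflectOne (fderiv ℝ α (-t, 0) (1, 0)) := by
        have : ν (1, 0) = -(1, 0) := by simp [hνp]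
        rw [ContinuousLinearMap.comp_apply, ContinuousLinearMap.comp_apply, this, map_neg, map_neg,
          hνp]
        rfl
      have e2 : ∀ w, (reflectOneCLM.comp ((fderiv ℝ α (ν (t, 0))).comp ν)) (0, w)
          = reflectOne (fderiv ℝ α (-t, 0) (0, w)) := by
        intro w
        have : ν (0, w) = (0, w) := by simp [hνp]
        rw [ContinuousLinearMap.comp_apply, ContinuousLinearMap.comp_apply, this, hνp]
        rfl
      rw [e1, e2, e2]
      simp [Matrix.det_succ_row_zero, Fin.sum_univ_succ, Fin.succAbove, reflectOne]
      ring
    rw [h1]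
    exact h.orientation_pos _
  · obtain ⟨f, hf, hfd⟩ := h.framing
    refine ⟨fun x => f (reflectOne x), ?_, fun δ hδ => ?_⟩
    · refine ContinuousOn.comp hf contDiff_reflectOne.continuous.continuousOn fun x hx =>
        ⟨reflectOne_mem hx.1, ?_⟩
      rintro ⟨t, ht⟩
      refine hx.2 ⟨-t, ?_⟩
      beta_reduce at ht ⊢
      rw [neg_neg, ht, reflectOne_reflectOne]
    · obtain ⟨d1, d2⟩ := hfd δ hδ
      simp only [reflectOne_reflectOne, neg_zero]
      exact ⟨d1, d2.comp_neg⟩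

noncomputable def reflectThree (x : R4) : R4 := !₂[x 0, x 1, x 2, -x 3]

theorem Isotopic.mirrorReverse {K K' : ℝ → R4} (h : Isotopic K K') :
    Isotopic (mirrorReverse K) (mirrorReverse K') := by
  obtain ⟨H, G, hHG, h0, h1⟩ := h
  have hrr : ∀ x, reflectThree (reflectThree x) = x := fun x => by
    ext i; fin_cases i <;> simp [reflectThree]
  have hmem : ∀ x ∈ S3, reflectThree x ∈ S3 := fun x hx => by
    have h : ‖x‖ = 1 := by simpa using hx
    have h2 : ‖reflectThree x‖ = 1 := by
      rw [EuclideanSpace.norm_eq] at h ⊢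
      simpa [Fin.sum_univ_four, reflectThree] using h
    simpa using h2
  have hs : ContDiff ℝ ∞ reflectThree := by
    rw [contDiff_euclidean]
    intro i
    fin_cases i <;> simp [reflectThree] <;> fun_prop
  have hmr : ∀ (k : ℝ → R4) t, _root_.mirrorReverse k t = reflectThree (k (-t)) := fun k t => rfl
  refine ⟨fun q => reflectThree (H (q.1, reflectThree q.2)),
    fun q => reflectThree (G (q.1, reflectThree q.2)), fun s hsI x hx => ?_, fun x hx => ?_, fun t => ?_⟩
  · obtain ⟨a1, a2, a3, a4, a5, a6⟩ := hHG s hsI _ (hmem x hx)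
    have hf : ContDiffAt ℝ ∞ (fun q : ℝ × R4 => (q.1, reflectThree q.2)) (s, x) := by
      exact contDiffAt_fst.prodMk (hs.contDiffAt.comp (s, x) contDiffAt_snd)
    refine ⟨hs.contDiffAt.comp (s, x) (ContDiffAt.comp (s, x) (g := H) a1 hf),
      hs.contDiffAt.comp (s, x) (ContDiffAt.comp (s, x) (g := G) a2 hf), hmem _ a3, hmem _ a4, ?_, ?_⟩
    · simp only [hrr, a5]
    · simp only [hrr, a6]
  · simp only [h0 _ (hmem x hx), hrr]
  · simp only [hmr, hrr, h1]

/-- The mirror image of a knot does not depend on the hyperplane of reflection. -/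
theorem isotopic_mirrorReverse (K : ℝ → R4) :
    Isotopic (mirrorReverse K) fun t => reflectOne (K (-t)) := by
  -- Rotation by `πs` in the plane of the second and fourth coordinates. At `s = 1` it negates both,
  -- exchanging the reflection in one for the reflection in the other.
  set rot : ℝ × R4 → R4 := fun q => !₂[q.2 0,
    Real.cos (Real.pi * q.1) * q.2 1 - Real.sin (Real.pi * q.1) * q.2 3, q.2 2,
    Real.sin (Real.pi * q.1) * q.2 1 + Real.cos (Real.pi * q.1) * q.2 3] with hrot
  have hs : ContDiff ℝ ∞ rot := by
    rw [contDiff_euclidean]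
    intro i
    have h : ∀ j, ContDiff ℝ ∞ fun q : ℝ × R4 => q.2 j := fun j => by fun_prop
    have hc : ContDiff ℝ ∞ fun q : ℝ × R4 => Real.cos (Real.pi * q.1) := by fun_prop
    have hn : ContDiff ℝ ∞ fun q : ℝ × R4 => Real.sin (Real.pi * q.1) := by fun_prop
    fin_cases i <;> simp [hrot]
    · exact h 0
    · exact (hc.mul (h 1)).sub (hn.mul (h 3))
    · exact h 2
    · exact (hn.mul (h 1)).add (hc.mul (h 3))
  have hmem : ∀ s, ∀ x ∈ S3, rot (s, x) ∈ S3 := fun s x hx => by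
    have h : ‖x‖ = 1 := by simpa using hx
    have h2 : ‖rot (s, x)‖ = 1 := by
      rw [EuclideanSpace.norm_eq, Real.sqrt_eq_one] at h ⊢
      simp only [Fin.sum_univ_four, Real.norm_eq_abs, sq_abs] at h ⊢
      simp [hrot]
      linear_combination h + (x 1 ^ 2 + x 3 ^ 2) * Real.sin_sq_add_cos_sq (Real.pi * s)
    simpa using h2
  have hinv : ∀ s x, rot (-s, rot (s, x)) = x := fun s x => by
    have h := Real.sin_sq_add_cos_sq (Real.pi * s)
    ext i
    fin_cases i <;> simp [hrot]
    · linear_combination (x 1) * h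
    · linear_combination (x 3) * h
  refine ⟨rot, fun q => rot (-q.1, q.2), fun s _ x hx => ⟨hs.contDiffAt, ?_, hmem s x hx,
    hmem (-s) x hx, hinv s x, ?_⟩, fun x _ => ?_, fun t => ?_⟩
  · exact hs.contDiffAt.comp (s, x) (contDiffAt_fst.neg.prodMk contDiffAt_snd)
  · simpa using hinv (-s) x
  · ext i; fin_cases i <;> simp [hrot]
  · ext i; fin_cases i <;> simp [hrot, mirrorReverse, reflectOne]

/-! ### Germs of embeddings of the solid torus in itself -/

/-- The conditions concern the core only; `TorusGerm.exists_radius` recovers an embedding of some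
tube. -/
structure TorusGerm (φ : ℝ × ℂ → ℝ × ℂ) : Prop where
  smooth : ∀ t, ∀ᶠ p in 𝓝 (t, (0 : ℂ)), ContDiffAt ℝ ∞ φ p
  equivariant : ∀ t w, φ (t + 1, w) = φ (t, w) + (1, 0)
  core_injective : ∀ t t', ∀ k : ℤ, φ (t', 0) = φ (t, 0) + ((k : ℝ), 0) → ∃ n : ℤ, t' = t + n
  immersion : ∀ t, Function.Injective (fderiv ℝ φ (t, 0))

/-- Two germs that give the same satellites, up to concordance, with every companion. -/
def GermIsotopic (φ φ' : ℝ × ℂ → ℝ × ℂ) : Prop :=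
  ∀ ψ : ℝ × ℂ → R4, EmbOn (disc 2) ψ → ∀ P, TorusCurve P → ∃ δ₀ > 0, ∀ δ ∈ Ioc 0 δ₀,
    CollaredConcordant (fun t => ψ (φ (shrink δ (P t)))) fun t => ψ (φ' (shrink δ (P t)))

theorem GermIsotopic.trans {φ φ' φ'' : ℝ × ℂ → ℝ × ℂ} (h : GermIsotopic φ φ')
    (h' : GermIsotopic φ' φ'') : GermIsotopic φ φ'' := by
  intro ψ hψ P hP
  obtain ⟨d, hd, H⟩ := h ψ hψ P hP
  obtain ⟨d', hd', H'⟩ := h' ψ hψ P hP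
  exact ⟨min d d', lt_min hd hd', fun δ hδ => (H δ ⟨hδ.1, hδ.2.trans (min_le_left _ _)⟩).trans
    (H' δ ⟨hδ.1, hδ.2.trans (min_le_right _ _)⟩)⟩

theorem TorusFamily.germIsotopic {F : (ℝ × ℂ) × ℝ → ℝ × ℂ} (hF : TorusFamily F)
    (hcore : ∀ t, ∀ s ∈ Icc (0 : ℝ) 1, ‖(F ((t, 0), s)).2‖ ≤ 1) :
    GermIsotopic (fun p => F (p, 0)) fun p => F (p, 1) := fun _ hψ _ hP =>
  hψ.exists_collaredConcordant_family hF
    (fun t s hs => (hcore t s hs).trans_lt (by norm_num)) hP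

theorem TorusFamily.germ {F : (ℝ × ℂ) × ℝ → ℝ × ℂ} (hF : TorusFamily F) {s : ℝ}
    (hs : s ∈ Icc (0 : ℝ) 1) : TorusGerm fun p => F (p, s) where
  smooth t := by
    have h : ContinuousAt (fun p : ℝ × ℂ => (p, s)) (t, 0) := by fun_prop
    filter_upwards [h.eventually (hF.smooth t s hs)] with p hp using hp.comp_prodMk_left
  equivariant t w := hF.equivariant t w s
  core_injective t t' k h := hF.core_injective s hs t t' k h
  immersion t := hF.immersion t s hs

theorem TorusGerm.contDiffAt {φ : ℝ × ℂ → ℝ × ℂ} (h : TorusGerm φ) (t : ℝ) :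
    ContDiffAt ℝ ∞ φ (t, 0) := (h.smooth t).self_of_nhds

/-- For reparametrising the source of a germ. As `φ` is controlled only near its core, the family
has to map the core to itself. -/
theorem TorusGerm.comp_family {φ : ℝ × ℂ → ℝ × ℂ} (hφ : TorusGerm φ)
    {F : (ℝ × ℂ) × ℝ → ℝ × ℂ} (hF : TorusFamily F) (hc : ∀ t s, (F ((t, 0), s)).2 = 0) :
    TorusFamily fun q => φ (F q) where
  smooth t s hs := by
    have h1 := (hF.smooth t s hs).self_of_nhds.continuousAt
    have h2 : F ((t, 0), s) = ((F ((t, 0), s)).1, 0) := Prod.ext rfl (hc t s)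
    have h3 := hφ.smooth (F ((t, 0), s)).1
    rw [← h2] at h3
    filter_upwards [hF.smooth t s hs, h1.eventually h3] with q hq hq'
    exact ContDiffAt.comp q (g := φ) hq' hq
  equivariant t w s := by
    rw [hF.equivariant]
    exact hφ.equivariant (F ((t, w), s)).1 (F ((t, w), s)).2 ▸ by
      congr 1; ext <;> simp
  core_injective s hs t t' k h := by
    have h2 : ∀ t, F ((t, 0), s) = ((F ((t, 0), s)).1, 0) := fun t => Prod.ext rfl (hc t s)
    rw [h2 t, h2 t'] at h
    obtain ⟨n, hn⟩ := hφ.core_injective _ _ k h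
    refine hF.core_injective s hs t t' n ?_
    rw [h2 t, h2 t', hn]; simp
  immersion t s hs := by
    have h2 : F ((t, 0), s) = ((F ((t, 0), s)).1, 0) := Prod.ext rfl (hc t s)
    refine injective_fderiv_comp (g := φ) (f := fun p => F (p, s)) ?_
      ((hF.germ hs).contDiffAt t |>.differentiableAt (by simp)) ?_ (hF.immersion t s hs)
    · rw [h2]; exact (hφ.contDiffAt _).differentiableAt (by simp)
    · rw [h2]; exact hφ.immersion _

/-- Injectivity modulo deck translations becomes plain periodicity after composing with `stdTorus`.
Then `exists_embedded_neighbourhood` applies, with a parameter interval reduced to a point. -/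
theorem TorusGerm.exists_radius {φ : ℝ × ℂ → ℝ × ℂ} (hφ : TorusGerm φ) :
    ∃ r > 0, ∀ p ∈ disc r, ContDiffAt ℝ ∞ φ p ∧ Function.Injective (fderiv ℝ φ p) ∧
      ∀ q ∈ disc r, ∀ k : ℤ, φ q = φ p + ((k : ℝ), 0) → ∃ n : ℤ, q = p + ((n : ℝ), 0) := by
  have hstd := embOn_stdTorus
  have heq : ∀ t w, stdTorus (φ (t + 1, w)) = stdTorus (φ (t, w)) := fun t w => by
    rw [hφ.equivariant]
    simpa using periodic_int hstd.periodic 1 (φ (t, w))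
  have hsm : ∀ p, ContDiffAt ℝ ∞ φ p → ContDiffAt ℝ ∞ (fun p => stdTorus (φ p)) p := fun p hp =>
    ContDiffAt.comp p (g := stdTorus) contDiff_stdTorus.contDiffAt hp
  obtain ⟨r₁, hr₁, hA, hB⟩ := exists_embedded_neighbourhood
    (Φ := fun q : (ℝ × ℂ) × ℝ => (stdTorus (φ q.1), q.2)) (a := 0) (b := 0)
    (fun t w s => by simp only [heq])
    (fun t s _ => by
      have h : ContinuousAt (fun q : (ℝ × ℂ) × ℝ => q.1) ((t, 0), s) := by fun_prop
      filter_upwards [h.eventually (hφ.smooth t)] with q hq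
      exact (ContDiffAt.comp q (g := fun p => stdTorus (φ p)) (hsm _ hq) contDiffAt_fst).prodMk
        contDiffAt_snd)
    (fun t t' s _ s' _ h => by
      obtain ⟨h1, h2⟩ := Prod.ext_iff.1 h
      obtain ⟨k, hk⟩ := hstd.injective _ (mem_univ _) _ (mem_univ _) h1
      exact ⟨h2, hφ.core_injective _ _ k hk⟩)
    (fun t s _ => injective_fderiv_level (G := fun q : (ℝ × ℂ) × ℝ => stdTorus (φ q.1))
      ((ContDiffAt.comp ((t, (0 : ℂ)), s) (g := fun p => stdTorus (φ p)) (hsm _ (hφ.contDiffAt t))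
        contDiffAt_fst).differentiableAt (by simp))
      (injective_fderiv_comp (g := stdTorus) (contDiff_stdTorus.differentiable (by simp) _)
        ((hφ.contDiffAt t).differentiableAt (by simp)) (hstd.immersion _ (mem_univ _))
        (hφ.immersion t)))
  obtain ⟨r₂, hr₂, hC⟩ := eventually_core_uniform (a := 0) (b := 0)
    (p := fun q => ContDiffAt ℝ ∞ φ q.1)
    (fun t w s => by
      have h : φ = fun p => φ (p + (1, 0)) - (1, 0) := by
        funext p
        have := hφ.equivariant p.1 p.2
        rw [show p + (1, 0) = (p.1 + 1, p.2) by ext <;> simp, this]; simp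
      constructor
      · intro h1
        rw [h]
        refine ContDiffAt.sub ?_ contDiffAt_const
        refine ContDiffAt.comp (t, w) (g := φ) (f := fun p : ℝ × ℂ => p + (1, 0)) ?_ (by fun_prop)
        simpa using h1
      · intro h1
        have h' : φ = fun p => φ (p - (1, 0)) + (1, 0) := by
          funext p
          have := hφ.equivariant (p.1 - 1) p.2
          rw [show p - (1, 0) = (p.1 - 1, p.2) by ext <;> simp, ← this]; simp
        rw [h']
        refine ContDiffAt.add ?_ contDiffAt_const
        refine ContDiffAt.comp (t + 1, w) (g := φ) (f := fun p : ℝ × ℂ => p - (1, 0)) ?_ (by fun_prop)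
        simpa using h1)
    (fun t s _ => by
      have h : ContinuousAt (fun q : (ℝ × ℂ) × ℝ => q.1) ((t, 0), s) := by fun_prop
      exact h.eventually (hφ.smooth t))
  have i0 : (0 : ℝ) ∈ Icc (0 : ℝ) 0 := by simp
  refine ⟨min r₁ r₂, lt_min hr₁ hr₂, fun p hp => ?_⟩
  have hp1 := disc_mono (min_le_left _ _) hp
  have hp2 := hC p (disc_mono (min_le_right _ _) hp) 0 i0
  refine ⟨hp2, ?_, fun q hq k h => ?_⟩
  · have h1 := (hA p hp1 0 i0).2
    refine injective_of_forall_eq_zero fun v hv => ?_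
    have h20 : HasFDerivAt (fun p => stdTorus (φ p)) _ p :=
      HasFDerivAt.comp p (g := stdTorus) (contDiff_stdTorus.differentiable (by simp) _).hasFDerivAt
        (hp2.differentiableAt (by simp)).hasFDerivAt
    have h2 : HasFDerivAt (fun q : (ℝ × ℂ) × ℝ => (stdTorus (φ q.1), q.2)) _ (p, 0) :=
      (HasFDerivAt.comp (p, (0 : ℝ)) (f := fun q : (ℝ × ℂ) × ℝ => q.1)
        (g := fun p => stdTorus (φ p)) h20 hasFDerivAt_fst).prodMk hasFDerivAt_snd
    rw [h2.fderiv] at h1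
    have h3 : (v, (0 : ℝ)) = 0 := h1 (by simp [hv])
    exact congrArg Prod.fst h3
  · refine (hB p hp1 0 i0 q (disc_mono (min_le_left _ _) hq) 0 i0 ?_).2
    rw [h, periodic_int hstd.periodic]

/-! ### Cut-off functions on the circle -/

/-- A smooth step applied to `cos (2πt)`, rising between the values `cos (2πε)` and `cos (πε)`;
periodicity is then automatic. -/
theorem exists_periodic_cutoff {ε : ℝ} (hε : 0 < ε) (hε2 : ε < 1 / 2) :
    ∃ χ : ℝ → ℝ, ContDiff ℝ ∞ χ ∧ (∀ t, χ (t + 1) = χ t) ∧ (∀ t, χ t ∈ Icc (0 : ℝ) 1) ∧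
      (∀ t, |t| ≤ ε / 2 → χ t = 1) ∧ ∀ t, χ t ≠ 0 → |t - round t| < ε := by
  have hpi := Real.pi_pos
  set c₁ := Real.cos (2 * Real.pi * ε) with hc₁
  set c₂ := Real.cos (2 * Real.pi * (ε / 2)) with hc₂
  have hc : c₁ < c₂ := Real.cos_lt_cos_of_nonneg_of_le_pi (by positivity) (by nlinarith) (by nlinarith)
  refine ⟨fun t => Real.smoothTransition ((Real.cos (2 * Real.pi * t) - c₁) / (c₂ - c₁)), ?_,
    fun t => ?_, fun t => ⟨Real.smoothTransition.nonneg _, Real.smoothTransition.le_one _⟩,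
    fun t ht => ?_, fun t ht => ?_⟩
  · exact Real.smoothTransition.contDiff.comp (by fun_prop)
  · have h1 : 2 * Real.pi * (t + 1) = 2 * Real.pi * t + 2 * Real.pi := by ring
    simp only [h1, Real.cos_add_two_pi]
  · refine Real.smoothTransition.one_of_one_le ((one_le_div (by linarith)).2 ?_)
    have h1 : c₂ ≤ Real.cos |2 * Real.pi * t| := by
      refine Real.cos_le_cos_of_nonneg_of_le_pi (abs_nonneg _) (by nlinarith) ?_
      rw [abs_mul, abs_of_pos (by positivity : 0 < 2 * Real.pi)]
      exact mul_le_mul_of_nonneg_left ht (by positivity)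
    rw [Real.cos_abs] at h1
    linarith
  · by_contra hge
    refine ht (Real.smoothTransition.zero_of_nonpos (div_nonpos_of_nonpos_of_nonneg ?_ (by linarith)))
    have h1 : Real.cos (2 * Real.pi * t) = Real.cos |2 * Real.pi * (t - round t)| := by
      rw [Real.cos_abs, show 2 * Real.pi * (t - round t) = 2 * Real.pi * t - (round t : ℤ) * (2 * Real.pi)
        by ring, Real.cos_sub_int_mul_two_pi]
    rw [h1, sub_nonpos]
    have h2 := abs_sub_round t
    rw [abs_mul, abs_of_pos (by positivity : 0 < 2 * Real.pi)]
    exact Real.cos_le_cos_of_nonneg_of_le_pi (by positivity) (by nlinarith)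
      (mul_le_mul_of_nonneg_left (not_lt.1 hge) (by positivity))

/-- A smooth staircase. -/
theorem exists_staircase {ε : ℝ} (hε : 0 < ε) (hε2 : ε < 1 / 2) :
    ∃ S : ℝ → ℝ, ContDiff ℝ ∞ S ∧ (∀ t, S (t + 1) = S t + 1) ∧ (∀ t, 0 ≤ deriv S t) ∧
      ∀ t ∈ Icc ε (1 - ε), S t = 0 := by
  obtain ⟨χ, hχ, hχp, hχI, hχ1, hχ0⟩ := exists_periodic_cutoff hε hε2
  have hint : ∀ a b, IntervalIntegrable χ MeasureTheory.volume a b := fun a b =>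
    hχ.continuous.intervalIntegrable a b
  set I := ∫ x in (0 : ℝ)..1, χ x with hI
  have hIpos : 0 < I := by
    refine intervalIntegral.integral_pos zero_lt_one hχ.continuous.continuousOn
      (fun x _ => (hχI x).1) ⟨0, by simp, ?_⟩
    rw [hχ1 0 (by rw [abs_zero]; positivity)]; norm_num
  -- The normalised primitive of a bump around the integers; starting the integral at `1 / 2` gives
  -- the flat step there the height zero.
  set S : ℝ → ℝ := fun t => I⁻¹ * ∫ x in (1 / 2 : ℝ)..t, χ x with hS
  have hSd : ∀ t, HasDerivAt S (I⁻¹ * χ t) t := fun t =>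
    ((hχ.continuous.integral_hasStrictDerivAt _ t).hasDerivAt).const_mul _
  have hSd' : deriv S = fun t => I⁻¹ * χ t := funext fun t => (hSd t).deriv
  refine ⟨S, ?_, fun t => ?_, fun t => ?_, fun t ht => ?_⟩
  · rw [contDiff_infty_iff_deriv]
    refine ⟨fun t => (hSd t).differentiableAt, ?_⟩
    rw [hSd']
    exact contDiff_const.mul hχ
  · simp only [hS]
    have h1 := Function.Periodic.intervalIntegral_add_eq (f := χ) (T := 1) hχp t 0
    rw [zero_add] at h1
    rw [← intervalIntegral.integral_add_adjacent_intervals (hint (1 / 2) t) (hint t (t + 1)), h1,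
      mul_add, ← hI, inv_mul_cancel₀ hIpos.ne']
  · rw [hSd']
    exact mul_nonneg (inv_nonneg.2 hIpos.le) (hχI t).1
  · have h2 : ∀ x ∈ Icc ε (1 - ε), χ x = 0 := by
      intro x hx
      by_contra h
      have h3 := hχ0 x h
      have h4 := round_le x 0
      have h5 := round_le x 1
      rw [abs_lt] at h3
      rcases le_or_gt (round x) 0 with h6 | h6
      · have : (round x : ℝ) ≤ 0 := by exact_mod_cast h6
        linarith [hx.1]
      · have : (1 : ℝ) ≤ round x := by exact_mod_cast h6
        linarith [hx.2]
    have h7 : ∫ x in (1 / 2 : ℝ)..t, χ x = ∫ x in (1 / 2 : ℝ)..t, (0 : ℝ) := by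
      refine intervalIntegral.integral_congr fun x hx => ?_
      refine h2 x ?_
      rw [uIcc_eq_union] at hx
      rcases hx with hx | hx
      · exact ⟨by linarith [hx.1], by linarith [hx.2, ht.2]⟩
      · exact ⟨by linarith [hx.1, ht.1], by linarith [hx.2]⟩
    simp only [hS, h7]
    simp

/-! ### Normal form of a locally knotted tube -/

open scoped ComplexConjugate in
/-- The normal derivative at a point of the core can be deformed to the identity. -/
theorem TorusGerm.exists_normalised {φ : ℝ × ℂ → ℝ × ℂ} (hφ : TorusGerm φ) {a b : ℂ}
    (hab : ‖b‖ < ‖a‖) (h : ∀ w, (fderiv ℝ φ (0, 0) (0, w)).2 = a * w + b * conj w)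
    (hc : ∀ t, ‖(φ (t, 0)).2‖ ≤ 1) :
    ∃ φ' : ℝ × ℂ → ℝ × ℂ, TorusGerm φ' ∧ GermIsotopic φ φ' ∧ (∀ t, φ' (t, 0) = φ (t, 0)) ∧
      ∀ w, (fderiv ℝ φ' (0, 0) (0, w)).2 = w := by
  have ha : a ≠ 0 := norm_pos_iff.1 ((norm_nonneg _).trans_lt hab)
  have ha' : conj a ≠ 0 := by simpa using ha
  have hN : a * conj a - b * conj b ≠ 0 := by
    rw [Complex.mul_conj, Complex.mul_conj, ← Complex.ofReal_sub, Complex.normSq_eq_norm_sq,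
      Complex.normSq_eq_norm_sq]
    have : 0 < ‖a‖ ^ 2 - ‖b‖ ^ 2 := by nlinarith [norm_nonneg b]
    exact_mod_cast this.ne'
  -- The map `z ↦ A * (z + B * conj z)` is the inverse of `w ↦ a * w + b * conj w`. Since `‖B‖ < 1`,
  -- scaling `B` and a logarithm of `A` joins it to the identity; precomposition with this path
  -- normalises the derivative at `t = 0`.
  set A : ℂ := conj a / (a * conj a - b * conj b) with hA
  have hA0 : A ≠ 0 := div_ne_zero ha' hN
  set B : ℂ := -b / conj a with hB
  have hB1 : ‖B‖ < 1 := by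
    rw [hB, norm_div, norm_neg, Complex.norm_conj, div_lt_one (norm_pos_iff.2 ha)]
    exact hab
  set F : (ℝ × ℂ) × ℝ → ℝ × ℂ := fun q => (q.1.1, Complex.exp (q.2 * Complex.log A) *
    (q.1.2 + q.2 * B * conj q.1.2)) with hF
  have hFf : TorusFamily F := by
    refine torusFamily_linear (A := fun p => Complex.exp (p.2 * Complex.log A))
      (B := fun p => p.2 * B) ?_ ?_ (fun _ _ _ => Complex.exp_ne_zero _) (fun t s hs => ?_)
      (fun _ _ => rfl) fun _ _ => rfl
    · exact ((Complex.ofRealCLM.contDiff.comp contDiff_snd).mul contDiff_const).cexp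
    · exact (Complex.ofRealCLM.contDiff.comp contDiff_snd).mul contDiff_const
    · rw [norm_mul, Complex.norm_real, Real.norm_of_nonneg hs.1]
      nlinarith [norm_nonneg B, hs.1, hs.2]
  have hF0 : ∀ t s, F ((t, 0), s) = (t, 0) := fun t s => by simp [hF]
  have hG := hφ.comp_family hFf fun t s => by rw [hF0]
  have h1 : ∀ p, F (p, 0) = p := fun p => by simp [hF]
  have h2 : ∀ p, F (p, 1) = (p.1, A * (p.2 + B * conj p.2)) := fun p => by
    simp [hF, Complex.exp_log hA0]
  refine ⟨fun p => φ (F (p, 1)), hG.germ (right_mem_Icc.2 zero_le_one), ?_,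
    fun t => by simp only [hF0], fun w => ?_⟩
  · simpa only [h1] using hG.germIsotopic fun t s _ => by rw [hF0]; exact hc t
  · have h3 := hasFDerivAt_linear_fibre (A := fun _ => A) (B := fun _ => B) (t := 0)
      (differentiableAt_const _) (differentiableAt_const _)
    have h4 : HasFDerivAt φ (fderiv ℝ φ (0, 0)) (F ((0, 0), 1)) := by
      rw [hF0]; exact ((hφ.contDiffAt 0).differentiableAt (by simp)).hasFDerivAt
    simp only [h2] at h4 ⊢
    have h5 := HasFDerivAt.comp (g := φ) ((0 : ℝ), (0 : ℂ)) h4 h3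
    have h6 : fderiv ℝ (fun p : ℝ × ℂ => φ (p.1, A * (p.2 + B * conj p.2))) (0, 0) = _ := h5.fderiv
    rw [h6]
    simp only [ContinuousLinearMap.comp_apply, ContinuousLinearMap.prod_apply]
    simp
    have h7 := h (A * (w + B * conj w))
    rw [mul_add] at h7
    rw [h7]
    simp only [hA, hB, map_add, map_mul, map_div₀, map_sub, map_neg, Complex.conj_conj]
    field_simp
    ring

/-- A germ whose core is standard near a meridian disc, and whose normal derivative there is the
identity, can be deformed to one that is standard near that disc. -/
theorem TorusGerm.exists_eq_id_near {φ : ℝ × ℂ → ℝ × ℂ} (hφ : TorusGerm φ) {ε : ℝ} (hε : 0 < ε)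
    (hstd : ∀ t, |t| ≤ ε → φ (t, 0) = (t, 0)) (hnd : ∀ w, (fderiv ℝ φ (0, 0) (0, w)).2 = w)
    (hc : ∀ t, ‖(φ (t, 0)).2‖ ≤ 1) :
    ∃ φ' : ℝ × ℂ → ℝ × ℂ, TorusGerm φ' ∧ GermIsotopic φ φ' ∧ (∀ t, φ' (t, 0) = φ (t, 0)) ∧
      ∃ ε' > 0, ∀ t w, |t| ≤ ε' → φ' (t, w) = (t, w) := by
  set D : ℝ → ℝ × ℂ →L[ℝ] ℝ × ℂ := fun t => fderiv ℝ φ (t, 0) with hD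
  have hφd : ∀ t : ℝ, HasFDerivAt φ (D t) (t, 0) := fun t =>
    ((hφ.contDiffAt t).differentiableAt (by simp)).hasFDerivAt
  have hDc : Continuous D := by
    rw [continuous_iff_continuousAt]
    intro t
    have h1 : ContinuousAt (fderiv ℝ φ) (t, 0) :=
      ((hφ.contDiffAt t).fderiv_right (m := 0) (by simp)).continuousAt
    exact ContinuousAt.comp (f := fun t : ℝ => (t, (0 : ℂ))) h1 (by fun_prop)
  have hDp : ∀ t, D (t + 1) = D t := fun t => fderiv_equivariant hφ.equivariant t 0
  set N : ℝ → ℂ →L[ℝ] ℂ := fun t => (ContinuousLinearMap.snd ℝ ℝ ℂ).comp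
    ((D t).comp (ContinuousLinearMap.inr ℝ ℝ ℂ)) - ContinuousLinearMap.id ℝ ℂ with hN
  have hNc : Continuous N := by fun_prop
  have hN0 : N 0 = 0 := by
    ext1
    simp [hN, hD, hnd]
  -- Where the normal derivative is within `1 / 2` of the identity, its convex combinations with the
  -- identity are injective; the cut-off is supported there.
  obtain ⟨ε₁, hε₁, hNε⟩ := Metric.continuousAt_iff.1 (hNc.continuousAt (x := 0)) (1 / 2) (by norm_num)
  set ε₂ := min (min ε ε₁) (1 / 4) with hε₂
  have hε₂0 : 0 < ε₂ := by positivity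
  have hε₂ε : ε₂ ≤ ε := (min_le_left _ _).trans (min_le_left _ _)
  have hε₂ε₁ : ε₂ ≤ ε₁ := (min_le_left _ _).trans (min_le_right _ _)
  obtain ⟨χ, hχ, hχp, hχI, hχ1, hχ0⟩ := exists_periodic_cutoff hε₂0
    ((min_le_right _ _).trans_lt (by norm_num))
  have hcore : ∀ t, χ t ≠ 0 → φ (t, 0) = (t, 0) := by
    intro t ht
    have h1 := hstd _ ((hχ0 t ht).le.trans hε₂ε)
    have h2 := equivariant_int hφ.equivariant (round t) (t - round t, 0)
    rw [h1] at h2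
    have h3 : ((t - round t, 0) : ℝ × ℂ) + ((round t : ℝ), 0) = (t, 0) := by ext <;> simp
    rwa [h3] at h2
  have hlocal : ∀ t, χ t ≠ 0 → D t (1, 0) = (1, 0) ∧ ‖N t‖ < 1 / 2 := by
    intro t ht
    have h1 := hχ0 t ht
    have h2 : D (t - round t) = D t := by
      have := Function.Periodic.sub_int_mul_eq (f := D) (c := 1) hDp (round t) (x := t)
      simpa using this
    have h3 : N (t - round t) = N t := by simp only [hN, h2]
    constructor
    · have h4 : HasDerivAt (fun t : ℝ => (t, (0 : ℂ))) ((1 : ℝ), (0 : ℂ)) (t - round t) :=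
        (hasDerivAt_id _).prodMk (hasDerivAt_const _ _)
      have h5 := (hφd (t - round t)).comp_hasDerivAt _ h4
      have h6 : (φ ∘ fun t : ℝ => (t, (0 : ℂ))) =ᶠ[𝓝 (t - round t)] fun t : ℝ => (t, (0 : ℂ)) := by
        have h7 : ∀ᶠ x in 𝓝 (t - round t), |x| < ε :=
          continuous_abs.continuousAt.eventually (Iio_mem_nhds (h1.trans_le hε₂ε))
        filter_upwards [h7] with x hx using hstd x hx.le
      rw [← h2]
      exact (h5.congr_of_eventuallyEq h6.symm).unique h4
    · have h4 := hNε (x := t - round t) (by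
        rw [Real.dist_eq, sub_zero]; exact h1.trans_le hε₂ε₁)
      rwa [hN0, dist_zero_right, h3] at h4
  -- The derivative of the cut-off multiplies `(t, 0) - φ (t, 0)`. This vanishes where `χ ≠ 0`,
  -- since the core is standard there; where `χ = 0`, the cut-off has a minimum and its derivative
  -- vanishes.
  have hχd : ∀ t, deriv χ t = 0 ∨ χ t ≠ 0 := by
    intro t
    by_cases h : χ t = 0
    · refine Or.inl (IsLocalMin.deriv_eq_zero (Eventually.of_forall fun x => ?_))
      rw [h]; exact (hχI x).1
    · exact Or.inr h
  set F : (ℝ × ℂ) × ℝ → ℝ × ℂ := fun q => (1 - q.2 * χ q.1.1) • φ q.1 + (q.2 * χ q.1.1) • q.1 with hF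
  have hF0 : ∀ t s, F ((t, 0), s) = φ (t, 0) := by
    intro t s
    simp only [hF]
    by_cases h : χ t = 0
    · simp [h]
    · rw [hcore t h, ← add_smul]; simp
  have hFf : TorusFamily F := by
    refine ⟨fun t s _ => ?_, fun t w s => ?_, fun s _ t t' k h => ?_, fun t s hs => ?_⟩
    · have h : ContinuousAt (fun q : (ℝ × ℂ) × ℝ => q.1) ((t, 0), s) := by fun_prop
      have hc : ContDiff ℝ ∞ fun q : (ℝ × ℂ) × ℝ => q.2 * χ q.1.1 :=
        contDiff_snd.mul (hχ.comp (contDiff_fst.comp contDiff_fst))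
      filter_upwards [h.eventually (hφ.smooth t)] with q hq
      exact ((contDiff_const.sub hc).contDiffAt.smul
        (ContDiffAt.comp q (g := φ) hq contDiffAt_fst)).add (hc.contDiffAt.smul contDiffAt_fst)
    · simp only [hF, hφ.equivariant, hχp]
      ext
      · simp; ring
      · simp
    · rw [hF0, hF0] at h
      exact hφ.core_injective t t' k h
    · set c := s * χ t with hcd
      have hc01 : c ∈ Icc (0 : ℝ) 1 :=
        ⟨mul_nonneg hs.1 (hχI t).1, mul_le_one₀ hs.2 (hχI t).1 (hχI t).2⟩
      have h1 : HasFDerivAt (fun p : ℝ × ℂ => s * χ p.1) _ (t, 0) :=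
        (HasFDerivAt.comp (g := χ) (t, (0 : ℂ))
          (hχ.differentiable (by simp) t).hasDerivAt.hasFDerivAt hasFDerivAt_fst).const_mul s
      have h2 : HasFDerivAt (fun p : ℝ × ℂ => F (p, s)) _ (t, 0) :=
        ((h1.const_sub 1).smul (hφd t)).add (h1.smul (hasFDerivAt_id _))
      rw [h2.fderiv]
      refine injective_of_forall_eq_zero fun v hv => ?_
      have h3 : (1 - c) • D t v + c • v + (s * (v.1 * deriv χ t)) • (((t, 0) : ℝ × ℂ) - φ (t, 0)) = 0 := by
        rw [← hv]
        ext <;> simp [hcd] <;> ring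
      have h4 : (s * (v.1 * deriv χ t)) • (((t, 0) : ℝ × ℂ) - φ (t, 0)) = 0 := by
        rcases hχd t with h | h
        · simp [h]
        · rw [hcore t h]; simp
      rw [h4, add_zero] at h3
      by_cases h : χ t = 0
      · refine hφ.immersion t ?_
        rw [map_zero]
        simpa [hcd, h] using h3
      · obtain ⟨h5, h6⟩ := hlocal t h
        have h7 : D t v = (v.1, 0) + D t (0, v.2) := by
          have h3 : v = v.1 • ((1 : ℝ), (0 : ℂ)) + (0, v.2) := by ext <;> simp
          conv_lhs => rw [h3]
          rw [map_add, map_smul, h5]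
          ext <;> simp
        have h8 : (D t (0, v.2)).2 = v.2 + N t v.2 := by simp [hN]
        have h9 := congrArg Prod.snd h3
        rw [h7] at h9
        simp only [Prod.snd_add, Prod.smul_snd, zero_add, Prod.snd_zero, h8] at h9
        have h10 : v.2 = -((1 - c) • N t v.2) := by
          refine eq_neg_of_add_eq_zero_left ?_
          rw [← h9]
          module
        have h11 : v.2 = 0 := by
          by_contra hne
          have h12 := norm_pos_iff.2 hne
          have h13 : ‖v.2‖ ≤ 1 / 2 * ‖v.2‖ := by
            conv_lhs => rw [h10]
            rw [norm_neg, norm_smul, Real.norm_of_nonneg (by linarith [hc01.2])]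
            have h14 := (N t).le_of_opNorm_le h6.le v.2
            have h15 := norm_nonneg (N t v.2)
            nlinarith [hc01.1]
          linarith
        have h16 : D t v = (v.1, 0) := by
          rw [h7, h11, show ((0 : ℝ), (0 : ℂ)) = 0 from rfl, map_zero, add_zero]
        have h17 := congrArg Prod.fst h3
        rw [h16] at h17
        simp only [Prod.fst_add, Prod.smul_fst, smul_eq_mul, Prod.fst_zero] at h17
        exact Prod.ext (show v.1 = 0 by linarith) h11
  have h0 : ∀ p, F (p, 0) = φ p := fun p => by simp [hF]
  refine ⟨fun p => F (p, 1), hFf.germ (right_mem_Icc.2 zero_le_one), ?_, fun t => hF0 t 1,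
    ε₂ / 2, by positivity, fun t w ht => ?_⟩
  · simpa only [h0] using hFf.germIsotopic fun t s _ => by rw [hF0]; exact hc t
  · simp [hF, hχ1 t ht]

/-- A germ of an embedding that is locally knotted in `(0, 1/4)` and standard elsewhere. -/
structure KnottedGerm (a b : ℝ) (φ : ℝ × ℂ → ℝ × ℂ) : Prop where
  germ : TorusGerm φ
  pos : 0 < a
  le : a ≤ b
  lt : b < 1 / 4
  eq_id : ∀ t w, t ∈ Icc (b - 1) a → φ (t, w) = (t, w)
  arc : ∀ t ∈ Icc a b, (φ (t, 0)).1 ∈ Ioo 0 (1 / 4)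
  norm_core : ∀ t, ‖(φ (t, 0)).2‖ ≤ 1

/-- Conjugate by a diffeomorphism `g` of the circle that squeezes everything away from the meridian
disc into a short interval. The lift `g` and its inverse are increasing and commute with integer
translations, so convex combinations with the identity make both halves of the conjugation
isotopies. -/
theorem TorusGerm.exists_compressed {φ : ℝ × ℂ → ℝ × ℂ} (hφ : TorusGerm φ) {ε : ℝ} (hε : 0 < ε)
    (hid : ∀ t w, |t| ≤ ε → φ (t, w) = (t, w))
    (harc : ∀ t ∈ Ioo (0 : ℝ) 1, (φ (t, 0)).1 ∈ Ioo (0 : ℝ) 1)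
    (hc : ∀ t, ‖(φ (t, 0)).2‖ ≤ 1) : ∃ a b φ', KnottedGerm a b φ' ∧ GermIsotopic φ φ' := by
  wlog hε4 : ε ≤ 1 / 4 generalizing ε
  · exact this (ε := 1 / 4) (by norm_num) (fun t w ht => hid t w (ht.trans (not_le.1 hε4).le)) le_rfl
  have hcont : Continuous fun t => (φ (t, 0)).1 := by
    rw [continuous_iff_continuousAt]
    intro t
    exact (ContinuousAt.comp (f := fun t : ℝ => (t, (0 : ℂ))) (hφ.contDiffAt t).continuousAt
      (by fun_prop)).fst
  have hne : (Icc ε (1 - ε)).Nonempty := ⟨1 / 2, by constructor <;> linarith⟩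
  obtain ⟨t₀, ht₀, hmin⟩ := isCompact_Icc.exists_isMinOn hne hcont.continuousOn
  obtain ⟨t₁, ht₁, hmax⟩ := isCompact_Icc.exists_isMaxOn hne hcont.continuousOn
  have h₀ := harc t₀ ⟨by linarith [ht₀.1], by linarith [ht₀.2]⟩
  have h₁ := harc t₁ ⟨by linarith [ht₁.1], by linarith [ht₁.2]⟩
  -- By compactness the knotted part of the core keeps the distance `η` from the meridian disc,
  -- measured along the circle.
  set η := min ε (min (φ (t₀, 0)).1 (1 - (φ (t₁, 0)).1)) with hη
  have hη0 : 0 < η := lt_min hε (lt_min h₀.1 (by linarith [h₁.2]))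
  have hηε : η ≤ ε := min_le_left _ _
  have harc' : ∀ t ∈ Icc ε (1 - ε), (φ (t, 0)).1 ∈ Icc η (1 - η) := by
    intro t ht
    have h2 : (φ (t₀, 0)).1 ≤ (φ (t, 0)).1 := hmin ht
    have h3 : (φ (t, 0)).1 ≤ (φ (t₁, 0)).1 := hmax ht
    have h4 : η ≤ (φ (t₀, 0)).1 := (min_le_right _ _).trans (min_le_left _ _)
    have h5 : η ≤ 1 - (φ (t₁, 0)).1 := (min_le_right _ _).trans (min_le_right _ _)
    constructor <;> linarith
  obtain ⟨S, hS, hS1, hSd, hS0⟩ := exists_staircase hη0 (hηε.trans_lt (by linarith))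
  -- Division by five on `Icc η (1 - η)`, as `1 / 5 < 1 / 4`; the staircase makes up the rest of the
  -- degree near the integers.
  set g : ℝ → ℝ := fun t => t / 5 + 4 / 5 * S t with hg
  have hgs : ContDiff ℝ ∞ g := (contDiff_id.div_const 5).add (contDiff_const.mul hS)
  have hgd : ∀ t, HasDerivAt g (1 / 5 + 4 / 5 * deriv S t) t := fun t =>
    ((hasDerivAt_id t).div_const 5).add ((hS.differentiable (by simp) t).hasDerivAt.const_mul _)
  have hgpos : ∀ t, 0 < 1 / 5 + 4 / 5 * deriv S t := fun t => by linarith [hSd t]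
  have hg1 : ∀ t, g (t + 1) = g t + 1 := fun t => by simp only [hg, hS1]; ring
  have hgm : StrictMono g := strictMono_of_deriv_pos fun t => by
    rw [(hgd t).deriv]; exact hgpos t
  have hg0 : ∀ t ∈ Icc η (1 - η), g t = t / 5 := fun t ht => by simp [hg, hS0 t ht]
  have hgk : ∀ (k : ℤ) t, g (t + k) = g t + k := by
    intro k t
    have h : Function.Periodic (fun t => g t - t) 1 := fun t => by simp only [hg1]; ring
    have := h.int_mul k t
    simp only [mul_one] at this
    linarith
  have hsurj : Function.Surjective g := by
    intro y
    have hk := hgk ⌊y - g 0⌋ 0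
    have hk' := hgk (⌊y - g 0⌋ + 1) 0
    rw [zero_add] at hk hk'
    push_cast at hk'
    obtain ⟨x, -, hx⟩ := intermediate_value_Icc (a := (⌊y - g 0⌋ : ℝ)) (b := ⌊y - g 0⌋ + 1)
      (by linarith) hgs.continuous.continuousOn
      (show y ∈ _ from ⟨by rw [hk]; linarith [Int.floor_le (y - g 0)],
        by rw [hk']; linarith [Int.lt_floor_add_one (y - g 0)]⟩)
    exact ⟨x, hx⟩
  set e := (hgm.orderIsoOfSurjective g hsurj).toHomeomorph with he
  have heg : ∀ t, e t = g t := fun t => rfl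
  set h : ℝ → ℝ := fun t => e.symm t with hh
  have hgh : ∀ t, g (h t) = t := fun t => e.apply_symm_apply t
  have hhg : ∀ t, h (g t) = t := fun t => e.symm_apply_apply t
  have hhs : ContDiff ℝ ∞ h := e.contDiff_symm_deriv (fun t => (hgpos t).ne') hgd hgs
  have hh1 : ∀ t, h (t + 1) = h t + 1 := fun t => hgm.injective (by rw [hgh, hg1, hgh])
  have hhm : StrictMono h := fun x y hxy => hgm.lt_iff_lt.1 (by rwa [hgh, hgh])
  have hhd : ∀ t, 0 < deriv h t := by
    intro t
    have h1 := (hgd (h t)).comp t (hhs.differentiable (by simp) t).hasDerivAt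
    have h2 : g ∘ h = id := funext hgh
    rw [h2] at h1
    have h3 := h1.unique (hasDerivAt_id t)
    exact pos_of_mul_pos_right (by rw [h3]; exact one_pos) (hgpos _).le
  have hgg : ∀ s ∈ Icc (0 : ℝ) 1, StrictMono fun x => (1 - s) * x + s * g x := by
    intro s hs
    refine strictMono_of_deriv_pos fun x => ?_
    have h1 : HasDerivAt (fun x => (1 - s) * x + s * g x) _ x :=
      ((hasDerivAt_id x).const_mul (1 - s)).add ((hgd x).const_mul s)
    rw [h1.deriv]
    have := hSd x
    nlinarith [hs.1, hs.2, mul_nonneg hs.1 this]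
  have hpost : TorusFamily fun q => ((1 - q.2) * (φ q.1).1 + q.2 * g (φ q.1).1, (φ q.1).2) := by
    refine ⟨fun t s _ => ?_, fun t w s => ?_, fun s hs t t' k h => ?_, fun t s hs => ?_⟩
    · have h1 : ContinuousAt (fun q : (ℝ × ℂ) × ℝ => q.1) ((t, 0), s) := by fun_prop
      filter_upwards [h1.eventually (hφ.smooth t)] with q hq
      have h2 : ContDiffAt ℝ ∞ (fun q : (ℝ × ℂ) × ℝ => φ q.1) q :=
        ContDiffAt.comp q (g := φ) hq contDiffAt_fst
      have h3 : ContDiffAt ℝ ∞ (fun q : (ℝ × ℂ) × ℝ => (φ q.1).1) q := h2.fst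
      exact (((contDiffAt_const.sub contDiffAt_snd).mul h3).add
        (contDiffAt_snd.mul (hgs.contDiffAt.comp q h3))).prodMk h2.snd
    · simp only [hφ.equivariant, Prod.fst_add, hg1, Prod.snd_add]
      ext
      · simp; ring
      · simp
    · obtain ⟨h1, h2⟩ := Prod.ext_iff.1 h
      refine hφ.core_injective t t' k (Prod.ext ((hgg s hs).injective ?_) (by simpa using h2))
      simp only [Prod.fst_add] at h1 ⊢
      rw [h1, hgk]; ring
    · set c : ℝ := 1 / 5 + 4 / 5 * deriv S (φ (t, 0)).1
      have hφd := ((hφ.contDiffAt t).differentiableAt (by simp)).hasFDerivAt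
      have h1 : HasFDerivAt (fun p : ℝ × ℂ => g (φ p).1) _ (t, 0) :=
        HasFDerivAt.comp (t, (0 : ℂ)) (g := g) (hgd _).hasFDerivAt hφd.fst
      have h2 : HasFDerivAt (fun p : ℝ × ℂ => ((1 - s) * (φ p).1 + s * g (φ p).1, (φ p).2)) _ (t, 0) :=
        ((hφd.fst.const_mul (1 - s)).add (h1.const_mul s)).prodMk hφd.snd
      rw [h2.fderiv]
      refine injective_of_forall_eq_zero fun v hv => ?_
      have h3 := congrArg Prod.fst hv
      have h4 := congrArg Prod.snd hv
      simp at h3 h4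
      have h5 : 0 < (1 - s) + s * c := by
        have h7 : 1 / 5 ≤ c := by simp only [c]; linarith [hSd (φ (t, 0)).1]
        linarith [mul_le_mul_of_nonneg_left h7 hs.1, hs.2]
      have h6 : ((1 - s) + s * c) * (fderiv ℝ φ (t, 0) v).1 = 0 := by
        simp only [c]; linear_combination h3
      have h7 := (mul_eq_zero.1 h6).resolve_left h5.ne'
      exact hφ.immersion t ((Prod.ext h7 h4 : fderiv ℝ φ (t, 0) v = 0).trans (map_zero _).symm)
  set ψ : ℝ × ℂ → ℝ × ℂ := fun p => (g (φ p).1, (φ p).2) with hψ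
  have hψ1 : ∀ p, ((1 - (1 : ℝ)) * (φ p).1 + 1 * g (φ p).1, (φ p).2) = ψ p := fun p => by simp [hψ]
  have hψg : TorusGerm ψ := by
    simpa only [hψ1] using hpost.germ (right_mem_Icc.2 zero_le_one)
  have iso1 : GermIsotopic φ ψ := by
    have := hpost.germIsotopic fun t s _ => hc t
    simp only [sub_self, sub_zero, one_mul, zero_mul, add_zero, zero_add, Prod.mk.eta] at this
    exact this
  have hpre : TorusFamily fun q => ((1 - q.2) * q.1.1 + q.2 * h q.1.1, q.1.2) := by
    have hmono : ∀ s ∈ Icc (0 : ℝ) 1, ∀ x, 0 < (1 - s) + s * deriv h x := by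
      intro s hs x
      have := hhd x
      rcases hs.1.eq_or_lt with h0 | h0
      · rw [← h0]; norm_num
      · have := mul_pos h0 this
        linarith [hs.2]
    have hd : ∀ s x, HasDerivAt (fun x => (1 - s) * x + s * h x) ((1 - s) + s * deriv h x) x :=
      fun s x => (((hasDerivAt_id x).const_mul (1 - s)).add
        ((hhs.differentiable (by simp) x).hasDerivAt.const_mul s)).congr_deriv (by ring)
    have hhk : ∀ (k : ℤ) t, h (t + k) = h t + k := fun k t => hgm.injective (by
      rw [hgh, hgk, hgh])
    refine ⟨fun t s _ => Eventually.of_forall fun q => ContDiff.contDiffAt ?_, fun t w s => ?_,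
      fun s hs t t' k hk => ⟨k, ?_⟩, fun t s hs => ?_⟩
    · exact (((contDiff_const.sub contDiff_snd).mul (contDiff_fst.comp contDiff_fst)).add
        (contDiff_snd.mul (hhs.comp (contDiff_fst.comp contDiff_fst)))).prodMk
        (contDiff_snd.comp contDiff_fst)
    · simp only [hh1]
      ext
      · simp; ring
      · simp
    · have h1 : StrictMono fun x => (1 - s) * x + s * h x := strictMono_of_deriv_pos fun x => by
        rw [(hd s x).deriv]; exact hmono s hs x
      have h2 := congrArg Prod.fst hk
      simp only [Prod.fst_add] at h2
      refine h1.injective ?_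
      rw [h2, hhk]; ring
    · have h2 : HasFDerivAt (fun p : ℝ × ℂ => ((1 - s) * p.1 + s * h p.1, p.2)) _ (t, 0) :=
        (HasFDerivAt.comp (t, (0 : ℂ)) (g := fun x => (1 - s) * x + s * h x)
          (hd s t).hasFDerivAt hasFDerivAt_fst).prodMk hasFDerivAt_snd
      rw [h2.fderiv]
      refine injective_of_forall_eq_zero fun v hv => ?_
      have h3 := congrArg Prod.fst hv
      have h4 := congrArg Prod.snd hv
      simp [(hmono s hs t).ne'] at h3 h4
      exact Prod.ext h3 h4
  have hcomp := hψg.comp_family hpre fun t s => rfl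
  have hφ'1 : ∀ p : ℝ × ℂ, ((1 - (1 : ℝ)) * p.1 + 1 * h p.1, p.2) = (h p.1, p.2) := fun p => by simp
  have hb : g (-ε) = g (1 - ε) - 1 := by
    have := hg1 (-ε)
    rw [show -ε + 1 = 1 - ε by ring] at this
    linarith
  have hga : g ε = ε / 5 := hg0 ε ⟨hηε, by linarith⟩
  have hgb : g (1 - ε) = (1 - ε) / 5 := hg0 _ ⟨by linarith, by linarith⟩
  refine ⟨g ε, g (1 - ε), fun p => ψ (h p.1, p.2), ⟨?_, by rw [hga]; positivity,
    hgm.monotone (by linarith), by rw [hgb]; linarith, fun t w ht => ?_, fun t ht => ?_,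
    fun t => hc _⟩, iso1.trans ?_⟩
  · simpa only [hφ'1] using hcomp.germ (right_mem_Icc.2 zero_le_one)
  · have h1 : |h t| ≤ ε := by
      rw [abs_le]
      constructor
      · rw [← hhg (-ε)]; exact hhm.monotone (by rw [hb]; exact ht.1)
      · rw [← hhg ε]; exact hhm.monotone ht.2
    simp only [hψ, hid _ w h1, hgh]
  · have h1 : h t ∈ Icc ε (1 - ε) := ⟨by rw [← hhg ε]; exact hhm.monotone ht.1,
      by rw [← hhg (1 - ε)]; exact hhm.monotone ht.2⟩
    have h2 := harc' _ h1
    simp only [hψ, hg0 _ h2]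
    constructor
    · linarith [h2.1]
    · linarith [h2.2]
  · have := hcomp.germIsotopic fun t s _ => hc _
    simp only [sub_self, sub_zero, one_mul, zero_mul, add_zero, zero_add, Prod.mk.eta] at this
    exact this

/-- The normal form of the tube of a locally knotted core. -/
theorem exists_knottedGerm {φ : ℝ × ℂ → ℝ × ℂ} (hsm : ∀ p ∈ solidTorus, ContDiffAt ℝ ∞ φ p)
    (heq : ∀ t w, φ (t + 1, w) = φ (t, w) + (1, 0)) (hmaps : MapsTo φ solidTorus solidTorus)
    (hκ : IsLocallyKnottedCore fun t => φ (t, 0)) (htube : IsTube fun p => stdTorus (φ p)) :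
    TorusGerm φ ∧ ∃ a b φ', KnottedGerm a b φ' ∧ GermIsotopic φ φ' := by
  have hcore : ∀ t : ℝ, (t, (0 : ℂ)) ∈ solidTorus := fun t =>
    disc_one_subset_solidTorus (core_mem_disc one_pos t)
  have hφd : ∀ t : ℝ, DifferentiableAt ℝ φ (t, 0) := fun t =>
    (hsm _ (hcore t)).differentiableAt (by simp)
  have hstdd := contDiff_stdTorus.differentiable (by simp)
  have hg : TorusGerm φ := by
    refine ⟨fun t => ?_, heq, fun t t' k h => ?_, fun t => ?_⟩
    · filter_upwards [(isOpen_disc 1).mem_nhds (core_mem_disc one_pos t)] with p hp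
      exact hsm p (disc_one_subset_solidTorus hp)
    · exact hκ.isPattern.injective t t' ⟨k, h⟩
    · exact injective_fderiv_of_comp (g := stdTorus) (hstdd _) (hφd t) (htube.embOn.immersion _ (hcore t))
  have hc : ∀ t, ‖(φ (t, 0)).2‖ ≤ 1 := fun t => hmaps (hcore t)
  obtain ⟨ε, hε, hstd⟩ := hκ.standard
  have h00 : φ (0, 0) = (0, 0) := hstd 0 (by simpa using hε.le)
  set D := fderiv ℝ φ (0, 0) with hD
  have hD1 : D (1, 0) = (1, 0) := by
    have h4 : HasDerivAt (fun t : ℝ => (t, (0 : ℂ))) ((1 : ℝ), (0 : ℂ)) 0 :=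
      (hasDerivAt_id _).prodMk (hasDerivAt_const _ _)
    have h5 := (hφd 0).hasFDerivAt.comp_hasDerivAt _ h4
    have h6 : (φ ∘ fun t : ℝ => (t, (0 : ℂ))) =ᶠ[𝓝 0] fun t : ℝ => (t, (0 : ℂ)) := by
      have h7 : ∀ᶠ x in 𝓝 (0 : ℝ), |x| < ε :=
        continuous_abs.continuousAt.eventually (Iio_mem_nhds (by simpa using hε))
      filter_upwards [h7] with x hx using hstd x hx.le
    exact (h5.congr_of_eventuallyEq h6.symm).unique h4
  -- Both `stdTorus` and `stdTorus ∘ φ` are positively oriented, so the fibre derivative of `φ` at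
  -- the base point preserves orientation and can be deformed to the identity.
  have hlt := norm_lt_of_orientation_pos (α := stdTorus) (β := fun p => stdTorus (φ p)) (p := (0, 0))
    (q := (0, 0)) (D := D) (by simp only [h00])
    (by
      have h := fderiv_comp (0, 0) (hstdd (φ (0, 0))) (hφd 0)
      rw [h00] at h
      exact h) hD1
    (orientation_stdTorus_pos 0) (htube.oriented _ (hcore 0))
  obtain ⟨φ₁, g₁, i₁, c₁, n₁⟩ := hg.exists_normalised hlt (snd_apply_eq_wirtinger D) hc
  obtain ⟨φ₂, g₂, i₂, c₂, ε', hε', e₂⟩ := g₁.exists_eq_id_near hε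
    (fun t ht => by rw [c₁]; exact hstd t ht) n₁ fun t => by rw [c₁]; exact hc t
  obtain ⟨a, b, φ₃, k₃, i₃⟩ := g₂.exists_compressed hε' e₂
    (fun t ht => by rw [c₂, c₁]; exact hκ.arc t ht) fun t => by rw [c₂, c₁]; exact hc t
  exact ⟨hg, a, b, φ₃, k₃, (i₁.trans i₂).trans i₃⟩

/-! ### Spinning -/

/-- The mirror image of a germ in the meridian disc `{0} × ℂ`. -/
def reverseGerm (φ : ℝ × ℂ → ℝ × ℂ) (p : ℝ × ℂ) : ℝ × ℂ :=
  (-(φ (-p.1, p.2)).1, (φ (-p.1, p.2)).2)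

theorem reverseGerm_equivariant {φ : ℝ × ℂ → ℝ × ℂ} (h : ∀ t w, φ (t + 1, w) = φ (t, w) + (1, 0))
    (t : ℝ) (w : ℂ) : reverseGerm φ (t + 1, w) = reverseGerm φ (t, w) + (1, 0) := by
  have h1 := h (-(t + 1)) w
  rw [show -(t + 1) + 1 = -t by ring] at h1
  simp only [reverseGerm, h1]
  ext <;> simp

theorem periodic_stdTorus_twist {τ : ℝ → ℝ} {n : ℤ} (hτ : ∀ t, τ (t + 1) = τ t + n) (t : ℝ) (w : ℂ) :
    stdTorus (twist τ (t + 1, w)) = stdTorus (twist τ (t, w)) := by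
  have h1 : Circle.exp (2 * Real.pi * (τ t + n)) = Circle.exp (2 * Real.pi * τ t) :=
    circle_exp_eq_iff.2 ⟨n, rfl⟩
  have h2 : twist τ (t + 1, w) = ((twist τ (t, w)).1 + 1, (twist τ (t, w)).2) := by
    simp [twist, hτ, h1]
  rw [h2]
  exact embOn_stdTorus.periodic _ _

theorem contDiff_twist {τ : ℝ → ℝ} (hτ : ContDiff ℝ ∞ τ) : ContDiff ℝ ∞ (twist τ) := by
  have h : ContDiff ℝ ∞ fun p : ℝ × ℂ => Complex.exp (((2 * Real.pi * τ p.1 : ℝ) : ℂ) * Complex.I) :=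
    ((Complex.ofRealCLM.contDiff.comp (contDiff_const.mul (hτ.comp contDiff_fst))).mul
      contDiff_const).cexp
  have h1 : twist τ = fun p =>
      (p.1, Complex.exp (((2 * Real.pi * τ p.1 : ℝ) : ℂ) * Complex.I) * p.2) := by
    funext p; simp [twist, Circle.coe_exp]
  rw [h1]
  exact contDiff_fst.prodMk (h.mul contDiff_snd)

theorem twist_neg_twist (τ : ℝ → ℝ) (p : ℝ × ℂ) : twist (fun t => -τ t) (twist τ p) = p := by
  simp [twist]

theorem injective_fderiv_twist {τ : ℝ → ℝ} (hτ : ContDiff ℝ ∞ τ) (p : ℝ × ℂ) :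
    Function.Injective (fderiv ℝ (twist τ) p) := by
  refine injective_fderiv_of_comp (g := twist fun t => -τ t)
    ((contDiff_twist hτ.neg).differentiable (by simp) _)
    ((contDiff_twist hτ).differentiable (by simp) _) ?_
  simp only [twist_neg_twist]
  rw [fderiv_fun_id]
  exact Function.injective_id

theorem embOn_stdTorus_twist {τ : ℝ → ℝ} (hτ : ContDiff ℝ ∞ τ) {n : ℤ}
    (hn : ∀ t, τ (t + 1) = τ t + n) : EmbOn univ fun p => stdTorus (twist τ p) where
  smooth p _ := (contDiff_stdTorus.comp (contDiff_twist hτ)).contDiffAt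
  periodic := periodic_stdTorus_twist hn
  mem_sphere p _ := embOn_stdTorus.mem_sphere _ (mem_univ _)
  injective p _ q _ h := by
    obtain ⟨k, hk⟩ := embOn_stdTorus.injective _ (mem_univ _) _ (mem_univ _) h
    have hk1 : q.1 = p.1 + k := by simpa [twist] using congrArg Prod.fst hk
    have hk2 := congrArg Prod.snd hk
    have h1 : τ q.1 = τ p.1 + k * n := by
      have h2 : Function.Periodic (fun t => τ t - n * t) 1 := fun t => by simp only [hn]; ring
      have h3 := h2.int_mul k p.1
      simp only [mul_one] at h3
      rw [hk1]; linarith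
    have h2 : Circle.exp (2 * Real.pi * τ q.1) = Circle.exp (2 * Real.pi * τ p.1) :=
      circle_exp_eq_iff.2 ⟨k * n, by rw [h1]; push_cast; ring⟩
    simp only [twist, h2, Prod.snd_add, add_zero] at hk2
    exact ⟨k, Prod.ext (by simpa using hk1)
      (by simpa using mul_left_cancel₀ (Circle.coe_ne_zero _) hk2)⟩
  immersion p _ := injective_fderiv_comp (contDiff_stdTorus.differentiable (by simp) _)
    ((contDiff_twist hτ).differentiable (by simp) _) (embOn_stdTorus.immersion _ (mem_univ _))
    (injective_fderiv_twist hτ p)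

/-! ### The radius profile of the spinning construction. -/

/-- The radius of the half-plane that is spun, as a function of the concordance parameter. -/
noncomputable def spinEta (s : ℝ) : ℝ := expNegInvGlue (expNegInvGlue s)

theorem contDiff_spinEta : ContDiff ℝ ∞ spinEta :=
  expNegInvGlue.contDiff.comp expNegInvGlue.contDiff

theorem spinEta_nonneg (s : ℝ) : 0 ≤ spinEta s := expNegInvGlue.nonneg _

theorem spinEta_of_nonpos {s : ℝ} (hs : s ≤ 0) : spinEta s = 0 := by
  simp [spinEta, expNegInvGlue.zero_of_nonpos hs]

theorem expNegInvGlue_of_pos {s : ℝ} (hs : 0 < s) : expNegInvGlue s = Real.exp (-s⁻¹) := by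
  simp [expNegInvGlue, not_le.2 hs]

theorem spinEta_of_pos {s : ℝ} (hs : 0 < s) : spinEta s = Real.exp (-(expNegInvGlue s)⁻¹) :=
  expNegInvGlue_of_pos (expNegInvGlue.pos_of_pos hs)

theorem monotone_spinEta : Monotone spinEta := fun _ _ h =>
  expNegInvGlue.monotone (expNegInvGlue.monotone h)

theorem expNegInvGlue_injOn : InjOn expNegInvGlue (Ici 0) := by
  intro x hx y hy h
  rcases (mem_Ici.1 hx).eq_or_lt with hx | hx
  · have : expNegInvGlue y = 0 := by rw [← h, ← hx]; simp
    rw [expNegInvGlue.zero_iff_nonpos] at this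
    linarith [mem_Ici.1 hy]
  · have hy : 0 < y := by
      by_contra hn
      have h1 := expNegInvGlue.zero_of_nonpos (not_lt.1 hn)
      have h2 := expNegInvGlue.pos_of_pos hx
      linarith
    rw [expNegInvGlue_of_pos hx, expNegInvGlue_of_pos hy] at h
    simpa using h

theorem spinEta_injOn : InjOn spinEta (Ici 0) := fun _ hx _ hy h =>
  expNegInvGlue_injOn hx hy (expNegInvGlue_injOn (expNegInvGlue.nonneg _) (expNegInvGlue.nonneg _) h)

/-- The inner exponential stays below one, so this bounds the radii that occur as values of
`spinEta`. -/
theorem spinEta_lt_exp_neg_one (s : ℝ) : spinEta s < Real.exp (-1) := by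
  rcases le_or_gt s 0 with hs | hs
  · rw [spinEta_of_nonpos hs]; exact Real.exp_pos _
  · rw [spinEta_of_pos hs, Real.exp_lt_exp, neg_lt_neg_iff]
    refine (one_lt_inv₀ (expNegInvGlue.pos_of_pos hs)).2 ?_
    rw [expNegInvGlue_of_pos hs, Real.exp_lt_one_iff]
    exact neg_neg_of_pos (inv_pos.2 hs)

theorem exp_neg_one_lt_half : Real.exp (-1) < 1 / 2 := by
  rw [Real.exp_neg, one_div]
  exact inv_strictAnti₀ (by norm_num) (by linarith [Real.exp_one_gt_d9])

theorem quarter_lt_exp_neg_one : 1 / 4 < Real.exp (-1) := by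
  rw [Real.exp_neg, one_div]
  exact inv_strictAnti₀ (Real.exp_pos _) (by linarith [Real.exp_one_lt_d9])

/-- This fixes the length `4` of the concordance: at that level the radius exceeds the bound `1 / 4`
on the knotted arc. The inequality amounts to `exp (1 / 4) < log 4`. -/
theorem quarter_lt_spinEta_four : 1 / 4 < spinEta 4 := by
  have h1 : Real.exp (1 / 4) < 1.3 := by
    have h2 : Real.exp (1 / 4) ^ 4 = Real.exp 1 := by
      rw [← Real.exp_nat_mul]; norm_num
    refine lt_of_pow_lt_pow_left₀ 4 (by norm_num) ?_
    rw [h2]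
    have := Real.exp_one_lt_d9
    norm_num
    linarith
  have h3 : (expNegInvGlue 4)⁻¹ = Real.exp (1 / 4) := by
    rw [expNegInvGlue_of_pos (by norm_num), ← Real.exp_neg]; norm_num
  rw [spinEta_of_pos (by norm_num), h3]
  have h4 : Real.exp (-Real.log 4) = 1 / 4 := by
    rw [Real.exp_neg, Real.exp_log (by norm_num)]; norm_num
  have h5 : Real.log 4 = 2 * Real.log 2 := by
    rw [show (4 : ℝ) = 2 ^ 2 by norm_num, Real.log_pow]; norm_num
  have h6 := Real.log_two_gt_d9
  have h7 : Real.exp (-Real.log 4) < Real.exp (-Real.exp (1 / 4)) := Real.exp_lt_exp.2 (by linarith)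
  linarith

theorem hasDerivAt_expNegInvGlue (x : ℝ) : HasDerivAt expNegInvGlue ((x⁻¹) ^ 2 * expNegInvGlue x) x := by
  have h := expNegInvGlue.hasDerivAt_polynomial_eval_inv_mul 1 x
  simpa using h

theorem deriv_spinEta_ne_zero {s : ℝ} (hs : 0 < s) : deriv spinEta s ≠ 0 := by
  have h : HasDerivAt spinEta _ s :=
    (hasDerivAt_expNegInvGlue (expNegInvGlue s)).comp s (hasDerivAt_expNegInvGlue s)
  rw [h.deriv]
  have h1 := expNegInvGlue.pos_of_pos hs
  have h2 := expNegInvGlue.pos_of_pos h1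
  positivity

/-- The level to which the spun point moves when its radius is multiplied by `q`. -/
noncomputable def spinLevel (s q : ℝ) : ℝ :=
  s / (1 + s * Real.log (1 - expNegInvGlue s * Real.log q))

theorem spinLevel_one (s : ℝ) : spinLevel s 1 = s := by simp [spinLevel]

theorem spinLevel_of_nonpos {s : ℝ} (hs : s ≤ 0) (q : ℝ) : spinLevel s q = s := by
  simp [spinLevel, expNegInvGlue.zero_of_nonpos hs]

/-- For `s > 0` the hypothesis says `log q - 1 / g < -1`, where `g = expNegInvGlue s`. Multiplying
by `g` gives `g < 1 - g * log q`, and taking logarithms gives the second bound, since `log g = -1 /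
s`. -/
theorem spinLevel_denom {s q : ℝ} (hq : 0 < q) (h : q * spinEta s < Real.exp (-1)) :
    0 < 1 - expNegInvGlue s * Real.log q ∧
      0 < 1 + s * Real.log (1 - expNegInvGlue s * Real.log q) := by
  rcases le_or_gt s 0 with hs | hs
  · simp [expNegInvGlue.zero_of_nonpos hs]
  · have hg := expNegInvGlue.pos_of_pos hs
    have h1 : Real.log q + -(expNegInvGlue s)⁻¹ < -1 := by
      rw [spinEta_of_pos hs] at h
      rw [← Real.exp_lt_exp, Real.exp_add, Real.exp_log hq]
      exact h
    have h2 : expNegInvGlue s < 1 - expNegInvGlue s * Real.log q := by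
      have h3 := mul_lt_mul_of_pos_left h1 hg
      rw [mul_add, mul_neg, mul_inv_cancel₀ hg.ne'] at h3
      linarith
    refine ⟨hg.trans h2, ?_⟩
    have h4 := Real.log_lt_log hg h2
    rw [expNegInvGlue_of_pos hs, Real.log_exp] at h4
    have h5 := mul_lt_mul_of_pos_left h4 hs
    rw [mul_neg, mul_inv_cancel₀ hs.ne'] at h5
    rw [expNegInvGlue_of_pos hs]
    linarith

theorem spinLevel_pos {s q : ℝ} (hs : 0 < s) (hq : 0 < q) (h : q * spinEta s < Real.exp (-1)) :
    0 < spinLevel s q :=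
  div_pos hs (spinLevel_denom hq h).2

/-- With `g = expNegInvGlue`, multiplying the radius by `q` subtracts `log q` from `1 / g`, hence
adds `log (1 - g * log q)` to `1 / s`. The exponential is iterated so that this correction is flat
at `s = 0`; a single one would give `s / (1 - s * log q)`, which does not join the identity on `s ≤
0` smoothly. -/
theorem spinEta_spinLevel {s q : ℝ} (hq : 0 < q) (h : q * spinEta s < Real.exp (-1)) :
    spinEta (spinLevel s q) = q * spinEta s := by
  rcases le_or_gt s 0 with hs | hs
  · rw [spinLevel_of_nonpos hs, spinEta_of_nonpos hs, mul_zero]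
  · obtain ⟨h1, h2⟩ := spinLevel_denom hq h
    have hV := spinLevel_pos hs hq h
    have hg := expNegInvGlue.pos_of_pos hs
    have h3 : (spinLevel s q)⁻¹ = s⁻¹ + Real.log (1 - expNegInvGlue s * Real.log q) := by
      rw [spinLevel, inv_div]
      field_simp
    have h4 : (expNegInvGlue (spinLevel s q))⁻¹ = (expNegInvGlue s)⁻¹ - Real.log q := by
      rw [expNegInvGlue_of_pos hV, h3, neg_add, Real.exp_add, Real.exp_neg (Real.log _),
        Real.exp_log h1, ← expNegInvGlue_of_pos hs]
      field_simp
    rw [spinEta_of_pos hV, spinEta_of_pos hs, h4, neg_sub, sub_eq_add_neg, Real.exp_add,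
      Real.exp_log hq]

/-! ### The germ as a function of the squared radius. -/

/-- The first coordinate of the germ in the half-plane, divided by the radius. -/
noncomputable def spinRatio (φ : ℝ × ℂ → ℝ × ℂ) (p : ℝ × ℂ) : ℝ :=
  if p.1 ≤ 0 then 1 else (φ (Real.sqrt p.1, p.2)).1 / Real.sqrt p.1

/-- The second coordinate of the germ in the half-plane. -/
noncomputable def spinFibre (φ : ℝ × ℂ → ℝ × ℂ) (p : ℝ × ℂ) : ℂ :=
  if p.1 ≤ 0 then p.2 else (φ (Real.sqrt p.1, p.2)).2

namespace KnottedGerm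

variable {a b : ℝ} {φ : ℝ × ℂ → ℝ × ℂ}

theorem eq_id_of_mem (h : KnottedGerm a b φ) {t : ℝ} (ht : t ∈ Icc b (1 + a)) (w : ℂ) :
    φ (t, w) = (t, w) := by
  have h1 := h.germ.equivariant (t - 1) w
  rw [h.eq_id (t - 1) w ⟨by linarith [ht.1], by linarith [ht.2]⟩] at h1
  rw [sub_add_cancel] at h1
  rw [h1]; ext <;> simp

theorem exists_radius_arc (h : KnottedGerm a b φ) :
    ∃ r > 0, (∀ p ∈ disc r, ContDiffAt ℝ ∞ φ p) ∧
      ∀ t ∈ Icc a b, ∀ w : ℂ, ‖w‖ < r → (φ (t, w)).1 ∈ Ioo 0 (1 / 4) := by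
  obtain ⟨r, hr, hrad⟩ := h.germ.exists_radius
  have h1 : ∀ᶠ w in 𝓝 (0 : ℂ), ∀ t ∈ Icc a b, (φ (t, w)).1 ∈ Ioo 0 (1 / 4) := by
    refine isCompact_Icc.eventually_forall_of_forall_eventually fun t ht => ?_
    have h2 : ContinuousAt (fun z : ℂ × ℝ => (φ (z.2, z.1)).1) (0, t) :=
      (ContinuousAt.comp (f := fun z : ℂ × ℝ => (z.2, z.1)) (h.germ.contDiffAt t).continuousAt
        (by fun_prop)).fst
    exact h2.eventually (isOpen_Ioo.mem_nhds (h.arc t ht))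
  obtain ⟨d, hd, hw⟩ := Metric.eventually_nhds_iff.1 h1
  exact ⟨min r d, lt_min hr hd, fun p hp => (hrad p (disc_mono (min_le_left _ _) hp)).1,
    fun t ht w hw' => hw (by rw [dist_zero_right]; exact hw'.trans_le (min_le_right _ _)) t ht⟩

theorem spin_of_lt (h : KnottedGerm a b φ) {σ : ℝ} (hσ : σ < a ^ 2) (w : ℂ) :
    spinRatio φ (σ, w) = 1 ∧ spinFibre φ (σ, w) = w := by
  rcases le_or_gt σ 0 with h0 | h0
  · simp [spinRatio, spinFibre, h0]
  · have h1 : Real.sqrt σ < a := (Real.sqrt_lt' h.pos).2 hσ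
    have h2 := Real.sqrt_pos.2 h0
    have h3 := h.eq_id (Real.sqrt σ) w ⟨by linarith [h.lt], h1.le⟩
    simp [spinRatio, spinFibre, not_le.2 h0, h3, h2.ne']

theorem spin_of_ge (h : KnottedGerm a b φ) {σ : ℝ} (hσ : b ^ 2 ≤ σ) (hσ1 : σ ≤ 1) (w : ℂ) :
    spinRatio φ (σ, w) = 1 ∧ spinFibre φ (σ, w) = w := by
  have hb : 0 < b := h.pos.trans_le h.le
  have h0 : 0 < σ := lt_of_lt_of_le (by positivity) hσ
  have h1 : b ≤ Real.sqrt σ := Real.le_sqrt_of_sq_le hσ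
  have h2 := Real.sqrt_pos.2 h0
  have h4 : Real.sqrt σ ≤ 1 := Real.sqrt_le_one.2 hσ1
  have h3 := h.eq_id_of_mem (t := Real.sqrt σ) ⟨h1, by linarith [h.pos]⟩ w
  simp [spinRatio, spinFibre, not_le.2 h0, h3, h2.ne']

theorem spin_eq (h : KnottedGerm a b φ) {σ : ℝ} (hσ : 0 ≤ σ) (w : ℂ) :
    φ (Real.sqrt σ, w) = (spinRatio φ (σ, w) * Real.sqrt σ, spinFibre φ (σ, w)) := by
  rcases hσ.eq_or_lt with h0 | h0
  · rw [← h0, (h.spin_of_lt (by positivity [h.pos]) w).1, (h.spin_of_lt (by positivity [h.pos]) w).2]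
    rw [Real.sqrt_zero, h.eq_id 0 w ⟨by linarith [h.lt], h.pos.le⟩]
    simp
  · have h2 := Real.sqrt_pos.2 h0
    simp [spinRatio, spinFibre, not_le.2 h0, h2.ne']

theorem spin_cases (h : KnottedGerm a b φ) {r : ℝ}
    (hr : ∀ t ∈ Icc a b, ∀ w : ℂ, ‖w‖ < r → (φ (t, w)).1 ∈ Ioo 0 (1 / 4)) {σ : ℝ}
    (hσ1 : σ ≤ 1) {w : ℂ} (hw : ‖w‖ < r) :
    (spinRatio φ (σ, w) = 1 ∧ spinFibre φ (σ, w) = w) ∨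
      0 < σ ∧ 0 < spinRatio φ (σ, w) ∧ spinRatio φ (σ, w) * Real.sqrt σ < 1 / 4 := by
  rcases lt_or_ge σ (a ^ 2) with h1 | h1
  · exact Or.inl (h.spin_of_lt h1 w)
  rcases le_or_gt (b ^ 2) σ with h2 | h2
  · exact Or.inl (h.spin_of_ge h2 hσ1 w)
  have ha := h.pos
  have h0 : 0 < σ := lt_of_lt_of_le (by positivity) h1
  have hs := Real.sqrt_pos.2 h0
  have h3 := hr (Real.sqrt σ) ⟨Real.le_sqrt_of_sq_le h1, Real.sqrt_le_iff.2 ⟨(h.pos.trans_le h.le).le, h2.le⟩⟩ w hw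
  rw [h.spin_eq h0.le] at h3
  exact Or.inr ⟨h0, pos_of_mul_pos_left h3.1 hs.le, h3.2⟩

/-- The square root is singular only at zero, and near there `φ` is the identity, so that the ratio
is `1` and the fibre coordinate is unchanged. -/
theorem contDiffAt_spin (h : KnottedGerm a b φ) {r : ℝ} (hr : ∀ p ∈ disc r, ContDiffAt ℝ ∞ φ p)
    (σ : ℝ) {w : ℂ} (hw : ‖w‖ < r) :
    ContDiffAt ℝ ∞ (spinRatio φ) (σ, w) ∧ ContDiffAt ℝ ∞ (spinFibre φ) (σ, w) := by
  have ha := h.pos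
  rcases lt_or_ge σ (a ^ 2) with h1 | h1
  · have h2 : ∀ᶠ p : ℝ × ℂ in 𝓝 (σ, w), p.1 < a ^ 2 := continuousAt_fst.eventually (Iio_mem_nhds h1)
    constructor
    · refine (contDiffAt_const (c := (1 : ℝ))).congr_of_eventuallyEq ?_
      filter_upwards [h2] with p hp using (h.spin_of_lt hp p.2).1
    · refine (contDiffAt_snd (𝕜 := ℝ)).congr_of_eventuallyEq ?_
      filter_upwards [h2] with p hp using (h.spin_of_lt hp p.2).2
  · have h0 : 0 < σ := lt_of_lt_of_le (by positivity) h1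
    have h2 : ∀ᶠ p : ℝ × ℂ in 𝓝 (σ, w), ¬ p.1 ≤ 0 := by
      filter_upwards [continuousAt_fst.eventually (Ioi_mem_nhds h0)] with p hp using not_le.2 hp
    have hsq : ContDiffAt ℝ ∞ (fun p : ℝ × ℂ => Real.sqrt p.1) (σ, w) :=
      contDiffAt_fst.sqrt h0.ne'
    have hφ : ContDiffAt ℝ ∞ (fun p : ℝ × ℂ => φ (Real.sqrt p.1, p.2)) (σ, w) :=
      ContDiffAt.comp (σ, w) (g := φ) (f := fun p : ℝ × ℂ => (Real.sqrt p.1, p.2)) (hr _ hw)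
        (hsq.prodMk contDiffAt_snd)
    constructor
    · refine (hφ.fst.div hsq (Real.sqrt_pos.2 h0).ne').congr_of_eventuallyEq ?_
      filter_upwards [h2] with p hp
      simp [spinRatio, hp]
    · refine hφ.snd.congr_of_eventuallyEq ?_
      filter_upwards [h2] with p hp
      simp [spinFibre, hp]

end KnottedGerm

/-- Spinning the germ in the half-plane about the meridian disc `{0} × ℂ`. -/
noncomputable def spinMap (φ : ℝ × ℂ → ℝ × ℂ) (q : (ℝ × ℂ) × ℝ) : (ℝ × ℂ) × ℝ :=
  ((spinRatio φ (q.1.1 ^ 2 + spinEta q.2 ^ 2, q.1.2) * q.1.1,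
    spinFibre φ (q.1.1 ^ 2 + spinEta q.2 ^ 2, q.1.2)),
    spinLevel q.2 (spinRatio φ (q.1.1 ^ 2 + spinEta q.2 ^ 2, q.1.2)))

/-- The window is wider than one period, so that windows around neighbouring integers overlap, yet
the radius stays at most one, within the range of `spin_of_ge`. -/
theorem spin_sq_le_one {u : ℝ} (hu : |u| < 3 / 4) (s : ℝ) : u ^ 2 + spinEta s ^ 2 ≤ 1 := by
  have h1 : spinEta s < 1 / 2 := (spinEta_lt_exp_neg_one s).trans exp_neg_one_lt_half
  have h2 := spinEta_nonneg s
  have h3 : u ^ 2 ≤ (3 / 4) ^ 2 := sq_le_sq' (by linarith [(abs_lt.1 hu).1]) (abs_lt.1 hu).2.le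
  nlinarith

namespace KnottedGerm

variable {a b r : ℝ} {φ : ℝ × ℂ → ℝ × ℂ}

/-- Off the knotted arc the ratio is `1`. On it, the image radius is below `1 / 4`, while both `|u|`
and the spinning radius are at most the full radius. The middle bound is what `spinLevel` needs. -/
theorem spinRatio_bound (h : KnottedGerm a b φ)
    (hr : ∀ t ∈ Icc a b, ∀ w : ℂ, ‖w‖ < r → (φ (t, w)).1 ∈ Ioo 0 (1 / 4)) {u : ℝ}
    (hu : |u| < 3 / 4) (s : ℝ) {w : ℂ} (hw : ‖w‖ < r) :
    0 < spinRatio φ (u ^ 2 + spinEta s ^ 2, w) ∧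
      spinRatio φ (u ^ 2 + spinEta s ^ 2, w) * spinEta s < Real.exp (-1) ∧
      (spinRatio φ (u ^ 2 + spinEta s ^ 2, w) = 1 ∨
        spinRatio φ (u ^ 2 + spinEta s ^ 2, w) * spinEta s < 1 / 4 ∧
        spinRatio φ (u ^ 2 + spinEta s ^ 2, w) * |u| < 1 / 4) := by
  rcases h.spin_cases hr (spin_sq_le_one hu s) hw with ⟨h1, -⟩ | ⟨h0, h1, h2⟩
  · rw [h1]
    exact ⟨one_pos, by rw [one_mul]; exact spinEta_lt_exp_neg_one s, Or.inl rfl⟩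
  · have h3 : spinEta s ≤ Real.sqrt (u ^ 2 + spinEta s ^ 2) :=
      Real.le_sqrt_of_sq_le (by nlinarith [sq_nonneg u])
    have h4 : |u| ≤ Real.sqrt (u ^ 2 + spinEta s ^ 2) :=
      Real.abs_le_sqrt (by nlinarith [sq_nonneg (spinEta s)])
    have h5 := (mul_le_mul_of_nonneg_left h3 h1.le).trans_lt h2
    exact ⟨h1, h5.trans quarter_lt_exp_neg_one, Or.inr ⟨h5,
      (mul_le_mul_of_nonneg_left h4 h1.le).trans_lt h2⟩⟩

theorem spinMap_of_ge (h : KnottedGerm a b φ) {u s : ℝ} (hu : |u| < 3 / 4)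
    (hb : b ^ 2 ≤ u ^ 2 + spinEta s ^ 2) (w : ℂ) : spinMap φ ((u, w), s) = ((u, w), s) := by
  obtain ⟨h1, h2⟩ := h.spin_of_ge hb (spin_sq_le_one hu s) w
  simp [spinMap, h1, h2, spinLevel_one]

theorem contDiffAt_spinMap (h : KnottedGerm a b φ) (hφ : ∀ p ∈ disc r, ContDiffAt ℝ ∞ φ p)
    (hr : ∀ t ∈ Icc a b, ∀ w : ℂ, ‖w‖ < r → (φ (t, w)).1 ∈ Ioo 0 (1 / 4)) {u : ℝ}
    (hu : |u| < 3 / 4) (s : ℝ) {w : ℂ} (hw : ‖w‖ < r) :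
    ContDiffAt ℝ ∞ (spinMap φ) ((u, w), s) := by
  obtain ⟨h1, h2, -⟩ := h.spinRatio_bound hr hu s hw
  obtain ⟨h3, h4⟩ := spinLevel_denom h1 h2
  obtain ⟨h5, h6⟩ := h.contDiffAt_spin hφ (u ^ 2 + spinEta s ^ 2) hw
  have hη : ContDiff ℝ ∞ spinEta := contDiff_spinEta
  have hσ : ContDiff ℝ ∞ fun q : (ℝ × ℂ) × ℝ => (q.1.1 ^ 2 + spinEta q.2 ^ 2, q.1.2) :=
    (((contDiff_fst.comp contDiff_fst).pow 2).add ((hη.comp contDiff_snd).pow 2)).prodMk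
      (contDiff_snd.comp contDiff_fst)
  have hQ : ContDiffAt ℝ ∞ (fun q : (ℝ × ℂ) × ℝ =>
      spinRatio φ (q.1.1 ^ 2 + spinEta q.2 ^ 2, q.1.2)) ((u, w), s) :=
    ContDiffAt.comp ((u, w), s) (g := spinRatio φ) h5 hσ.contDiffAt
  have hY : ContDiffAt ℝ ∞ (fun q : (ℝ × ℂ) × ℝ =>
      spinFibre φ (q.1.1 ^ 2 + spinEta q.2 ^ 2, q.1.2)) ((u, w), s) :=
    ContDiffAt.comp ((u, w), s) (g := spinFibre φ) h6 hσ.contDiffAt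
  have hg : ContDiff ℝ ∞ fun q : (ℝ × ℂ) × ℝ => expNegInvGlue q.2 :=
    expNegInvGlue.contDiff.comp contDiff_snd
  have hL := ((contDiffAt_const (c := (1 : ℝ))).sub
    (hg.contDiffAt.mul (hQ.log h1.ne'))).log h3.ne'
  have hV : ContDiffAt ℝ ∞ (fun q : (ℝ × ℂ) × ℝ =>
      spinLevel q.2 (spinRatio φ (q.1.1 ^ 2 + spinEta q.2 ^ 2, q.1.2))) ((u, w), s) :=
    contDiffAt_snd.div (contDiffAt_const.add (contDiffAt_snd.mul hL)) h4.ne'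
  exact ((hQ.mul (contDiffAt_fst.comp _ contDiffAt_fst)).prodMk hY).prodMk hV

/-- Along a curve with velocity `v` in the kernel, both plane coordinates of the image are
stationary, hence so is the image radius `Q * √σ`. Thus `φ (√σ, W)` is stationary, and as `φ` is an
immersion, so are `√σ`, `W` and the ratio `Q`; this leaves no motion in the source. For `s ≤ 0` the
level coordinate alone gives `v.2 = 0`. -/
theorem injective_fderiv_spinMap (h : KnottedGerm a b φ) (hφ : ∀ p ∈ disc r, ContDiffAt ℝ ∞ φ p)
    (hr0 : 0 < r) (hr : ∀ t ∈ Icc a b, ∀ w : ℂ, ‖w‖ < r → (φ (t, w)).1 ∈ Ioo 0 (1 / 4)) {u : ℝ}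
    (hu : |u| < 3 / 4) (s : ℝ) : Function.Injective (fderiv ℝ (spinMap φ) ((u, 0), s)) := by
  have hw : ‖(0 : ℂ)‖ < r := by simpa using hr0
  refine injective_of_forall_eq_zero fun v hv => ?_
  have hΨd := ((h.contDiffAt_spinMap hφ hr hu s hw).differentiableAt (by simp)).hasFDerivAt
  set U : ℝ → ℝ := fun x => u + x * v.1.1 with hU
  set W : ℝ → ℂ := fun x => x • v.1.2 with hW
  set T : ℝ → ℝ := fun x => s + x * v.2 with hT
  have hU' : HasDerivAt U v.1.1 0 := (((hasDerivAt_id (0 : ℝ)).mul_const _).const_add u).congr_deriv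
    (by simp)
  have hW' : HasDerivAt W v.1.2 0 := ((hasDerivAt_id (0 : ℝ)).smul_const _).congr_deriv (by simp)
  have hT' : HasDerivAt T v.2 0 := (((hasDerivAt_id (0 : ℝ)).mul_const _).const_add s).congr_deriv
    (by simp)
  have hU0 : U 0 = u := by simp [hU]
  have hW0 : W 0 = 0 := by simp [hW]
  have hT0 : T 0 = s := by simp [hT]
  set H : ℝ → ℝ := fun x => spinEta (T x) with hH
  have hηd : ∀ s, HasDerivAt spinEta (deriv spinEta s) s := fun s =>
    (contDiff_spinEta.differentiable (by simp) s).hasDerivAt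
  have hH' : HasDerivAt H (deriv spinEta s * v.2) 0 := by
    have h1 := hηd (T 0)
    rw [hT0] at h1
    exact HasDerivAt.comp 0 (h₂ := spinEta) (by rw [hT0]; exact h1) hT'
  set σ : ℝ → ℝ := fun x => U x ^ 2 + H x ^ 2 with hσ
  have hσ0 : σ 0 = u ^ 2 + spinEta s ^ 2 := by simp only [hσ, hH, hU0, hT0]
  have hσ' : HasDerivAt σ (2 * u * v.1.1 + 2 * spinEta s * (deriv spinEta s * v.2)) 0 := by
    refine ((hU'.pow 2).add (hH'.pow 2)).congr_deriv ?_
    simp only [hH, hU0, hT0]; ring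
  obtain ⟨c1, c2⟩ := h.contDiffAt_spin hφ (u ^ 2 + spinEta s ^ 2) hw
  set Q : ℝ → ℝ := fun x => spinRatio φ (σ x, W x) with hQ
  set Y : ℝ → ℂ := fun x => spinFibre φ (σ x, W x) with hY
  have hQd : DifferentiableAt ℝ Q 0 := by
    have d1 : DifferentiableAt ℝ σ 0 := hσ'.differentiableAt
    have d2 : DifferentiableAt ℝ W 0 := hW'.differentiableAt
    have e2 : DifferentiableAt ℝ (spinRatio φ) (σ 0, W 0) := by
      rw [hσ0, hW0]; exact c1.differentiableAt (by simp)
    exact DifferentiableAt.comp (0 : ℝ) (f := fun x => (σ x, W x)) e2 (d1.prodMk d2)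
  have hQ' := hQd.hasDerivAt
  set Q₁ := deriv Q 0
  have hcurve : HasDerivAt (fun x => ((U x, W x), T x)) v 0 := (hU'.prodMk hW').prodMk hT'
  have hΨ : HasDerivAt (fun x => spinMap φ ((U x, W x), T x)) 0 0 := by
    have h1 : HasFDerivAt (spinMap φ) (fderiv ℝ (spinMap φ) ((u, 0), s)) ((U 0, W 0), T 0) := by
      rw [hU0, hW0, hT0]; exact hΨd
    rw [← hv]
    exact h1.comp_hasDerivAt (0 : ℝ) (f := fun x => ((U x, W x), T x)) hcurve
  have hX' : HasDerivAt (fun x => Q x * U x) 0 0 := hΨ.fst.fst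
  have hY' : HasDerivAt Y 0 0 := hΨ.fst.snd
  have hV' : HasDerivAt (fun x => spinLevel (T x) (Q x)) 0 0 := hΨ.snd
  have hQ0 : Q 0 = spinRatio φ (u ^ 2 + spinEta s ^ 2, 0) := by simp only [hQ, hσ0, hW0]
  have hnear : ∀ᶠ x in 𝓝 (0 : ℝ), |U x| < 3 / 4 ∧ ‖W x‖ < r := by
    have e1 : ContinuousAt (fun x => |U x|) 0 := hU'.continuousAt.abs
    have e2 : ContinuousAt (fun x => ‖W x‖) 0 := hW'.continuousAt.norm
    exact (e1.eventually (Iio_mem_nhds (by beta_reduce; rw [hU0]; exact hu))).and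
      (e2.eventually (Iio_mem_nhds (by beta_reduce; rw [hW0]; exact hw)))
  obtain ⟨q1, q2, -⟩ := h.spinRatio_bound hr hu s hw
  rw [← hQ0] at q1 q2
  -- the derivative of the product of the ratio and the radius vanishes
  have hE : HasDerivAt (fun x => Q x * H x) 0 0 ∧ (s ≤ 0 → v.2 = 0) := by
    rcases le_or_gt s 0 with hs | hs
    · have hg0 : expNegInvGlue s = 0 := expNegInvGlue.zero_of_nonpos hs
      have hg' : HasDerivAt (fun x => expNegInvGlue (T x)) 0 0 := by
        have e1 := hasDerivAt_expNegInvGlue s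
        rw [hg0, mul_zero] at e1
        rw [← hT0] at e1
        exact (e1.comp 0 hT').congr_deriv (by simp)
      have hl : HasDerivAt (fun x => Real.log (Q x)) (Q₁ / Q 0) 0 := hQ'.log q1.ne'
      have hm0 : (1 - expNegInvGlue (T 0) * Real.log (Q 0)) = 1 := by rw [hT0, hg0]; simp
      have hm : HasDerivAt (fun x => Real.log (1 - expNegInvGlue (T x) * Real.log (Q x))) 0 0 := by
        have e1 : HasDerivAt (fun x => 1 - expNegInvGlue (T x) * Real.log (Q x)) 0 0 :=
          ((hg'.mul hl).const_sub 1).congr_deriv (by rw [hT0, hg0]; simp)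
        exact (e1.log (by rw [hm0]; norm_num)).congr_deriv (by simp)
      have hd0 : 1 + T 0 * Real.log (1 - expNegInvGlue (T 0) * Real.log (Q 0)) = 1 := by
        rw [hm0]; simp
      have hVs : HasDerivAt (fun x => spinLevel (T x) (Q x)) v.2 0 := by
        have e1 : HasDerivAt (fun x => 1 + T x * Real.log (1 - expNegInvGlue (T x) * Real.log (Q x)))
            0 0 := ((hT'.mul hm).const_add 1).congr_deriv (by rw [hm0]; simp)
        refine (hT'.div e1 (by rw [hd0]; norm_num)).congr_deriv ?_
        rw [hd0]; simp
      have hv2 : v.2 = 0 := hVs.unique hV'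
      refine ⟨(hQ'.mul hH').congr_deriv ?_, fun _ => hv2⟩
      simp [hH, hT0, hv2, spinEta_of_nonpos hs]
    · refine ⟨?_, fun h0 => absurd hs (not_lt.2 h0)⟩
      have e1 : HasDerivAt (fun x => spinEta (spinLevel (T x) (Q x))) 0 0 := by
        have e2 := (hηd (spinLevel (T 0) (Q 0))).comp 0 hV'
        rw [mul_zero] at e2
        exact e2
      refine e1.congr_of_eventuallyEq ?_
      filter_upwards [hnear] with x hx
      obtain ⟨p1, p2, -⟩ := h.spinRatio_bound hr hx.1 (T x) hx.2
      exact (spinEta_spinLevel p1 p2).symm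
  obtain ⟨hE, hs0⟩ := hE
  have hEd : Q₁ * spinEta s + Q 0 * (deriv spinEta s * v.2) = 0 := by
    have e1 := (hQ'.mul hH').unique hE
    simpa only [hH, hT0] using e1
  have hXd : Q₁ * u + Q 0 * v.1.1 = 0 := by
    have e1 := (hQ'.mul hU').unique hX'
    simpa only [hU0] using e1
  have key : v.1.1 = 0 ∧ v.1.2 = 0 ∧ deriv spinEta s * v.2 = 0 := by
    suffices hsuff : Q₁ = 0 ∧ v.1.2 = 0 by
      rw [hsuff.1, zero_mul, zero_add] at hEd hXd
      exact ⟨(mul_eq_zero.1 hXd).resolve_left q1.ne', hsuff.2, (mul_eq_zero.1 hEd).resolve_left q1.ne'⟩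
    rcases lt_or_ge (u ^ 2 + spinEta s ^ 2) (a ^ 2) with hlt | hge
    · have e1 : ∀ᶠ x in 𝓝 (0 : ℝ), σ x < a ^ 2 :=
        hσ'.continuousAt.eventually (Iio_mem_nhds (by rw [hσ0]; exact hlt))
      constructor
      · have e2 : Q =ᶠ[𝓝 0] fun _ => (1 : ℝ) := by
          filter_upwards [e1] with x hx using (h.spin_of_lt hx _).1
        exact (hQ'.congr_of_eventuallyEq e2.symm).unique (hasDerivAt_const _ _)
      · have e2 : Y =ᶠ[𝓝 0] W := by
          filter_upwards [e1] with x hx using (h.spin_of_lt hx _).2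
        exact hW'.unique (hY'.congr_of_eventuallyEq e2.symm)
    · have ha := h.pos
      have hpos : 0 < σ 0 := by rw [hσ0]; exact lt_of_lt_of_le (by positivity) hge
      have hR0 := Real.sqrt_pos.2 hpos
      obtain ⟨R₁, hR'⟩ : ∃ R₁, HasDerivAt (fun x => Real.sqrt (σ x)) R₁ 0 := ⟨_, hσ'.sqrt hpos.ne'⟩
      have hc : HasDerivAt (fun x => (Real.sqrt (σ x), W x)) (R₁, v.1.2) 0 := hR'.prodMk hW'
      have hφd : HasFDerivAt φ (fderiv ℝ φ (Real.sqrt (σ 0), 0)) (Real.sqrt (σ 0), W 0) := by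
        rw [hW0]; exact ((hφ _ hw).differentiableAt (by simp)).hasFDerivAt
      have hf := hφd.comp_hasDerivAt (0 : ℝ) (f := fun x => (Real.sqrt (σ x), W x)) hc
      set f := fderiv ℝ φ (Real.sqrt (σ 0), 0) (R₁, v.1.2) with hfdef
      have hfe : (φ ∘ fun x => (Real.sqrt (σ x), W x)) = fun x => (Q x * Real.sqrt (σ x), Y x) := by
        funext x
        exact h.spin_eq (by positivity) _
      rw [hfe] at hf
      have hfa : HasDerivAt (fun x => Q x * Real.sqrt (σ x)) f.1 0 :=
        (ContinuousLinearMap.fst ℝ ℝ ℂ).hasFDerivAt.comp_hasDerivAt 0 hf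
      have hfb : HasDerivAt Y f.2 0 := (ContinuousLinearMap.snd ℝ ℝ ℂ).hasFDerivAt.comp_hasDerivAt 0 hf
      have hf2 : f.2 = 0 := hfb.unique hY'
      -- The squared image radius is the sum of the squares of `Q * U` and `Q * H`, both of which
      -- have derivative zero.
      have hf1 : f.1 = 0 := by
        have e1 := (hX'.pow 2).add (hE.pow 2)
        have e2 := hfa.pow 2
        have e3 : (fun x => (Q x * U x)) ^ 2 + (fun x => (Q x * H x)) ^ 2
            = (fun x => Q x * Real.sqrt (σ x)) ^ 2 := by
          funext x
          have : Real.sqrt (σ x) ^ 2 = U x ^ 2 + H x ^ 2 := Real.sq_sqrt (by positivity)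
          simp only [Pi.add_apply, Pi.pow_apply, mul_pow, this]
          ring
        rw [e3] at e1
        have e4 := e2.unique e1
        simpa [q1.ne', hR0.ne'] using e4
      have hfv := h.germ.immersion (Real.sqrt (σ 0)) ((Prod.ext hf1 hf2 : f = 0).trans (map_zero _).symm)
      have hR1 : R₁ = 0 := congrArg Prod.fst hfv
      have hv12 : v.1.2 = 0 := congrArg Prod.snd hfv
      refine ⟨?_, hv12⟩
      have e5 := (hQ'.mul hR').unique hfa
      rw [hf1, hR1, mul_zero, add_zero] at e5
      exact (mul_eq_zero.1 e5).resolve_right hR0.ne'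
  obtain ⟨k1, k2, k3⟩ := key
  have k4 : v.2 = 0 := by
    rcases le_or_gt s 0 with hs | hs
    · exact hs0 hs
    · exact (mul_eq_zero.1 k3).resolve_left (deriv_spinEta_ne_zero hs)
  exact Prod.ext (Prod.ext k1 k2) k4

/-- Equal images have equal image radii, so injectivity of `φ` on its core gives equal source radii;
those are below one, which excludes a deck translation. Then the ratios agree and cancel.
Nonnegative levels are needed because `spinEta` is constant on `s ≤ 0`. -/
theorem spinMap_injective (h : KnottedGerm a b φ)
    (hr0 : 0 < r) (hr : ∀ t ∈ Icc a b, ∀ w : ℂ, ‖w‖ < r → (φ (t, w)).1 ∈ Ioo 0 (1 / 4)) {u u' : ℝ}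
    (hu : |u| < 3 / 4) (hu' : |u'| < 3 / 4) {s s' : ℝ} (hs : 0 ≤ s) (hs' : 0 ≤ s')
    (he : spinMap φ ((u, 0), s) = spinMap φ ((u', 0), s')) : u = u' ∧ s = s' := by
  have hw : ‖(0 : ℂ)‖ < r := by simpa using hr0
  obtain ⟨p1, p2, -⟩ := h.spinRatio_bound hr hu s hw
  obtain ⟨p1', p2', -⟩ := h.spinRatio_bound hr hu' s' hw
  have eX := congrArg (fun x : (ℝ × ℂ) × ℝ => x.1.1) he
  have eY := congrArg (fun x : (ℝ × ℂ) × ℝ => x.1.2) he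
  have eV := congrArg (fun x : (ℝ × ℂ) × ℝ => x.2) he
  simp only [spinMap] at eX eY eV
  have eE := spinEta_spinLevel p1 p2
  rw [eV, spinEta_spinLevel p1' p2'] at eE
  have hle := spin_sq_le_one hu s
  have hle' := spin_sq_le_one hu' s'
  have hlt : ∀ {u s : ℝ}, |u| < 3 / 4 → u ^ 2 + spinEta s ^ 2 < 1 := by
    intro u s hu
    have h1 : spinEta s < 1 / 2 := (spinEta_lt_exp_neg_one s).trans exp_neg_one_lt_half
    have h2 := spinEta_nonneg s
    have h3 : u ^ 2 ≤ (3 / 4) ^ 2 := sq_le_sq' (by linarith [(abs_lt.1 hu).1]) (abs_lt.1 hu).2.le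
    nlinarith
  have hlt1 := hlt (s := s) hu
  have hlt1' := hlt (s := s') hu'
  set σ := u ^ 2 + spinEta s ^ 2 with hσ
  set σ' := u' ^ 2 + spinEta s' ^ 2 with hσ'
  have hσ0 : 0 ≤ σ := by positivity
  have hσ0' : 0 ≤ σ' := by positivity
  set q := spinRatio φ (σ, 0)
  set q' := spinRatio φ (σ', 0)
  have eN : q * Real.sqrt σ = q' * Real.sqrt σ' := by
    have h1 : (q * Real.sqrt σ) ^ 2 = (q' * Real.sqrt σ') ^ 2 := by
      rw [mul_pow, mul_pow, Real.sq_sqrt hσ0, Real.sq_sqrt hσ0', hσ, hσ']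
      linear_combination (q * u + q' * u') * eX - (q * spinEta s + q' * spinEta s') * eE
    exact (sq_eq_sq₀ (by positivity) (by positivity)).1 h1
  have eφ : φ (Real.sqrt σ', 0) = φ (Real.sqrt σ, 0) + (((0 : ℤ) : ℝ), 0) := by
    rw [h.spin_eq hσ0, h.spin_eq hσ0']
    ext <;> simp [eN, eY, q, q']
  obtain ⟨n, hn⟩ := h.germ.core_injective _ _ 0 eφ
  have hs1 : Real.sqrt σ < 1 := by rw [Real.sqrt_lt' one_pos]; simpa using hlt1
  have hs1' : Real.sqrt σ' < 1 := by rw [Real.sqrt_lt' one_pos]; simpa using hlt1'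
  have hs2 := Real.sqrt_nonneg σ
  have hs2' := Real.sqrt_nonneg σ'
  have hn0 : n = 0 := by
    have h1 : (n : ℝ) < 1 := by linarith
    have h2 : (-1 : ℝ) < n := by linarith
    have h3 : n < 1 := by exact_mod_cast h1
    have h4 : -1 < n := by exact_mod_cast h2
    omega
  have eσ : σ = σ' := by
    rw [hn0, Int.cast_zero, add_zero] at hn
    rw [← Real.sq_sqrt hσ0, ← Real.sq_sqrt hσ0', hn]
  have eq : q = q' := by simp only [q, q', eσ]
  rw [eq] at eX eE
  refine ⟨mul_left_cancel₀ p1'.ne' eX, spinEta_injOn hs hs' ?_⟩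
  exact (mul_left_cancel₀ p1'.ne' eE).symm

end KnottedGerm

/-! ### The concordance swept out by spinning. -/

namespace KnottedGerm

variable {a b r : ℝ} {φ : ℝ × ℂ → ℝ × ℂ}

theorem reverseGerm_eq_id (h : KnottedGerm a b φ) {t : ℝ} (ht : t ∈ Icc (-a) (1 - b)) (w : ℂ) :
    reverseGerm φ (t, w) = (t, w) := by
  simp only [reverseGerm, h.eq_id (-t) w ⟨by linarith [ht.2], by linarith [ht.1]⟩, neg_neg]

/-- For `u ≥ 0` the second factor is the identity at `φ (u, w)`. For `u < 0` the first factor is the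
identity and the second is `φ` seen in the mirror. Either way this is the slice of radius zero of
the spun map. -/
theorem reverseGerm_comp (h : KnottedGerm a b φ)
    (hr : ∀ t ∈ Icc a b, ∀ w : ℂ, ‖w‖ < r → (φ (t, w)).1 ∈ Ioo 0 (1 / 4)) {u : ℝ}
    (hu : |u| ≤ 1 / 2) {w : ℂ} (hw : ‖w‖ < r) :
    reverseGerm φ (φ (u, w)) = (spinRatio φ (u ^ 2, w) * u, spinFibre φ (u ^ 2, w)) := by
  have h1 := h.spin_eq (sq_nonneg u) w
  rw [Real.sqrt_sq_eq_abs] at h1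
  have ha := h.pos
  have hb := h.lt
  have hu' := abs_le.1 hu
  rcases le_or_gt 0 u with h0 | h0
  · rw [abs_of_nonneg h0] at h1 hu
    rw [h1]
    obtain ⟨q1, -, q2⟩ := h.spinRatio_bound hr (u := u) (by rw [abs_of_nonneg h0]; linarith) 0 hw
    rw [spinEta_of_nonpos le_rfl, zero_pow two_ne_zero, add_zero, abs_of_nonneg h0] at q2
    rw [spinEta_of_nonpos le_rfl, zero_pow two_ne_zero, add_zero] at q1
    refine h.reverseGerm_eq_id ⟨?_, ?_⟩ _
    · have := mul_nonneg q1.le h0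
      linarith
    · rcases q2 with q2 | ⟨-, q2⟩
      · rw [q2]; linarith
      · linarith
  · rw [h.eq_id u w ⟨by linarith, by linarith⟩]
    rw [abs_of_neg h0] at h1
    simp [reverseGerm, h1]

theorem reverseGerm_comp_equivariant (h : KnottedGerm a b φ) (t : ℝ) (w : ℂ) :
    reverseGerm φ (φ (t + 1, w)) = reverseGerm φ (φ (t, w)) + (1, 0) := by
  rw [h.germ.equivariant, ← reverseGerm_equivariant h.germ.equivariant]
  congr 1; ext <;> simp

/-- Where the level changes, the new spinning radius is below `1 / 4`, hence below the radius at
level `4`. -/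
theorem spinLevel_mem (h : KnottedGerm a b φ)
    (hr : ∀ t ∈ Icc a b, ∀ w : ℂ, ‖w‖ < r → (φ (t, w)).1 ∈ Ioo 0 (1 / 4)) {u : ℝ}
    (hu : |u| < 3 / 4) {s : ℝ} (hs : s ∈ Ioo (0 : ℝ) 4) {w : ℂ} (hw : ‖w‖ < r) :
    (spinMap φ ((u, w), s)).2 ∈ Ioo (0 : ℝ) 4 := by
  obtain ⟨q1, q2, q3⟩ := h.spinRatio_bound hr hu s hw
  refine ⟨spinLevel_pos hs.1 q1 q2, ?_⟩
  rcases q3 with q3 | ⟨q3, -⟩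
  · simp only [spinMap, q3, spinLevel_one]; exact hs.2
  · by_contra! hc
    have h1 := monotone_spinEta hc
    have h2 := spinEta_spinLevel q1 q2
    simp only [spinMap] at h1
    rw [h2] at h1
    linarith [quarter_lt_spinEta_four]

/-- The product of a knotted germ with its mirror image is, as a companion of satellites, concordant
to the trivial germ: spin the germ about the meridian disc. -/
theorem exists_collaredConcordant_spin (h : KnottedGerm a b φ) {τ : ℝ → ℝ} (hτ : ContDiff ℝ ∞ τ)
    {n : ℤ} (hn : ∀ t, τ (t + 1) = τ t + n) {P : ℝ → ℝ × ℂ} (hP : TorusCurve P) :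
    ∃ δ₀ > 0, ∀ δ ∈ Ioc 0 δ₀, CollaredConcordant
      (fun t => stdTorus (twist τ (reverseGerm φ (φ (shrink δ (P t))))))
      (fun t => stdTorus (twist τ (shrink δ (P t)))) := by
  obtain ⟨r, hr0, hφ, hr⟩ := h.exists_radius_arc
  have hE := embOn_stdTorus_twist hτ hn
  have hb : b < 1 / 4 := h.lt
  have hb0 : 0 < b := h.pos.trans_le h.le
  set M : (ℝ × ℂ) × ℝ → R4 × ℝ := fun q => (stdTorus (twist τ q.1), q.2) with hM
  set Φ : (ℝ × ℂ) × ℝ → R4 × ℝ :=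
    fun q => M (spinMap φ ((q.1.1 - round q.1.1, q.1.2), q.2)) with hΦ
  have hround : ∀ t : ℝ, t - round t ∈ Ico (-(1 / 2) : ℝ) (1 / 2) := fun t => by
    rw [round_eq]
    have h1 := Int.floor_le (t + 1 / 2)
    have h2 := Int.lt_floor_add_one (t + 1 / 2)
    exact ⟨by linarith, by linarith⟩
  have hround' : ∀ t : ℝ, |t - round t| ≤ 1 / 2 := fun t =>
    abs_le.2 ⟨(hround t).1, (hround t).2.le⟩
  have hround'' : ∀ t : ℝ, |t - round t| < 3 / 4 := fun t => by linarith [hround' t]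
  have hM1 : ∀ (k : ℤ) (t : ℝ) w s, M ((t + k, w), s) = M ((t, w), s) := fun k t w s => by
    have h1 := periodic_int (φ := fun p => stdTorus (twist τ p)) hE.periodic k (t, w)
    rw [Prod.mk_add_mk, add_zero] at h1
    simp only [hM, h1]
  have hge : ∀ {u : ℝ}, 1 / 4 ≤ |u| → ∀ s, b ^ 2 ≤ u ^ 2 + spinEta s ^ 2 := fun {u} hu s => by
    have h1 : b ^ 2 ≤ |u| ^ 2 := pow_le_pow_left₀ hb0.le (by linarith) 2
    rw [sq_abs] at h1
    nlinarith [sq_nonneg (spinEta s)]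
  -- Rounding jumps at half-integers, harmlessly: if the nearest integer is not `k`, both
  -- representatives have absolute value at least `1 / 4`, where the spun map is the identity.
  have hloc : ∀ (t : ℝ) (k : ℤ), |t - k| < 3 / 4 → ∀ w s,
      Φ ((t, w), s) = M (spinMap φ ((t - k, w), s)) := by
    intro t k hk w s
    by_cases hkt : round t = k
    · simp only [hΦ, hkt]
    · have h1 : (1 : ℝ) ≤ |(round t : ℝ) - k| := by
        have : (1 : ℤ) ≤ |round t - k| := Int.one_le_abs (sub_ne_zero.2 hkt)
        exact_mod_cast this
      have h2 := hround' t
      have h3 : |(round t : ℝ) - k| ≤ |t - round t| + |t - k| := by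
        have := abs_sub_le (round t : ℝ) t k
        rwa [abs_sub_comm (round t : ℝ) t] at this
      simp only [hΦ]
      rw [h.spinMap_of_ge (hround'' t) (hge (by linarith) s),
        h.spinMap_of_ge hk (hge (by linarith) s)]
      rw [← hM1 (round t - k) (t - round t) w s]
      congr 3
      push_cast; ring
  have hlocn : ∀ (t : ℝ) (s : ℝ), ∀ᶠ q in 𝓝 ((t, (0 : ℂ)), s),
      |q.1.1 - (round t : ℝ)| < 3 / 4 ∧ ‖q.1.2‖ < r := fun t s => by
    have e1 : ContinuousAt (fun q : (ℝ × ℂ) × ℝ => |q.1.1 - (round t : ℝ)|) ((t, 0), s) := by fun_prop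
    have e2 : ContinuousAt (fun q : (ℝ × ℂ) × ℝ => ‖q.1.2‖) ((t, 0), s) := by fun_prop
    exact (e1.eventually (Iio_mem_nhds (hround'' t))).and
      (e2.eventually (Iio_mem_nhds (by simpa using hr0)))
  have hMs : ContDiff ℝ ∞ M :=
    ((contDiff_stdTorus.comp (contDiff_twist hτ)).comp contDiff_fst).prodMk contDiff_snd
  have hsh : ∀ k : ℤ, ContDiff ℝ ∞ fun q : (ℝ × ℂ) × ℝ => q - (((k : ℝ), 0), 0) := fun k =>
    contDiff_id.sub contDiff_const
  have hΦk : ∀ t s, Φ =ᶠ[𝓝 ((t, (0 : ℂ)), s)]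
      fun q => M (spinMap φ (q - (((round t : ℝ), 0), 0))) := fun t s => by
    filter_upwards [hlocn t s] with q hq
    have h1 : q - (((round t : ℝ), (0 : ℂ)), (0 : ℝ)) = ((q.1.1 - round t, q.1.2), q.2) := by
      ext <;> simp
    rw [h1]
    exact hloc q.1.1 (round t) hq.1 q.1.2 q.2
  have hcd : ∀ (t : ℝ) (q : (ℝ × ℂ) × ℝ), |q.1.1 - (round t : ℝ)| < 3 / 4 ∧ ‖q.1.2‖ < r →
      ContDiffAt ℝ ∞ (spinMap φ) (q - (((round t : ℝ), 0), 0)) := by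
    intro t q hq
    have h1 : q - (((round t : ℝ), (0 : ℂ)), (0 : ℝ)) = ((q.1.1 - round t, q.1.2), q.2) := by
      ext <;> simp
    rw [h1]
    exact h.contDiffAt_spinMap hφ hr hq.1 _ hq.2
  have hfirst : ∀ t s, (spinMap φ ((t - round t, 0), s)).1.1 ∈ Ico (-(1 / 2) : ℝ) (1 / 2) := by
    intro t s
    obtain ⟨q1, -, q3⟩ := h.spinRatio_bound hr (hround'' t) s (w := 0) (by simpa using hr0)
    rcases q3 with q3 | ⟨-, q3⟩
    · simp only [spinMap, q3, one_mul]; exact hround t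
    · have h1 : |(spinMap φ ((t - round t, 0), s)).1.1| < 1 / 4 := by
        simpa only [spinMap, abs_mul, abs_of_pos q1] using q3
      have h2 := abs_lt.1 h1
      exact ⟨by linarith, by linarith⟩
  refine exists_collaredConcordant (Φ := Φ) (L := 4) (r := r)
    (φ₀ := fun p => stdTorus (twist τ (reverseGerm φ (φ p)))) (φ₁ := fun p => stdTorus (twist τ p))
    (by norm_num) hr0 ?_ ?_ ?_ ?_ ?_ ?_ ?_ hP
  · intro t w s
    simp only [hΦ, round_add_one]
    congr 4
    push_cast; ring
  · intro t s _
    filter_upwards [(hΦk t s).eventually_nhds, hlocn t s] with q hq hq'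
    refine ⟨?_, embOn_stdTorus.mem_sphere _ (mem_univ _)⟩
    refine ContDiffAt.congr_of_eventuallyEq ?_ hq
    refine hMs.contDiffAt.comp q ?_
    exact ContDiffAt.comp q (g := spinMap φ) (hcd t q hq') (hsh _).contDiffAt
  · rintro ⟨t, w⟩ hw s hs
    have h1 := h.reverseGerm_comp hr (hround' t) hw
    have h2 : stdTorus (twist τ (reverseGerm φ (φ (t, w)))) =
        stdTorus (twist τ (reverseGerm φ (φ (t - round t, w)))) := by
      have h3 := periodic_int (φ := fun p => stdTorus (twist τ (reverseGerm φ (φ p))))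
        (fun t w => by
          rw [h.reverseGerm_comp_equivariant]
          exact hE.periodic (reverseGerm φ (φ (t, w))).1 (reverseGerm φ (φ (t, w))).2 ▸ by
            congr 2; ext <;> simp) (round t) (t - round t, w)
      rwa [Prod.mk_add_mk, add_zero, sub_add_cancel] at h3
    rw [h2, h1]
    simp only [hΦ, hM, spinMap, spinEta_of_nonpos hs, spinLevel_of_nonpos hs,
      zero_pow two_ne_zero, add_zero]
  · rintro ⟨t, w⟩ hw s hs
    have h1 : b ^ 2 ≤ (t - round t) ^ 2 + spinEta s ^ 2 := by
      have h2 : b ^ 2 ≤ spinEta s ^ 2 := pow_le_pow_left₀ hb0.le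
        (by linarith [monotone_spinEta hs, quarter_lt_spinEta_four]) 2
      nlinarith [sq_nonneg (t - round t)]
    have h3 := hM1 (round t) (t - round t) w s
    rw [sub_add_cancel] at h3
    simp only [hΦ]
    rw [h.spinMap_of_ge (hround'' t) h1, ← h3]
  · rintro ⟨t, w⟩ hw s hs
    exact h.spinLevel_mem hr (hround'' t) hs hw
  · intro t t' s hs s' hs' he
    have e1 : stdTorus (twist τ (spinMap φ ((t - round t, 0), s)).1) =
      stdTorus (twist τ (spinMap φ ((t' - round t', 0), s')).1) := congrArg Prod.fst he
    have e2 : (spinMap φ ((t - round t, 0), s)).2 = (spinMap φ ((t' - round t', 0), s')).2 :=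
      congrArg (fun x : R4 × ℝ => x.2) he
    obtain ⟨k, hk⟩ := hE.injective _ (mem_univ _) _ (mem_univ _) e1
    have hk1 : (spinMap φ ((t' - round t', 0), s')).1.1 = (spinMap φ ((t - round t, 0), s)).1.1 + k :=
      congrArg Prod.fst hk
    have f1 := hfirst t s
    have f2 := hfirst t' s'
    have hk0 : k = 0 := by
      have h1 : (k : ℝ) < 1 := by linarith [f1.1, f2.2]
      have h2 : (-1 : ℝ) < k := by linarith [f1.2, f2.1]
      have h3 : k < 1 := by exact_mod_cast h1
      have h4 : -1 < k := by exact_mod_cast h2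
      omega
    rw [hk0] at hk
    have e3 : (spinMap φ ((t' - round t', 0), s')).1 = (spinMap φ ((t - round t, 0), s)).1 :=
      hk.trans (by simp)
    obtain ⟨g1, g2⟩ := h.spinMap_injective hr0 hr (hround'' t) (hround'' t') hs.1 hs'.1
      (Prod.ext e3.symm e2)
    exact ⟨g2, round t' - round t, by push_cast; linarith⟩
  · intro t s _
    rw [(hΦk t s).fderiv_eq]
    have h0 : ((t, (0 : ℂ)), s) - (((round t : ℝ), (0 : ℂ)), (0 : ℝ)) = ((t - round t, 0), s) := by
      ext <;> simp
    have hc := h.contDiffAt_spinMap hφ hr (hround'' t) s (w := 0) (by simpa using hr0)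
    have hi1 : Function.Injective (fderiv ℝ (fun q : (ℝ × ℂ) × ℝ =>
        spinMap φ (q - (((round t : ℝ), 0), 0))) ((t, 0), s)) := by
      refine injective_fderiv_comp (g := spinMap φ) (f := fun q => q - (((round t : ℝ), 0), 0)) ?_
        ((hsh _).differentiable (by simp) _) ?_ ?_
      · rw [h0]; exact hc.differentiableAt (by simp)
      · rw [h0]; exact h.injective_fderiv_spinMap hφ hr0 hr (hround'' t) s
      · rw [fderiv_sub_const, fderiv_fun_id]; exact Function.injective_id
    refine injective_fderiv_comp (g := M) (f := fun q => spinMap φ (q - (((round t : ℝ), 0), 0)))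
      (hMs.differentiable (by simp) _) ?_ ?_ hi1
    · refine DifferentiableAt.comp (g := spinMap φ) _ ?_ ((hsh _).differentiable (by simp) _)
      rw [h0]; exact hc.differentiableAt (by simp)
    · set q := spinMap φ (((t, 0), s) - (((round t : ℝ), 0), 0))
      have h1 : HasFDerivAt (fun p => stdTorus (twist τ p))
          (fderiv ℝ (fun p => stdTorus (twist τ p)) q.1) q.1 :=
        ((hE.smooth q.1 (mem_univ _)).differentiableAt (by simp)).hasFDerivAt
      have h2 : HasFDerivAt M _ q :=
        (h1.comp q hasFDerivAt_fst).prodMk hasFDerivAt_snd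
      rw [h2.fderiv]
      refine injective_of_forall_eq_zero fun v hv => ?_
      have h3 := congrArg Prod.fst hv
      have h4 : v.2 = 0 := congrArg Prod.snd hv
      refine Prod.ext (hE.immersion q.1 (mem_univ _) ?_) h4
      rw [Prod.fst_zero, map_zero]
      exact h3

end KnottedGerm

/-! ### Maps of the solid torus of degree one -/

/-- `f` is a lift of a smooth embedding of the part `D` of `S¹ × ℂ`, of degree one. -/
structure TorusEmbOn (D : Set (ℝ × ℂ)) (f : ℝ × ℂ → ℝ × ℂ) : Prop where
  smooth : ∀ p ∈ D, ContDiffAt ℝ ∞ f p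
  equivariant : ∀ t w, f (t + 1, w) = f (t, w) + (1, 0)
  injective : ∀ p ∈ D, ∀ q ∈ D, ∀ k : ℤ, f q = f p + ((k : ℝ), 0) → ∃ n : ℤ, q = p + ((n : ℝ), 0)
  immersion : ∀ p ∈ D, Function.Injective (fderiv ℝ f p)

theorem TorusEmbOn.equivariant_add {D : Set (ℝ × ℂ)} {f : ℝ × ℂ → ℝ × ℂ} (h : TorusEmbOn D f)
    (p : ℝ × ℂ) : f (p + (1, 0)) = f p + (1, 0) := by
  simpa using equivariant_int h.equivariant 1 p

theorem TorusEmbOn.comp {D D' : Set (ℝ × ℂ)} {f g : ℝ × ℂ → ℝ × ℂ} (hg : TorusEmbOn D' g)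
    (hf : TorusEmbOn D f) (hD : MapsTo f D D') : TorusEmbOn D fun p => g (f p) where
  smooth p hp := ContDiffAt.comp p (g := g) (hg.smooth _ (hD hp)) (hf.smooth p hp)
  equivariant t w := by rw [hf.equivariant, hg.equivariant_add]
  injective p hp q hq k h := by
    obtain ⟨n, hn⟩ := hg.injective _ (hD hp) _ (hD hq) k h
    exact hf.injective p hp q hq n hn
  immersion p hp := injective_fderiv_comp ((hg.smooth _ (hD hp)).differentiableAt (by simp))
    ((hf.smooth p hp).differentiableAt (by simp)) (hg.immersion _ (hD hp)) (hf.immersion p hp)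

theorem EmbOn.comp {D D' : Set (ℝ × ℂ)} {f : ℝ × ℂ → ℝ × ℂ} {ψ : ℝ × ℂ → R4} (hψ : EmbOn D' ψ)
    (hf : TorusEmbOn D f) (hD : MapsTo f D D') : EmbOn D fun p => ψ (f p) where
  smooth p hp := ContDiffAt.comp p (g := ψ) (hψ.smooth _ (hD hp)) (hf.smooth p hp)
  periodic t w := by
    rw [hf.equivariant]
    simpa using periodic_int hψ.periodic 1 (f (t, w))
  mem_sphere p hp := hψ.mem_sphere _ (hD hp)
  injective p hp q hq h := by
    obtain ⟨n, hn⟩ := hψ.injective _ (hD hp) _ (hD hq) h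
    exact hf.injective p hp q hq n hn
  immersion p hp := injective_fderiv_comp ((hψ.smooth _ (hD hp)).differentiableAt (by simp))
    ((hf.smooth p hp).differentiableAt (by simp)) (hψ.immersion _ (hD hp)) (hf.immersion p hp)

theorem TorusEmbOn.torusCurve {D : Set (ℝ × ℂ)} {f : ℝ × ℂ → ℝ × ℂ} (hf : TorusEmbOn D f)
    {P : ℝ → ℝ × ℂ} (hP : TorusCurve P) (hD : ∀ t, P t ∈ D) : TorusCurve fun t => f (P t) where
  smooth := contDiff_iff_contDiffAt.2 fun t =>
    ContDiffAt.comp t (g := f) (hf.smooth _ (hD t)) hP.smooth.contDiffAt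
  periodic := by
    obtain ⟨l, hl⟩ := hP.periodic
    exact ⟨l, fun t => by rw [hl, equivariant_int hf.equivariant]⟩
  injective s t := by
    rintro ⟨k, hk⟩
    exact hP.injective s t (hf.injective _ (hD s) _ (hD t) k hk)
  immersion t h0 := by
    have h1 := ((hf.smooth _ (hD t)).differentiableAt (by simp)).hasFDerivAt.comp_hasDerivAt t
      (hP.smooth.differentiable (by simp) t).hasDerivAt
    have h2 : deriv (fun t => f (P t)) t = fderiv ℝ f (P t) (deriv P t) := h1.deriv
    rw [h2] at h0
    exact hP.immersion t (hf.immersion _ (hD t) (h0.trans (map_zero _).symm))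

theorem torusEmbOn_shrink {δ : ℝ} (hδ : δ ≠ 0) : TorusEmbOn univ (shrink δ) where
  smooth _ _ := (contDiff_shrink δ).contDiffAt
  equivariant t w := by simp [shrink]
  injective p _ q _ k h := by
    refine ⟨k, ?_⟩
    have h1 := congrArg Prod.fst h
    have h2 := congrArg Prod.snd h
    simp only [shrink, Prod.fst_add, Prod.snd_add, add_zero] at h1 h2
    exact Prod.ext h1 (by simpa using mul_left_cancel₀ (Complex.ofReal_ne_zero.2 hδ) h2)
  immersion p _ := injective_fderiv_shrink hδ p

theorem circle_exp_add_int_mul {τ : ℝ → ℝ} {n : ℤ} (hn : ∀ t, τ (t + 1) = τ t + n) (t : ℝ) (k : ℤ) :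
    Circle.exp (2 * Real.pi * τ (t + k)) = Circle.exp (2 * Real.pi * τ t) := by
  have h2 : Function.Periodic (fun t => τ t - n * t) 1 := fun t => by simp only [hn]; ring
  have h3 := h2.int_mul k t
  simp only [mul_one] at h3
  refine circle_exp_eq_iff.2 ⟨n * k, ?_⟩
  push_cast
  linarith

theorem twist_add_int {τ : ℝ → ℝ} {n : ℤ} (hn : ∀ t, τ (t + 1) = τ t + n) (p : ℝ × ℂ) (k : ℤ) :
    twist τ (p + ((k : ℝ), 0)) = twist τ p + ((k : ℝ), 0) := by
  simp [twist, circle_exp_add_int_mul hn]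

theorem torusEmbOn_twist {τ : ℝ → ℝ} (hτ : ContDiff ℝ ∞ τ) {n : ℤ} (hn : ∀ t, τ (t + 1) = τ t + n) :
    TorusEmbOn univ (twist τ) where
  smooth _ _ := (contDiff_twist hτ).contDiffAt
  equivariant t w := by simpa using twist_add_int hn (t, w) 1
  injective p _ q _ k h := by
    refine ⟨k, ?_⟩
    rw [← twist_neg_twist τ q, h, twist_add_int (n := -n) (fun t => by rw [hn]; push_cast; ring),
      twist_neg_twist]
  immersion p _ := injective_fderiv_twist hτ p

theorem twist_shrink (τ : ℝ → ℝ) (δ : ℝ) (p : ℝ × ℂ) : twist τ (shrink δ p) = shrink δ (twist τ p) := by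
  simp [twist, shrink, mul_left_comm]

theorem TorusGerm.exists_torusEmbOn {φ : ℝ × ℂ → ℝ × ℂ} (hφ : TorusGerm φ) :
    ∃ r > 0, TorusEmbOn (disc r) φ := by
  obtain ⟨r, hr, h⟩ := hφ.exists_radius
  exact ⟨r, hr, fun p hp => (h p hp).1, hφ.equivariant, fun p hp => (h p hp).2.2,
    fun p hp => (h p hp).2.1⟩

/-! ### Reflection in a meridian disc. -/

/-- The reflection of the solid torus in a meridian disc. -/
def flipTorus (p : ℝ × ℂ) : ℝ × ℂ := (-p.1, p.2)

theorem contDiff_flipTorus : ContDiff ℝ ∞ flipTorus := contDiff_fst.neg.prodMk contDiff_snd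

theorem hasFDerivAt_flipTorus (p : ℝ × ℂ) : HasFDerivAt flipTorus
    ((-ContinuousLinearMap.fst ℝ ℝ ℂ).prod (ContinuousLinearMap.snd ℝ ℝ ℂ)) p :=
  hasFDerivAt_fst.neg.prodMk hasFDerivAt_snd

theorem injective_fderiv_flipTorus (p : ℝ × ℂ) : Function.Injective (fderiv ℝ flipTorus p) := by
  rw [(hasFDerivAt_flipTorus p).fderiv]
  refine injective_of_forall_eq_zero fun v hv => ?_
  have h1 : -v.1 = 0 := congrArg Prod.fst hv
  have h2 : v.2 = 0 := congrArg Prod.snd hv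
  exact Prod.ext (neg_eq_zero.1 h1) h2

theorem TorusGerm.reverse {φ : ℝ × ℂ → ℝ × ℂ} (h : TorusGerm φ) : TorusGerm (reverseGerm φ) where
  smooth t := by
    have h1 : ContinuousAt flipTorus (t, (0 : ℂ)) := contDiff_flipTorus.continuous.continuousAt
    filter_upwards [h1.eventually (h.smooth (-t))] with p hp
    have h2 : ContDiffAt ℝ ∞ (fun p => φ (flipTorus p)) p :=
      ContDiffAt.comp p (g := φ) hp contDiff_flipTorus.contDiffAt
    exact contDiff_flipTorus.contDiffAt.comp p h2
  equivariant := reverseGerm_equivariant h.equivariant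
  core_injective t t' k he := by
    have h1 : φ (-t', 0) = φ (-t, 0) + (((-k : ℤ) : ℝ), 0) := by
      have e1 := congrArg Prod.fst he
      have e2 := congrArg Prod.snd he
      simp only [reverseGerm, Prod.fst_add, Prod.snd_add] at e1 e2
      refine Prod.ext ?_ e2
      simp only [Prod.fst_add, Int.cast_neg]; linarith
    obtain ⟨n, hn⟩ := h.core_injective _ _ _ h1
    exact ⟨-n, by push_cast; linarith⟩
  immersion t := by
    have hd : DifferentiableAt ℝ φ (flipTorus (t, 0)) := (h.contDiffAt (-t)).differentiableAt (by simp)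
    have hf := contDiff_flipTorus.differentiable (by simp)
    exact injective_fderiv_comp (g := flipTorus) (f := fun p => φ (flipTorus p)) (hf _)
      (DifferentiableAt.comp (g := φ) _ hd (hf _)) (injective_fderiv_flipTorus _)
      (injective_fderiv_comp (g := φ) (f := flipTorus) hd (hf _) (h.immersion (-t))
        (injective_fderiv_flipTorus _))

theorem TorusCurve.flip {P : ℝ → ℝ × ℂ} (hP : TorusCurve P) : TorusCurve fun t => flipTorus (P t) where
  smooth := contDiff_flipTorus.comp hP.smooth
  periodic := by
    obtain ⟨l, hl⟩ := hP.periodic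
    refine ⟨-l, fun t => ?_⟩
    rw [hl]
    ext <;> simp [flipTorus]; ring
  injective s t := by
    rintro ⟨k, hk⟩
    refine hP.injective s t ⟨-k, ?_⟩
    have e1 := congrArg Prod.fst hk
    have e2 := congrArg Prod.snd hk
    simp only [flipTorus, Prod.fst_add, Prod.snd_add] at e1 e2
    refine Prod.ext ?_ e2
    simp only [Prod.fst_add, Int.cast_neg]; linarith
  immersion t h0 := by
    have h1 := (hasFDerivAt_flipTorus (P t)).comp_hasDerivAt t
      (hP.smooth.differentiable (by simp) t).hasDerivAt
    have h2 : deriv (fun t => flipTorus (P t)) t = _ := h1.deriv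
    rw [h2, ← (hasFDerivAt_flipTorus (P t)).fderiv] at h0
    exact hP.immersion t (injective_fderiv_flipTorus _ (h0.trans (map_zero _).symm))

theorem reflectOne_stdTorus (p : ℝ × ℂ) : reflectOne (stdTorus p) = stdTorus (flipTorus p) := by
  ext i; fin_cases i <;> simp [reflectOne, stdTorus, flipTorus]

theorem embOn_stdTorus_flipTorus : EmbOn univ fun p => stdTorus (flipTorus p) where
  smooth _ _ := (contDiff_stdTorus.comp contDiff_flipTorus).contDiffAt
  periodic t w := by
    have h1 := embOn_stdTorus.periodic (-(t + 1)) w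
    rw [show -(t + 1) + 1 = -t by ring] at h1
    exact h1.symm
  mem_sphere _ _ := embOn_stdTorus.mem_sphere _ (mem_univ _)
  injective p _ q _ h := by
    obtain ⟨n, hn⟩ := embOn_stdTorus.injective _ (mem_univ _) _ (mem_univ _) h
    refine ⟨-n, ?_⟩
    have e1 := congrArg Prod.fst hn
    have e2 := congrArg Prod.snd hn
    simp only [flipTorus, Prod.fst_add, Prod.snd_add] at e1 e2
    refine Prod.ext ?_ e2
    simp only [Prod.fst_add, Int.cast_neg]; linarith
  immersion p _ := injective_fderiv_comp (contDiff_stdTorus.differentiable (by simp) _)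
    (contDiff_flipTorus.differentiable (by simp) _) (embOn_stdTorus.immersion _ (mem_univ _))
    (injective_fderiv_flipTorus p)

/-- With smallness expressed by a filter, one shrinking factor can be chosen for several
deformations at once. -/
theorem eventually_nhdsGT_of_exists_Ioc {p : ℝ → Prop} (h : ∃ δ₀ > 0, ∀ δ ∈ Ioc 0 δ₀, p δ) :
    ∀ᶠ δ in 𝓝[>] (0 : ℝ), p δ := by
  obtain ⟨d, hd, H⟩ := h
  exact mem_of_superset (Ioc_mem_nhdsGT hd) H

theorem TorusCurve.eventually_shrink_mem_disc {P : ℝ → ℝ × ℂ} (hP : TorusCurve P) {r : ℝ}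
    (hr : 0 < r) : ∀ᶠ δ in 𝓝[>] (0 : ℝ), ∀ u ∈ Icc 0 δ, ∀ t, _root_.shrink u (P t) ∈ disc r := by
  obtain ⟨B, hB, hPB⟩ := hP.exists_bound
  refine eventually_nhdsGT_of_exists_Ioc ⟨r / (2 * B), by positivity, fun δ hδ u hu t => ?_⟩
  have h1 : ‖(_root_.shrink u (P t)).2‖ = u * ‖(P t).2‖ := norm_shrink_snd hu.1 _
  have h2 : u * ‖(P t).2‖ ≤ r / (2 * B) * B :=
    mul_le_mul (hu.2.trans hδ.2) (hPB t) (norm_nonneg _) (by positivity)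
  have h3 : r / (2 * B) * B = r / 2 := by field_simp
  change ‖(_root_.shrink u (P t)).2‖ < r
  rw [h1]; linarith

/-! ### Disjointness of the knotted arc from its mirror image. -/

namespace KnottedGerm

variable {a b r : ℝ} {φ : ℝ × ℂ → ℝ × ℂ}

theorem fst_core_mem (h : KnottedGerm a b φ) {u : ℝ} (hu : u ∈ Ioc (0 : ℝ) (1 / 2)) :
    (φ (u, 0)).1 ∈ Ioc (0 : ℝ) (1 / 2) ∧ (u < 1 / 2 → (φ (u, 0)).1 < 1 / 2) := by
  have ha := h.pos
  have hb := h.lt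
  rcases le_or_gt u a with h1 | h1
  · rw [h.eq_id u 0 ⟨by linarith [hu.1], h1⟩]; exact ⟨hu, id⟩
  rcases le_or_gt u b with h2 | h2
  · have h3 := h.arc u ⟨h1.le, h2⟩
    exact ⟨⟨h3.1, by linarith [h3.2]⟩, fun _ => by linarith [h3.2]⟩
  · rw [h.eq_id_of_mem (t := u) ⟨h2.le, by linarith [hu.2]⟩ 0]; exact ⟨hu, id⟩

/-- Shrinking the fibre between a knotted germ and its mirror image. -/
theorem torusFamily_shrink (h : KnottedGerm a b φ) {δ : ℝ} (hδ : 0 < δ) (hδ1 : δ ≤ 1) :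
    TorusFamily (fun q => reverseGerm φ (shrink (δ + q.2 * (1 - δ)) (φ q.1))) ∧
      ∀ t, ∀ s ∈ Icc (0 : ℝ) 1,
        ‖(reverseGerm φ (shrink (δ + s * (1 - δ)) (φ (t, 0)))).2‖ ≤ 1 := by
  set F : (ℝ × ℂ) × ℝ → ℝ × ℂ := fun q => reverseGerm φ (shrink (δ + q.2 * (1 - δ)) (φ q.1)) with hF
  have ha := h.pos
  have hb := h.lt
  have hab := h.le
  have hrev := h.germ.reverse
  have hl : ∀ s ∈ Icc (0 : ℝ) 1, 0 < δ + s * (1 - δ) ∧ δ + s * (1 - δ) ≤ 1 := fun s hs =>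
    ⟨by nlinarith [hs.1, hs.2], by nlinarith [hs.1, hs.2]⟩
  have heq : ∀ t w s, F ((t + 1, w), s) = F ((t, w), s) + (1, 0) := fun t w s => by
    simp only [hF]
    rw [h.germ.equivariant, ← reverseGerm_equivariant h.germ.equivariant]
    congr 1; ext <;> simp [shrink]
  have heqk : ∀ (k : ℤ) (p : ℝ × ℂ) s, F (p, s) = F (p - ((k : ℝ), 0), s) + ((k : ℝ), 0) :=
    fun k p s => by
      have h1 := equivariant_int (φ := fun p => F (p, s)) (fun t w => heq t w s) k (p - ((k : ℝ), 0))
      rwa [sub_add_cancel] at h1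
  -- the two local forms of the family
  have hneg : ∀ u ∈ Ioo (b - 1) a, ∀ w s,
      F ((u, w), s) = reverseGerm φ (shrink (δ + s * (1 - δ)) (u, w)) := fun u hu w s => by
    simp only [hF, h.eq_id u w ⟨hu.1.le, hu.2.le⟩]
  have hpos : ∀ p s, (φ p).1 ∈ Icc (-a) (1 - b) → F (p, s) = shrink (δ + s * (1 - δ)) (φ p) :=
    fun p s hp => h.reverseGerm_eq_id hp _
  have hpos' : ∀ u ∈ Ioc (0 : ℝ) (1 / 2), (φ (u, 0)).1 ∈ Ioo (-a) (1 - b) := fun u hu =>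
    ⟨by linarith [(h.fst_core_mem hu).1.1], by linarith [(h.fst_core_mem hu).1.2]⟩
  have hround : ∀ t : ℝ, t - round t ∈ Ico (-(1 / 2) : ℝ) (1 / 2) := fun t => by
    rw [round_eq]
    have h1 := Int.floor_le (t + 1 / 2)
    have h2 := Int.lt_floor_add_one (t + 1 / 2)
    exact ⟨by linarith, by linarith⟩
  have hcore : ∀ t s, F ((t, 0), s) = F ((t - round t, 0), s) + ((round t : ℝ), 0) := fun t s => by
    have h1 := heqk (round t) (t, 0) s
    rwa [Prod.mk_sub_mk, sub_zero] at h1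
  have hcont : ContDiff ℝ ∞ fun q : (ℝ × ℂ) × ℝ => shrink (δ + q.2 * (1 - δ)) q.1 := by
    have h1 : ContDiff ℝ ∞ fun q : (ℝ × ℂ) × ℝ => ((δ + q.2 * (1 - δ) : ℝ) : ℂ) :=
      Complex.ofRealCLM.contDiff.comp (contDiff_const.add (contDiff_snd.mul contDiff_const))
    exact (contDiff_fst.comp contDiff_fst).prodMk (h1.mul (contDiff_snd.comp contDiff_fst))
  -- In the first case `φ` is the identity near the point; in the second its core value lies where
  -- `reverseGerm φ` is. So the shrinking is always next to an identity map, and only one arc is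
  -- involved.
  have hdich : ∀ t : ℝ, t - round t ∈ Ioo (b - 1) a ∨ t - round t ∈ Ioc (0 : ℝ) (1 / 2) := fun t => by
    rcases le_or_gt (t - round t) 0 with h1 | h1
    · exact Or.inl ⟨by linarith [(hround t).1], by linarith⟩
    · exact Or.inr ⟨h1, (hround t).2.le⟩
  have hnear : ∀ t s, ContinuousAt (fun q : (ℝ × ℂ) × ℝ => (q.1.1 - (round t : ℝ))) ((t, 0), s) :=
    fun t s => by fun_prop
  have hφc : ∀ t s, ContinuousAt (fun q : (ℝ × ℂ) × ℝ => (φ (q.1 - ((round t : ℝ), 0))).1)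
      ((t, 0), s) := fun t s => by
    have h1 : ContinuousAt φ (((t, (0 : ℂ)), s).1 - ((round t : ℝ), 0)) := by
      have h2 : ((t, (0 : ℂ)), s).1 - ((round t : ℝ), (0 : ℂ)) = (t - round t, 0) := by ext <;> simp
      rw [h2]; exact (h.germ.contDiffAt _).continuousAt
    exact (ContinuousAt.comp (f := fun q : (ℝ × ℂ) × ℝ => q.1 - ((round t : ℝ), (0 : ℂ))) h1
      (by fun_prop)).fst
  refine ⟨⟨fun t s hs => ?_, heq, fun s hs t t' k he => ?_, fun t s hs => ?_⟩, fun t s hs => ?_⟩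
  · rcases hdich t with hu | hu
    · have h1 := (hnear t s).eventually (isOpen_Ioo.mem_nhds hu)
      have h2 : ∀ᶠ q in 𝓝 ((t, (0 : ℂ)), s),
          ContDiffAt ℝ ∞ (reverseGerm φ) (shrink (δ + q.2 * (1 - δ)) q.1) := by
        have h3 : ContinuousAt (fun q : (ℝ × ℂ) × ℝ => shrink (δ + q.2 * (1 - δ)) q.1) ((t, 0), s) :=
          hcont.continuous.continuousAt
        refine h3.eventually ?_
        have h4 : shrink (δ + s * (1 - δ)) (t, 0) = (t, 0) := by simp [shrink]
        simp only [h4]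
        exact hrev.smooth t
      filter_upwards [h1.eventually_nhds, h2] with q hq hq2
      have h5 : ContDiffAt ℝ ∞ (fun q : (ℝ × ℂ) × ℝ => reverseGerm φ (shrink (δ + q.2 * (1 - δ)) q.1))
          q := ContDiffAt.comp q (g := reverseGerm φ) hq2 hcont.contDiffAt
      refine h5.congr_of_eventuallyEq ?_
      filter_upwards [hq] with z hz
      have h6 := heqk (round t) z.1 z.2
      have h7 : z.1 - ((round t : ℝ), (0 : ℂ)) = (z.1.1 - round t, z.1.2) := by ext <;> simp
      rw [h7, hneg _ hz] at h6
      change F (z.1, z.2) = _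
      rw [h6, ← equivariant_int hrev.equivariant]
      congr 1; ext <;> simp [shrink]
    · have h1 := (hφc t s).eventually (isOpen_Ioo.mem_nhds (by
        have h2 : ((t, (0 : ℂ)), s).1 - ((round t : ℝ), (0 : ℂ)) = (t - round t, 0) := by ext <;> simp
        beta_reduce
        rw [h2]; exact hpos' _ hu))
      have h2 : ∀ᶠ q in 𝓝 ((t, (0 : ℂ)), s), ContDiffAt ℝ ∞ φ q.1 :=
        (continuousAt_fst (p := ((t, (0 : ℂ)), s))).eventually (h.germ.smooth t)
      filter_upwards [h1.eventually_nhds, h2] with q hq hq2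
      have h5 : ContDiffAt ℝ ∞ (fun q : (ℝ × ℂ) × ℝ => shrink (δ + q.2 * (1 - δ)) (φ q.1)) q := by
        have h6 : ContDiffAt ℝ ∞ (fun q : (ℝ × ℂ) × ℝ => (φ q.1, q.2)) q :=
          (ContDiffAt.comp q (g := φ) hq2 contDiffAt_fst).prodMk contDiffAt_snd
        exact hcont.contDiffAt.comp q h6
      refine h5.congr_of_eventuallyEq ?_
      filter_upwards [hq] with z hz
      have h6 := heqk (round t) z.1 z.2
      rw [hpos _ _ ⟨hz.1.le, hz.2.le⟩] at h6
      have h7 := equivariant_int h.germ.equivariant (round t) (z.1 - ((round t : ℝ), 0))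
      rw [sub_add_cancel] at h7
      change F (z.1, z.2) = _
      rw [h6, h7]
      ext <;> simp [shrink]
  · have hl0 := (hl s hs).1
    -- The two arcs stay in complementary half periods, so injectivity on the core has to be checked
    -- only within each half.
    have hform : ∀ t : ℝ,
        (t - round t ∈ Icc (-(1 / 2) : ℝ) 0 ∧
          F ((t - round t, 0), s) = reverseGerm φ (t - round t, 0) ∧
          (F ((t - round t, 0), s)).1 ∈ Icc (-(1 / 2) : ℝ) 0) ∨
        (F ((t - round t, 0), s) = shrink (δ + s * (1 - δ)) (φ (t - round t, 0)) ∧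
          (F ((t - round t, 0), s)).1 ∈ Ioo (0 : ℝ) (1 / 2)) := by
      intro t
      have hu := hround t
      rcases le_or_gt (t - round t) 0 with h1 | h1
      · have h2 : F ((t - round t, 0), s) = reverseGerm φ (t - round t, 0) := by
          rw [hneg _ ⟨by linarith [hu.1], by linarith⟩]
          congr 1; simp [shrink]
        refine Or.inl ⟨⟨hu.1, h1⟩, h2, ?_⟩
        rw [h2]
        rcases h1.eq_or_lt with h3 | h3
        · rw [h3, h.reverseGerm_eq_id ⟨by linarith, by linarith⟩]
          norm_num
        · have h4 := (h.fst_core_mem (u := -(t - round t)) ⟨by linarith, by linarith [hu.1]⟩).1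
          exact ⟨neg_le_neg h4.2, neg_nonpos.2 h4.1.le⟩
      · have h0 : t - round t ∈ Ioc (0 : ℝ) (1 / 2) := ⟨h1, hu.2.le⟩
        have h2 := hpos (t - round t, 0) s (Ioo_subset_Icc_self (hpos' _ h0))
        refine Or.inr ⟨h2, ?_⟩
        rw [h2]
        exact ⟨(h.fst_core_mem h0).1.1, (h.fst_core_mem h0).2 hu.2⟩
    have hIco : ∀ t : ℝ, (F ((t - round t, 0), s)).1 ∈ Ico (-(1 / 2) : ℝ) (1 / 2) := fun t => by
      rcases hform t with ⟨-, -, h1⟩ | ⟨-, h1⟩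
      · exact ⟨h1.1, by linarith [h1.2]⟩
      · exact ⟨by linarith [h1.1], h1.2⟩
    rw [hcore t, hcore t'] at he
    have e1 := congrArg Prod.fst he
    have e2 := congrArg Prod.snd he
    simp only [Prod.fst_add, Prod.snd_add, add_zero] at e1 e2
    have f1 := hIco t
    have f2 := hIco t'
    have hk : round t' - round t - k = 0 := by
      have h1 : ((round t' - round t - k : ℤ) : ℝ) < 1 := by
        push_cast; linarith [f1.2, f2.1]
      have h2 : (-1 : ℝ) < ((round t' - round t - k : ℤ) : ℝ) := by
        push_cast; linarith [f1.1, f2.2]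
      have h3 : round t' - round t - k < 1 := by exact_mod_cast h1
      have h4 : -1 < round t' - round t - k := by exact_mod_cast h2
      omega
    have hk' : (round t' : ℝ) - round t - k = 0 := by exact_mod_cast hk
    have e3 : F ((t' - round t', 0), s) = F ((t - round t, 0), s) :=
      Prod.ext (by linarith) e2
    have hfin : ∃ n : ℤ, t' - round t' = t - round t + n := by
      rcases hform t with ⟨-, g1, g2⟩ | ⟨g1, g2⟩ <;> rcases hform t' with ⟨-, g1', g2'⟩ | ⟨g1', g2'⟩
      · rw [g1, g1'] at e3
        exact hrev.core_injective _ _ 0 (by rw [e3]; ext <;> simp)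
      · rw [e3] at g2'
        exact absurd g2.2 (not_le.2 g2'.1)
      · rw [e3] at g2'
        exact absurd g2'.2 (not_le.2 g2.1)
      · rw [g1, g1'] at e3
        have e4 := congrArg Prod.fst e3
        have e5 := congrArg Prod.snd e3
        have e6 := mul_left_cancel₀ (Complex.ofReal_ne_zero.2 hl0.ne') e5
        have e7 : φ (t' - round t', 0) = φ (t - round t, 0) := Prod.ext e4 e6
        exact h.germ.core_injective _ _ 0 (by rw [e7]; ext <;> simp)
    obtain ⟨n, hn⟩ := hfin
    exact ⟨n + round t' - round t, by push_cast; linarith⟩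
  · have hl0 := (hl s hs).1
    rcases hdich t with hu | hu
    · have h1 := (hnear t s).eventually (isOpen_Ioo.mem_nhds hu)
      have hc : ContinuousAt (fun p : ℝ × ℂ => (p, s)) (t, 0) := by fun_prop
      have h2 : (fun p => F (p, s)) =ᶠ[𝓝 (t, 0)]
          fun p => reverseGerm φ (shrink (δ + s * (1 - δ)) p) := by
        filter_upwards [hc.eventually h1] with z hz
        have h6 := heqk (round t) z s
        have h7 : z - ((round t : ℝ), (0 : ℂ)) = (z.1 - round t, z.2) := by ext <;> simp
        rw [h7, hneg _ hz] at h6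
        rw [h6, ← equivariant_int hrev.equivariant]
        congr 1; ext <;> simp [shrink]
      rw [h2.fderiv_eq]
      have h4 : shrink (δ + s * (1 - δ)) (t, 0) = (t, 0) := by simp [shrink]
      refine injective_fderiv_comp (g := reverseGerm φ) ?_
        ((contDiff_shrink _).differentiable (by simp) _) ?_ (injective_fderiv_shrink hl0.ne' _)
      · rw [h4]; exact (hrev.contDiffAt t).differentiableAt (by simp)
      · rw [h4]; exact hrev.immersion t
    · have h1 := (hφc t s).eventually (isOpen_Ioo.mem_nhds (by
        have h2 : ((t, (0 : ℂ)), s).1 - ((round t : ℝ), (0 : ℂ)) = (t - round t, 0) := by ext <;> simp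
        beta_reduce
        rw [h2]; exact hpos' _ hu))
      have hc : ContinuousAt (fun p : ℝ × ℂ => (p, s)) (t, 0) := by fun_prop
      have h2 : (fun p => F (p, s)) =ᶠ[𝓝 (t, 0)] fun p => shrink (δ + s * (1 - δ)) (φ p) := by
        filter_upwards [hc.eventually h1] with z hz
        have h6 := heqk (round t) z s
        rw [hpos _ _ ⟨hz.1.le, hz.2.le⟩] at h6
        have h7 := equivariant_int h.germ.equivariant (round t) (z - ((round t : ℝ), 0))
        rw [sub_add_cancel] at h7
        rw [h6, h7]
        ext <;> simp [shrink]
      rw [h2.fderiv_eq]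
      exact injective_fderiv_comp (g := shrink (δ + s * (1 - δ)))
        ((contDiff_shrink _).differentiable (by simp) _)
        ((h.germ.contDiffAt t).differentiableAt (by simp)) (injective_fderiv_shrink hl0.ne' _)
        (h.germ.immersion t)
  · change ‖(F ((t, 0), s)).2‖ ≤ 1
    rw [hcore, Prod.snd_add, add_zero]
    rcases hdich t with hu | hu
    · rw [hneg _ hu]
      have h4 : shrink (δ + s * (1 - δ)) (t - round t, 0) = (t - round t, 0) := by simp [shrink]
      rw [h4]
      exact h.norm_core _
    · rw [hpos _ _ (Ioo_subset_Icc_self (hpos' _ hu)), norm_shrink_snd (hl s hs).1.le]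
      exact mul_le_one₀ (hl s hs).2 (norm_nonneg _) (h.norm_core _)

/-- Where `reverseGerm φ` is not the identity, both the parameter and the value lie over the quarter
period in which the twist is trivial. -/
theorem exists_reverseGerm_twist (h : KnottedGerm a b φ) {τ : ℝ → ℝ} {n : ℤ}
    (hn : ∀ t, τ (t + 1) = τ t + n) (hτ0 : ∀ t ∈ Icc (-(1 / 4) : ℝ) (1 / 4), τ t = 0) :
    ∃ r > 0, ∀ p ∈ disc r, reverseGerm φ (twist τ p) = twist τ (reverseGerm φ p) := by
  obtain ⟨r, hr0, -, hr⟩ := h.exists_radius_arc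
  have ha := h.pos
  have hb := h.lt
  have hab := h.le
  have hrev := h.germ.reverse
  refine ⟨r, hr0, fun p hp => ?_⟩
  have htw : ∀ u ∈ Icc (-(1 / 4) : ℝ) (1 / 4), ∀ w, twist τ (u, w) = (u, w) := fun u hu w => by
    simp [twist, hτ0 u hu]
  have key : ∀ u : ℝ, |u| ≤ 1 / 2 → ∀ w : ℂ, ‖w‖ < r →
      reverseGerm φ (twist τ (u, w)) = twist τ (reverseGerm φ (u, w)) := by
    intro u hu w hw
    have hu' := abs_le.1 hu
    have hid : (∀ w, reverseGerm φ (u, w) = (u, w)) →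
        reverseGerm φ (twist τ (u, w)) = twist τ (reverseGerm φ (u, w)) := fun hid => by
      rw [hid w]; exact hid _
    rcases le_or_gt (-a) u with h1 | h1
    · exact hid fun w => h.reverseGerm_eq_id ⟨h1, by linarith⟩ w
    rcases le_or_gt u (-b) with h2 | h2
    · exact hid fun w => by
        simp only [reverseGerm, h.eq_id_of_mem (t := -u) ⟨by linarith, by linarith⟩ w, neg_neg]
    · have h3 := hr (-u) ⟨by linarith, by linarith⟩ w hw
      rw [htw u ⟨by linarith, by linarith⟩]
      exact (htw (reverseGerm φ (u, w)).1 ⟨neg_le_neg h3.2.le, (neg_nonpos.2 h3.1.le).trans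
        (by norm_num)⟩ (reverseGerm φ (u, w)).2).symm
  have h1 := key (p.1 - round p.1) (abs_sub_round p.1) p.2 hp
  have h2 : p = (p.1 - round p.1, p.2) + ((round p.1 : ℝ), 0) := by ext <;> simp
  rw [h2, twist_add_int hn, equivariant_int hrev.equivariant, equivariant_int hrev.equivariant,
    twist_add_int hn, h1]

end KnottedGerm

/-! ### Twisted satellites -/

theorem TorusEmbOn.mono {D D' : Set (ℝ × ℂ)} {f : ℝ × ℂ → ℝ × ℂ} (h : TorusEmbOn D f)
    (hD : D' ⊆ D) : TorusEmbOn D' f :=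
  ⟨fun p hp => h.smooth p (hD hp), h.equivariant, fun p hp q hq => h.injective p (hD hp) q (hD hq),
    fun p hp => h.immersion p (hD hp)⟩

theorem shrink_mem_solidTorus {p : ℝ × ℂ} (hp : p ∈ solidTorus) {u : ℝ} (hu : u ∈ Icc (0 : ℝ) 1) :
    shrink u p ∈ solidTorus := by
  change ‖(shrink u p).2‖ ≤ 1
  rw [norm_shrink_snd hu.1]
  exact mul_le_one₀ hu.2 (norm_nonneg _) hp

theorem shrink_half_mem_disc {p : ℝ × ℂ} {R : ℝ} (hp : p ∈ disc (2 * R)) :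
    shrink (1 / 2) p ∈ disc R := by
  have h1 : ‖p.2‖ < 2 * R := hp
  change ‖(shrink (1 / 2) p).2‖ < R
  rw [norm_shrink_snd (by norm_num)]
  linarith

theorem solidTorus_subset_disc_two : solidTorus ⊆ disc 2 := fun p hp =>
  (show ‖p.2‖ ≤ 1 from hp).trans_lt one_lt_two

theorem collaredConcordant_stdTorus_twist_shrink {τ : ℝ → ℝ} (hτ : ContDiff ℝ ∞ τ) {n : ℤ}
    (hn : ∀ t, τ (t + 1) = τ t + n) {P : ℝ → ℝ × ℂ} (hP : TorusCurve P) {δ : ℝ} (hδ : 0 < δ)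
    (hδ1 : δ ≤ 1) : CollaredConcordant (fun t => stdTorus (twist τ (P t)))
      fun t => stdTorus (twist τ (shrink δ (P t))) :=
  (embOn_stdTorus_twist hτ hn).collaredConcordant_shrink hP hδ hδ1 fun _ _ _ => mem_univ _

/-- The deformation of one twist into the other is available close to the core only; hence shrink,
deform and expand again. -/
theorem collaredConcordant_stdTorus_twist_twist {τ τ' : ℝ → ℝ} (hτ : ContDiff ℝ ∞ τ)
    (hτ' : ContDiff ℝ ∞ τ') {n : ℤ} (hn : ∀ t, τ (t + 1) = τ t + n)
    (hn' : ∀ t, τ' (t + 1) = τ' t + n) {P : ℝ → ℝ × ℂ} (hP : TorusCurve P) :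
    CollaredConcordant (fun t => stdTorus (twist τ (P t))) fun t => stdTorus (twist τ' (P t)) := by
  obtain ⟨δ, hδ, h⟩ := (embOn_stdTorus.mono (subset_univ (disc 1))).exists_collaredConcordant_family
    (torusFamily_twist hτ hτ' hn hn') (fun t s _ => by simp [twist]) hP
  have h1 := h (min δ 1) ⟨lt_min hδ one_pos, min_le_left _ _⟩
  simp only [sub_zero, one_mul, zero_mul, add_zero, sub_self, zero_add] at h1
  exact ((collaredConcordant_stdTorus_twist_shrink hτ hn hP (lt_min hδ one_pos)
    (min_le_right _ _)).trans h1).trans (collaredConcordant_stdTorus_twist_shrink hτ' hn' hP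
      (lt_min hδ one_pos) (min_le_right _ _)).symm

theorem FramedTube.eventually_collaredConcordant_twist {α β : ℝ × ℂ → R4} {k n : ℤ}
    (hα : FramedTube 1 α k) (hβ : FramedTube 1 β n) (hcore : ∀ t, α (t, 0) = β (t, 0))
    {τ : ℝ → ℝ} (hτ : ContDiff ℝ ∞ τ) (hτn : ∀ t, τ (t + 1) = τ t + (n - k : ℤ)) {P : ℝ → ℝ × ℂ}
    (hP : TorusCurve P) (hD : ∀ t, P t ∈ disc 1) :
    ∀ᶠ δ in 𝓝[>] (0 : ℝ), CollaredConcordant (fun t => β (P t))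
      fun t => α (twist τ (shrink δ (P t))) := by
  have h1 := eventually_nhdsGT_of_exists_Ioc (hα.embOn.exists_collaredConcordant_twist one_pos
    hβ.embOn hcore hα.orientation_pos hβ.orientation_pos hα.framing hβ.framing hτ hτn hP)
  filter_upwards [h1, Ioc_mem_nhdsGT one_pos] with δ h2 hδ
  refine (hβ.embOn.collaredConcordant_shrink hP hδ.1 hδ.2 fun u hu t => ?_).trans h2
  have h3 := norm_shrink_snd (hδ.1.le.trans hu.1) (P t)
  change ‖(shrink u (P t)).2‖ < 1
  rw [h3]
  exact (mul_le_of_le_one_left (norm_nonneg _) hu.2).trans_lt (hD t)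

theorem Isotopic.collaredConcordant {c K : ℝ → R4} (h : Isotopic c K) (hc : IsKnot c) :
    CollaredConcordant c K := by
  obtain ⟨g, hg, hcc, -⟩ := h.exists_transport
  simpa only [hg] using hcc _ hc

/-- A satellite of the unknot is concordant to its twisted pattern in the standard solid torus. -/
theorem IsSatellite.collaredConcordant_stdTorus_twist {U : ℝ → R4} (hU : IsUnknot U)
    {P : ℝ → ℝ × ℂ} (hP : IsPattern P) {n : ℤ} {K : ℝ → R4} (hK : IsSatellite n U P K)
    {τ : ℝ → ℝ} (hτ : ContDiff ℝ ∞ τ) (hn : ∀ t, τ (t + 1) = τ t + n) :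
    CollaredConcordant K fun t => stdTorus (twist τ (P t)) := by
  obtain ⟨χ, hχ, hχU, hχn, hχK⟩ := hK
  have hPc := hP.torusCurve
  have hmem : ∀ u ∈ Icc (1 / 2 : ℝ) 1, ∀ t, shrink u (P t) ∈ solidTorus := fun u hu t =>
    shrink_mem_solidTorus (hP.mem_solidTorus t) ⟨by linarith [hu.1], hu.2⟩
  have hhalf : (1 / 2 : ℝ) ∈ Icc (1 / 2 : ℝ) 1 := ⟨le_rfl, by norm_num⟩
  -- A pattern may touch the boundary of the closed solid torus; halving the fibre moves it into the
  -- open tube on which framed tubes are defined.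
  have hP2 := hPc.shrink (δ := 1 / 2) (by norm_num)
  have c0 := hχK.collaredConcordant (hχ.embOn.isKnot hPc hP.mem_solidTorus)
  have c1 := hχ.embOn.collaredConcordant_shrink hPc (by norm_num) (by norm_num) hmem
  have hsymm : Isotopic U fun t => stdTorus (t, 0) :=
    hU.2.symm fun t => embOn_stdTorus.mem_sphere _ (mem_univ _)
  obtain ⟨g, hg, hgc, hgf⟩ := hsymm.exists_transport
  have c2 := hgc _ (hχ.embOn.isKnot hP2 (hmem _ hhalf))
  have hβ := hgf 1 χ n one_pos (hχ.framedTube hχn)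
  -- The transported tube has the standard core and framing `n`, the standard tube has framing `0`,
  -- so they differ by `n` twists.
  have c3 := framedTube_stdTorus.eventually_collaredConcordant_twist hβ
    (fun t => by rw [hχU, hg]) hτ (by simpa using hn) hP2 fun t =>
      shrink_half_mem_disc (solidTorus_subset_disc_two.trans (disc_mono (by norm_num))
        (hP.mem_solidTorus t))
  obtain ⟨δ, h3, hδ⟩ := (c3.and (Ioc_mem_nhdsGT one_pos)).exists
  have c4 := collaredConcordant_stdTorus_twist_shrink hτ hn hPc (δ := 1 / 2) (by norm_num)
    (by norm_num)
  have c5 := collaredConcordant_stdTorus_twist_shrink hτ hn hP2 hδ.1 hδ.2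
  exact ((((c0.symm.trans c1).trans c2).trans h3).trans c5.symm).trans c4.symm

theorem mirrorReverse_mem {K : ℝ → R4} (hK : ∀ t, K t ∈ S3) (t : ℝ) : mirrorReverse K t ∈ S3 := by
  have h1 := hK (-t)
  rw [mem_sphere_zero_iff_norm, EuclideanSpace.norm_eq, Fin.sum_univ_four] at h1 ⊢
  simpa [mirrorReverse] using h1

/-- A satellite of `C̄` whose pattern is a satellite of the local knot `C` is concordant to the
twisted pattern in the standard solid torus. -/
theorem IsSatellite.collaredConcordant_of_isSatellitePattern {C : ℝ → R4} {P Q : ℝ → ℝ × ℂ}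
    (hP : IsPattern P) {m r : ℤ} (hQ : IsSatellitePattern r C P Q) {K : ℝ → R4}
    (hK : IsSatellite m (mirrorReverse C) Q K) {τ : ℝ → ℝ} (hτ : ContDiff ℝ ∞ τ)
    (hn : ∀ t, τ (t + 1) = τ t + (m + r : ℤ))
    (hτ0 : ∀ t ∈ Icc (-(1 / 4) : ℝ) (1 / 4), τ t = 0) :
    CollaredConcordant K fun t => stdTorus (twist τ (P t)) := by
  obtain ⟨φ₀, hsm, heq, hmaps, hκ, hiso, htube, hfr, hQe⟩ := hQ
  obtain ⟨-, a, b, φ, h, hgi⟩ := exists_knottedGerm hsm heq hmaps hκ htube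
  obtain ⟨ψ, hψ, hψC, hψm, hψK⟩ := hK
  obtain rfl : Q = fun t => φ₀ (P t) := funext hQe
  have hPc := hP.torusCurve
  have hstdd := contDiff_stdTorus.differentiable (n := ∞) (by simp)
  have hE0 : TorusEmbOn solidTorus φ₀ := by
    refine ⟨hsm, heq, fun p hp q hq k hk => ?_, fun p hp => ?_⟩
    · refine htube.injective p hp q hq ?_
      rw [hk, periodic_int embOn_stdTorus.periodic]
    · exact injective_fderiv_of_comp (hstdd _) ((hsm p hp).differentiableAt (by simp))
        (htube.embOn.immersion p hp)
  have hψe := hψ.embOn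
  have hΨ := hψe.comp hE0 hmaps
  have s1 := hψK.collaredConcordant (hΨ.isKnot hPc hP.mem_solidTorus)
  -- the companion becomes the mirror image of the core of `φ₀`
  have hstdκ : ∀ t : ℝ, stdTorus (φ₀ (t, 0)) ∈ S3 := fun t => embOn_stdTorus.mem_sphere _ (mem_univ _)
  obtain ⟨g₁, hg₁, hgc₁, hgf₁⟩ :=
    (hiso.mirrorReverse.symm (mirrorReverse_mem hstdκ)).exists_transport
  obtain ⟨g₂, hg₂, hgc₂, hgf₂⟩ := (isotopic_mirrorReverse fun t => stdTorus (φ₀ (t, 0))).exists_transport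
  have hf₁ := hgf₁ 1 ψ m one_pos (hψ.framedTube hψm)
  have hf₂ := hgf₂ 1 _ m one_pos hf₁
  set ψ₁ : ℝ × ℂ → R4 := fun p => g₂ (g₁ (ψ p)) with hψ₁
  -- Germ isotopies are tested on tubes of radius two, because the core of a germ may reach radius
  -- one; halving the fibre provides such a tube.
  have hψ₁e : EmbOn (disc 2) fun p => ψ₁ (shrink (1 / 2) p) :=
    hf₂.embOn.comp ((torusEmbOn_shrink (by norm_num)).mono (subset_univ _)) fun p hp =>
      shrink_half_mem_disc (by simpa using hp)
  have s5 := eventually_nhdsGT_of_exists_Ioc (hgi _ hψ₁e P hPc)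
  -- radii on which the germs are embeddings
  obtain ⟨r₁, hr₁, hφ⟩ := h.germ.exists_torusEmbOn
  obtain ⟨r₂, hr₂, hρ⟩ := h.germ.reverse.exists_torusEmbOn
  obtain ⟨r₃, hr₃, hcomm⟩ := h.exists_reverseGerm_twist hn hτ0
  obtain ⟨r₄, hr₄, hφ2⟩ := eventually_core_uniform (p := fun q => ‖(φ q.1).2‖ < 2) (a := 0) (b := 0)
    (fun t w s => by rw [h.germ.equivariant]; simp) (fun t s _ => by
      have h1 : ContinuousAt (fun q : (ℝ × ℂ) × ℝ => ‖(φ q.1).2‖) ((t, 0), s) :=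
        (ContinuousAt.comp (f := fun q : (ℝ × ℂ) × ℝ => q.1) (x := ((t, (0 : ℂ)), s))
          (h.germ.contDiffAt t).continuousAt continuousAt_fst).snd.norm
      exact h1.eventually (Iio_mem_nhds ((h.norm_core t).trans_lt one_lt_two)))
  have hφ2' : ∀ p ∈ disc (min r₁ r₄), φ p ∈ disc 2 := fun p hp =>
    hφ2 p (disc_mono (min_le_right _ _) hp) 0 ⟨le_rfl, le_rfl⟩
  obtain ⟨δ₁, ⟨h5, hd1⟩, hmem1⟩ := ((s5.and (Ioc_mem_nhdsGT one_pos)).and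
    (hPc.eventually_shrink_mem_disc (lt_min hr₁ hr₄))).exists
  have hP1 := hPc.shrink hd1.1.ne'
  have hPδ : ∀ t, shrink δ₁ (P t) ∈ disc (min r₁ r₄) := hmem1 δ₁ ⟨hd1.1.le, le_rfl⟩
  have hsol : ∀ u ∈ Icc δ₁ 1, ∀ t, shrink u (P t) ∈ solidTorus := fun u hu t =>
    shrink_mem_solidTorus (hP.mem_solidTorus t) ⟨hd1.1.le.trans hu.1, hu.2⟩
  have s2 := hΨ.collaredConcordant_shrink hPc hd1.1 hd1.2 hsol
  have hQ1 := hE0.torusCurve hP1 (hsol δ₁ ⟨le_rfl, hd1.2⟩)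
  have hQ1m : ∀ t, φ₀ (shrink δ₁ (P t)) ∈ solidTorus := fun t => hmaps (hsol δ₁ ⟨le_rfl, hd1.2⟩ t)
  have hQ1h := hQ1.shrink (δ := 1 / 2) (by norm_num)
  have s3 := hψe.collaredConcordant_shrink hQ1 (δ := 1 / 2) (by norm_num) (by norm_num)
    fun u hu t => shrink_mem_solidTorus (hQ1m t) ⟨by linarith [hu.1], hu.2⟩
  have hQ1d : ∀ t, shrink (1 / 2) (φ₀ (shrink δ₁ (P t))) ∈ disc 1 := fun t =>
    shrink_half_mem_disc (by simpa using solidTorus_subset_disc_two (hQ1m t))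
  have s4 := (hgc₁ _ (hψe.isKnot hQ1h fun t => disc_one_subset_solidTorus (hQ1d t))).trans
    (hgc₂ _ (hf₁.embOn.isKnot hQ1h hQ1d))
  have t1 := (((s1.symm.trans s2).trans s3).trans s4).trans h5
  -- change the framing of the companion
  have hQ2 := (hφ.torusCurve hP1 fun t => disc_mono (min_le_left _ _) (hPδ t)).shrink
    (δ := 1 / 2) (by norm_num)
  -- The mirrored tube has framing `-r` and the transported one has framing `m`; their difference is
  -- the number `m + r` of twists.
  have hα := (htube.framedTube hfr).reflect one_pos
  have s6 := hα.eventually_collaredConcordant_twist hf₂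
    (fun t => by change _ = g₂ (g₁ (ψ (t, 0))); rw [hψC, hg₁, hg₂]) hτ (by simpa using hn) hQ2 fun t =>
      shrink_half_mem_disc (by simpa using hφ2' _ (hPδ t))
  have hQ3 := ((torusEmbOn_twist hτ hn).torusCurve hQ2 fun _ => mem_univ _).flip
  have s7 := eventually_nhdsGT_of_exists_Ioc
    (hgi _ (embOn_stdTorus_flipTorus.mono (subset_univ _)) _ hQ3)
  obtain ⟨δ₂, ⟨⟨h6, h7⟩, hd2⟩, hmem2⟩ := (((s6.and s7).and (Ioc_mem_nhdsGT (lt_min one_pos hr₂))).and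
    (hQ2.eventually_shrink_mem_disc hr₃)).exists
  have hd21 : δ₂ ≤ 1 := hd2.2.trans (min_le_left _ _)
  have hd2r : δ₂ ≤ r₂ := hd2.2.trans (min_le_right _ _)
  -- The reflection of the sphere becomes the flip of the solid torus, so that `φ₀` sits between two
  -- flips and can be replaced by `φ` for the flipped curve.
  have e6 : (fun t => reflectOne (stdTorus (φ₀ (-(twist τ (shrink δ₂ (shrink (1 / 2)
      (φ (shrink δ₁ (P t)))))).1, (twist τ (shrink δ₂ (shrink (1 / 2) (φ (shrink δ₁ (P t)))))).2)))) =
      fun t => stdTorus (flipTorus (φ₀ (shrink δ₂ (flipTorus (twist τ (shrink (1 / 2)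
        (φ (shrink δ₁ (P t))))))))) := by
    funext t
    rw [reflectOne_stdTorus, twist_shrink]
    rfl
  -- Flip, `φ`, flip is `reverseGerm φ`, and the twist is pulled through it to the outside.
  have e7 : (fun t => stdTorus (flipTorus (φ (shrink δ₂ (flipTorus (twist τ (shrink (1 / 2)
      (φ (shrink δ₁ (P t))))))))) ) =
      fun t => stdTorus (twist τ (reverseGerm φ (shrink (δ₂ * (1 / 2)) (φ (shrink δ₁ (P t)))))) := by
    funext t
    rw [← shrink_shrink, ← hcomm _ (hmem2 δ₂ ⟨hd2.1.le, le_rfl⟩ t),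
      twist_shrink τ δ₂]
    rfl
  rw [e6] at h6
  rw [e7] at h7
  have t2 := (t1.trans h6).trans h7
  -- open up the fibre
  have hl0 : 0 < δ₂ * (1 / 2) := by linarith [hd2.1]
  have hl1 : δ₂ * (1 / 2) ≤ 1 := by linarith
  have hE := embOn_stdTorus_twist hτ hn
  have hF1 : TorusEmbOn (disc (min r₁ r₄)) fun p => shrink (δ₂ * (1 / 2)) (φ p) :=
    (torusEmbOn_shrink hl0.ne').comp (hφ.mono (disc_mono (min_le_left _ _))) (mapsTo_univ _ _)
  have hF2 : EmbOn (disc (min r₁ r₄)) fun p =>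
      stdTorus (twist τ (reverseGerm φ (shrink (δ₂ * (1 / 2)) (φ p)))) := by
    refine hE.comp (hρ.comp hF1 fun p hp => ?_) (mapsTo_univ _ _)
    have h1 : ‖(φ p).2‖ < 2 := hφ2' p hp
    change ‖(shrink (δ₂ * (1 / 2)) (φ p)).2‖ < r₂
    rw [norm_shrink_snd hl0.le]
    nlinarith
  obtain ⟨hfam, hfam1⟩ := h.torusFamily_shrink hl0 hl1
  have s10 := eventually_nhdsGT_of_exists_Ioc
    ((hE.mono (subset_univ (disc 2))).exists_collaredConcordant_family hfam
      (fun t s hs => (hfam1 t s hs).trans_lt one_lt_two) hP1)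
  have s11 := eventually_nhdsGT_of_exists_Ioc (h.exists_collaredConcordant_spin hτ hn hP1)
  obtain ⟨ε, ⟨h10, h11⟩, hε⟩ := ((s10.and s11).and (Ioc_mem_nhdsGT one_pos)).exists
  have s9 := hF2.collaredConcordant_shrink hP1 hε.1 hε.2 fun u hu t => by
    rw [shrink_shrink]
    have hu0 := hε.1.le.trans hu.1
    exact hmem1 _ ⟨mul_nonneg hu0 hd1.1.le, mul_le_of_le_one_left hd1.1.le hu.2⟩ t
  simp only [zero_mul, add_zero, one_mul, add_sub_cancel, shrink_one] at h10
  have s12 := collaredConcordant_stdTorus_twist_shrink hτ hn hPc hd1.1 hd1.2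
  have s13 := collaredConcordant_stdTorus_twist_shrink hτ hn hP1 hε.1 hε.2
  exact ((((t2.trans s9).trans h10).trans h11).trans s13.symm).trans s12.symm

theorem mainTheorem7
    (C : ℝ → R4) (hC : IsKnot C)
    (U : ℝ → R4) (hU : IsUnknot U)
    (P : ℝ → ℝ × ℂ) (hP : IsPattern P)
    (m r : ℤ)
    -- `Q` is the pattern `S_r(C, P)`, and `K` is the satellite `S_m(C̄, S_r(C, P))`
    (Q : ℝ → ℝ × ℂ) (hQ : IsSatellitePattern r C P Q)
    (K : ℝ → R4) (hK : IsSatellite m (mirrorReverse C) Q K)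
    -- `K'` is the satellite `S_{m+r}(U, P)`
    (K' : ℝ → R4) (hK' : IsSatellite (m + r) U P K') :
    SmoothlyConcordant K K' ∧
      SmoothlyConcordant K (fun t => stdTorus (fullTwists (m + r) (P t))) := by
  -- The staircase is zero on `Icc (1 / 4) (3 / 4)`. Shifted by half a period it makes all turns
  -- around half-integers and none over `Icc (-1 / 4) (1 / 4)`, where the knotted arcs lie.
  obtain ⟨S, hS, hS1, -, hS0⟩ := exists_staircase (ε := 1 / 4) (by norm_num) (by norm_num)
  have hτ : ContDiff ℝ ∞ fun t => ((m + r : ℤ) : ℝ) * S (t + 1 / 2) :=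
    contDiff_const.mul (hS.comp (contDiff_id.add contDiff_const))
  have hn : ∀ t, ((m + r : ℤ) : ℝ) * S (t + 1 + 1 / 2) =
      ((m + r : ℤ) : ℝ) * S (t + 1 / 2) + (m + r : ℤ) := fun t => by
    rw [add_right_comm, hS1]; ring
  have h1 := hK.collaredConcordant_of_isSatellitePattern hP hQ hτ hn fun t ht => by
    rw [hS0 _ ⟨by linarith [ht.1], by linarith [ht.2]⟩, mul_zero]
  have h2 := hK'.collaredConcordant_stdTorus_twist hU hP hτ hn
  -- The concentrated twist is spread out evenly, which gives `fullTwists`.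
  have h3 := collaredConcordant_stdTorus_twist_twist (τ' := fun t => ((m + r : ℤ) : ℝ) * t) hτ
    (contDiff_const.mul contDiff_id) hn (fun t => by ring) hP.torusCurve
  exact ⟨(h1.trans h2.symm).smoothlyConcordant, (h1.trans h3).smoothlyConcordant⟩
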